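/- **Setting.** Let $0<\alpha<1$ and $T,\sigma,\kappa_1,\kappa_2,h_1,h_2>0$. The left and right Caputo derivatives are $${}_0D_t^\alpha f(t)=\frac1{\Gamma(1-\alpha)}\int_0^t (t-s)^{-\alpha}f'(s)\,ds,\qquad {}_TD_t^\alpha f(t)=-\frac1{\Gamma(1-\alpha)}\int_t^T (s-t)^{-\alpha}f'(s)\,ds .$$ *Continuous system (one Dirichlet–Neumann iteration of the error equations, interface data $\omega,\upsilon:[0,T]\to\mathbb R$).* Put $I_1=(-h_1,0)$ and $I_2=(0,h_2)$. For $i=1,2$ and $x\in I_i$, $${}_0D_t^\alpha y_i=\kappa_i\partial_{xx}y_i-\tfrac1\sigma p_i\ \ (0<t\le T),\qquad {}_TD_t^\alpha p_i=\kappa_i\partial_{xx}p_i+y_i\ \ (0\le t<T),\qquad y_i(x,0)=0,\quad p_i(x,T)=0,$$ with $y_1=p_1=0$ at $x=-h_1$; $y_1=\omega$, $p_1=\upsilon$ at $x=0$; $\kappa_2\partial_xy_2=\kappa_1\partial_xy_1$ and $\kappa_2\partial_xp_2=\kappa_1\partial_xp_1$ at $x=0$; $y_2=p_2=0$ at $x=h_2$.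 Solutions are classical in $x$ (differentiable on $\overline{I_i}$, twice differentiable in $I_i$), continuous on $\overline{I_i}\times[0,T]$, and have a continuous time derivative on $\overline{I_i}\times(0,T)$ such that, for some $C$ and some $\beta>\alpha$, $$|\partial_ty_i|\le C\big(t^{\alpha-1}+(T-t)^{\beta-1}\big),\qquad |\partial_tp_i|\le C\big((T-t)^{\alpha-1}+t^{\beta-1}\big).$$ *Meshes.* Nodes $0=t_0<\dots<t_{n+1}=T$: either uniform, $t_j=jT/(n+1)$ with $n\ge1$, or both-sided graded, with $n$ odd, $t_j=\big(\tfrac{j}{(n+1)/2}\big)^{(2-\alpha)/\alpha}\tfrac T2$ and $t_{n+1-j}=T-t_j$ for $0\le j\le (n+1)/2$. *Semi-discrete system.* For $1\le j\le m\le n+1$ let $$d_{m,j}=\frac{(t_m-t_{m-j})^{1-\alpha}-(t_m-t_{m-j+1})^{1-\alpha}}{t_{m-j+1}-t_{m-j}} .$$ The L1 matrix $L$, of order $n+1$, is lower triangular with diagonal entries $L_{m,m}=d_{m,1}/\Gamma(2-\alpha)$ and $L_{m,c}=(d_{m,m-c+1}-d_{m,m-c})/\Gamma(2-\alpha)$ for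 $c<m$. Let $\bar J$, of order $n+1$, have the exchange matrix of order $n$ as its upper left block and zeros elsewhere, and let $$\mathbb L=\begin{bmatrix}L&\frac1\sigma\bar J\\-\bar J&L\end{bmatrix}.$$ For functions $y,p$ of time write $N(y,p)=[y(t_1),\dots,y(t_{n+1});\,p(t_n),\dots,p(t_0)]$. For $\Pi\in\mathbb R^{2n+2}$ the semi-discrete system is $$\mathbb LX_i=\kappa_iX_i''\ \text{ on } I_i,\qquad X_1(-h_1)=0,\quad X_1(0)=\Pi,\quad \kappa_2X_2'(0)=\kappa_1X_1'(0),\quad X_2(h_2)=0 .$$ **Theorem.** Fix one of the two mesh families. 1. *Stability.* For every admissible $n$: the eigenvalues of $\mathbb L$, with algebraic multiplicity, are those of $L+\frac{i}{\sqrt\sigma}\bar J$ together with those of $L-\frac{i}{\sqrt\sigma}\bar J$; all of them have positive real part; $\mathbb L+\xi^2\mathbb I$ is invertible for every $\xi\in\mathbb R$; and for every $\Pi\in\mathbb R^{2n+2}$ the semi-discrete system has a unique solution $(X_1,X_2)$. 2. *Consistency.* Let $(y_1,p_1,y_2,p_2)$ be a solution of the continuous system with data $\omega,\upsilon$. For $i=1,2$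 and $1\le m\le n+1$, consider the truncation errors $\big(L[y_i(x,t_1),\dots,y_i(x,t_{n+1})]^{\mathsf T}\big)_m-{}_0D_t^\alpha y_i(x,t_m)$ and $\big(L[p_i(x,t_n),\dots,p_i(x,t_0)]^{\mathsf T}\big)_m-{}_TD_t^\alpha p_i(x,t_{n+1-m})$. They are bounded uniformly in $n$, $m$ and $x\in\overline{I_i}$, and for every $\delta>0$ they tend to $0$ as $n\to\infty$, uniformly over $x\in\overline{I_i}$ and all $m$ with $t_m\ge\delta$. 3. *Convergence.* For the same solution, let $(X_1,X_2)$ be the semi-discrete solution with $\Pi=N(\omega,\upsilon)$. Then, as $n\to\infty$ through admissible values, $$\max_{i=1,2}\ \sup_{x\in\overline{I_i}}\big\|X_i(x)-N\big(y_i(x,\cdot),p_i(x,\cdot)\big)\big\|_\infty\longrightarrow0 .$$ -/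

import Mathlib

open Set Filter Topology Matrix

noncomputable section

/-- Left-sided Caputo derivative of order `α ∈ (0,1)` on `[0, t]`. -/
def caputoLeft (α : ℝ) (f : ℝ → ℝ) (t : ℝ) : ℝ :=
  (Real.Gamma (1 - α))⁻¹ * ∫ s in (0 : ℝ)..t, (t - s) ^ (-α) * deriv f s

/-- Right-sided Caputo derivative of order `α ∈ (0,1)` on `[t, T]`. -/
def caputoRight (α T : ℝ) (f : ℝ → ℝ) (t : ℝ) : ℝ :=
  -((Real.Gamma (1 - α))⁻¹ * ∫ s in t..T, (s - t) ^ (-α) * deriv f s)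

/-- The two families of time meshes. -/
inductive TimeMesh where
  | uniform
  | bothSidedGraded

/-- Which `n` are allowed: all positive `n` for the uniform mesh, odd `n` for the graded mesh. -/
def TimeMesh.Admissible : TimeMesh → ℕ → Prop
  | .uniform, n => 1 ≤ n
  | .bothSidedGraded, n => Odd n

/-- The nodes `t_0 < t_1 < ⋯ < t_{n+1}` of the mesh of `[0,T]` with `n + 1` subintervals
(only the indices `j ≤ n + 1` matter). The graded mesh is refined, with exponent `(2 - α)/α`,
towards `0` on `[0, T/2]`, and is reflected onto `[T/2, T]`. -/
def TimeMesh.node (α T : ℝ) (n : ℕ) : TimeMesh → ℕ → ℝ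
  | .uniform, j => (j : ℝ) / ((n : ℝ) + 1) * T
  | .bothSidedGraded, j =>
      if 2 * j ≤ n + 1 then
        ((j : ℝ) / (((n : ℝ) + 1) / 2)) ^ ((2 - α) / α) * (T / 2)
      else
        T - (((n : ℝ) + 1 - (j : ℝ)) / (((n : ℝ) + 1) / 2)) ^ ((2 - α) / α) * (T / 2)

/-- The L1 coefficients `d_{m,j}`, for `1 ≤ j ≤ m`, on the nodes `t`. -/
def l1Coeff (α : ℝ) (t : ℕ → ℝ) (m j : ℕ) : ℝ :=
  ((t m - t (m - j)) ^ (1 - α) - (t m - t (m - j + 1)) ^ (1 - α)) /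
    (t (m - j + 1) - t (m - j))

/-- The lower triangular matrix `L` of the L1 scheme (for a zero initial value). With the
one-based indices `m = i + 1` (row) and `c = k + 1` (column), the entry is
`(d_{m,m-c+1} - d_{m,m-c}) / Γ(2-α)` for `c < m` and `d_{m,1} / Γ(2-α)` for `c = m`. -/
def l1Matrix (α : ℝ) (t : ℕ → ℝ) (n : ℕ) : Matrix (Fin (n + 1)) (Fin (n + 1)) ℝ :=
  Matrix.of fun i k =>
    (Real.Gamma (2 - α))⁻¹ *
      (if (k : ℕ) < (i : ℕ) then
        l1Coeff α t ((i : ℕ) + 1) ((i : ℕ) - (k : ℕ) + 1) -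
          l1Coeff α t ((i : ℕ) + 1) ((i : ℕ) - (k : ℕ))
      else if (k : ℕ) = (i : ℕ) then l1Coeff α t ((i : ℕ) + 1) 1
      else 0)

/-- The matrix `J̄` of order `n + 1`: the exchange matrix of order `n` in the upper left corner,
and a zero last row and column. -/
def exchangeBar (n : ℕ) : Matrix (Fin (n + 1)) (Fin (n + 1)) ℝ :=
  Matrix.of fun i k => if (i : ℕ) + (k : ℕ) + 1 = n then 1 else 0

/-- Index set of the combined vector `[Y; P]`. -/
abbrev StateAdjointIndex (n : ℕ) : Type := Fin (n + 1) ⊕ Fin (n + 1)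

/-- The combined matrix `𝕃 = [L, J̄/σ; -J̄, L]`. -/
def coupledMatrix (α σ : ℝ) (t : ℕ → ℝ) (n : ℕ) :
    Matrix (StateAdjointIndex n) (StateAdjointIndex n) ℝ :=
  Matrix.fromBlocks (l1Matrix α t n) (σ⁻¹ • exchangeBar n)
    (-exchangeBar n) (l1Matrix α t n)

/-- The complex matrix `L + z J̄`. -/
def shiftedMatrix (α : ℝ) (t : ℕ → ℝ) (n : ℕ) (z : ℂ) :
    Matrix (Fin (n + 1)) (Fin (n + 1)) ℂ :=
  (l1Matrix α t n).map Complex.ofReal + z • (exchangeBar n).map Complex.ofReal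

/-- The eigenvalues of a complex matrix, with algebraic multiplicity. -/
def eigenvalueMultiset {ι : Type} [Fintype ι] [DecidableEq ι] (A : Matrix ι ι ℂ) : Multiset ℂ :=
  A.charpoly.roots

/-- The vector `[y(t_1), …, y(t_{n+1}); p(t_n), …, p(t_0)]` of nodal values: the state forward
in time, the adjoint backward in time. -/
def nodalVector (t : ℕ → ℝ) (n : ℕ) (y p : ℝ → ℝ) : StateAdjointIndex n → ℝ :=
  Sum.elim (fun i => y (t ((i : ℕ) + 1))) (fun i => p (t (n - (i : ℕ))))

/-- The truncation error of the L1 scheme: at index `inl i` the L1 value minus the left Caputo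
derivative of `y` at `t_{i+1}`, at index `inr i` the L1 value (of the reversed nodal vector)
minus the right Caputo derivative of `p` at `t_{n-i}`. -/
def l1Truncation (α T : ℝ) (t : ℕ → ℝ) (n : ℕ) (y p : ℝ → ℝ) : StateAdjointIndex n → ℝ :=
  Sum.elim
    (fun i => (l1Matrix α t n *ᵥ fun k => y (t ((k : ℕ) + 1))) i
      - caputoLeft α y (t ((i : ℕ) + 1)))
    (fun i => (l1Matrix α t n *ᵥ fun k => p (t (n - (k : ℕ)))) i
      - caputoRight α T p (t (n - (i : ℕ))))

/-- `f` is differentiable on `[a,b]` (one-sidedly at the end points), and twice differentiable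
on `(a,b)`. -/
def TwiceDifferentiable {E : Type} [NormedAddCommGroup E] [NormedSpace ℝ E]
    (a b : ℝ) (f : ℝ → E) : Prop :=
  DifferentiableOn ℝ f (Icc a b) ∧ DifferentiableOn ℝ (deriv f) (Ioo a b)

/-- Time regularity, on `[a,b] × [0,T]`, of a solution of a forward fractional problem, with an
initial layer at `t = 0`: continuous up to the boundary, continuously differentiable in time for
`0 < t < T`, with `|∂ₜ u| ≤ C (t^(α-1) + (T-t)^(β-1))` for some `C` and some `β > α`. -/
structure ForwardTimeRegular (α T a b : ℝ) (u : ℝ → ℝ → ℝ) : Prop where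
  continuousOn : ContinuousOn (fun z : ℝ × ℝ => u z.1 z.2) (Icc a b ×ˢ Icc 0 T)
  differentiableAt : ∀ x ∈ Icc a b, ∀ t ∈ Ioo 0 T, DifferentiableAt ℝ (u x) t
  continuousOn_deriv :
    ContinuousOn (fun z : ℝ × ℝ => deriv (u z.1) z.2) (Icc a b ×ˢ Ioo 0 T)
  deriv_bound : ∃ C β : ℝ, α < β ∧ ∀ x ∈ Icc a b, ∀ t ∈ Ioo 0 T,
    |deriv (u x) t| ≤ C * (t ^ (α - 1) + (T - t) ^ (β - 1))

/-- The same regularity with time reversed. -/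
def BackwardTimeRegular (α T a b : ℝ) (u : ℝ → ℝ → ℝ) : Prop :=
  ForwardTimeRegular α T a b (fun x t => u x (T - t))

/-- `(y, p)` satisfies on `(a,b)`, for a diffusion coefficient `κ`, the coupled equations
`₀D_t^α y = κ ∂ₓₓ y - p/σ`, `_T D_t^α p = κ ∂ₓₓ p + y`, with `y = 0` at `t = 0` and
`p = 0` at `t = T`. -/
structure SolvesStateAdjoint (α T σ κ a b : ℝ) (y p : ℝ → ℝ → ℝ) : Prop where
  state_regular : ForwardTimeRegular α T a b y
  adjoint_regular : BackwardTimeRegular α T a b p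
  state_space : ∀ t ∈ Ioc 0 T, TwiceDifferentiable a b (fun x => y x t)
  adjoint_space : ∀ t ∈ Ico 0 T, TwiceDifferentiable a b (fun x => p x t)
  state_eq : ∀ x ∈ Ioo a b, ∀ t ∈ Ioc 0 T,
    caputoLeft α (y x) t = κ * deriv (deriv fun x' => y x' t) x - p x t / σ
  adjoint_eq : ∀ x ∈ Ioo a b, ∀ t ∈ Ico 0 T,
    caputoRight α T (p x) t = κ * deriv (deriv fun x' => p x' t) x + y x t
  state_initial : ∀ x ∈ Icc a b, y x 0 = 0
  adjoint_final : ∀ x ∈ Icc a b, p x T = 0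

/-- One Dirichlet-Neumann iteration of the continuous error equations, with interface data
`ω` (state) and `υ` (adjoint): a Dirichlet problem on `(-h₁,0)` and then a problem on `(0,h₂)`
with the flux at `0` prescribed by the first one. Functions have arguments `x`, `t`. -/
structure IsErrorSolution (α T σ κ₁ κ₂ h₁ h₂ : ℝ) (ω υ : ℝ → ℝ)
    (y₁ p₁ y₂ p₂ : ℝ → ℝ → ℝ) : Prop where
  left : SolvesStateAdjoint α T σ κ₁ (-h₁) 0 y₁ p₁
  right : SolvesStateAdjoint α T σ κ₂ 0 h₂ y₂ p₂
  state_left_outer : ∀ t ∈ Icc 0 T, y₁ (-h₁) t = 0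
  adjoint_left_outer : ∀ t ∈ Icc 0 T, p₁ (-h₁) t = 0
  state_interface : ∀ t ∈ Icc 0 T, y₁ 0 t = ω t
  adjoint_interface : ∀ t ∈ Icc 0 T, p₁ 0 t = υ t
  state_flux : ∀ t ∈ Ioc 0 T,
    κ₂ * derivWithin (fun x => y₂ x t) (Icc 0 h₂) 0 =
      κ₁ * derivWithin (fun x => y₁ x t) (Icc (-h₁) 0) 0
  adjoint_flux : ∀ t ∈ Ico 0 T,
    κ₂ * derivWithin (fun x => p₂ x t) (Icc 0 h₂) 0 =
      κ₁ * derivWithin (fun x => p₁ x t) (Icc (-h₁) 0) 0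
  state_right_outer : ∀ t ∈ Icc 0 T, y₂ h₂ t = 0
  adjoint_right_outer : ∀ t ∈ Icc 0 T, p₂ h₂ t = 0

/-- One Dirichlet-Neumann iteration of the semi-discrete (continuous in space) system with the
matrix `A` and the interface vector `g`: `A X₁ = κ₁ X₁''` on `(-h₁,0)`, `X₁(-h₁) = 0`,
`X₁(0) = g`, and `A X₂ = κ₂ X₂''` on `(0,h₂)`, `κ₂ X₂'(0) = κ₁ X₁'(0)`, `X₂(h₂) = 0`. -/
structure IsSemiDiscreteSolution {ι : Type} [Fintype ι] (A : Matrix ι ι ℝ)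
    (κ₁ κ₂ h₁ h₂ : ℝ) (g : ι → ℝ) (X₁ X₂ : ℝ → ι → ℝ) : Prop where
  left_space : TwiceDifferentiable (-h₁) 0 X₁
  right_space : TwiceDifferentiable 0 h₂ X₂
  left_eq : ∀ x ∈ Ioo (-h₁) 0, A *ᵥ X₁ x = κ₁ • deriv (deriv X₁) x
  right_eq : ∀ x ∈ Ioo 0 h₂, A *ᵥ X₂ x = κ₂ • deriv (deriv X₂) x
  left_outer : X₁ (-h₁) = 0
  interface : X₁ 0 = g
  flux : κ₂ • derivWithin X₂ (Icc 0 h₂) 0 = κ₁ • derivWithin X₁ (Icc (-h₁) 0) 0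
  right_outer : X₂ h₂ = 0

/-- Consistency of the L1 scheme for `(y, p)` on `[a,b]`: the truncation errors are bounded
uniformly in the mesh, and, away from the initial layers, they tend to zero uniformly. -/
def L1Consistent (α T a b : ℝ) (mesh : TimeMesh) (y p : ℝ → ℝ → ℝ) : Prop :=
  (∃ M : ℝ, ∀ n, mesh.Admissible n → ∀ x ∈ Icc a b, ∀ j,
    |l1Truncation α T (mesh.node α T n) n (y x) (p x) j| ≤ M) ∧
  ∀ δ > 0, ∀ ε > 0, ∃ n₀ : ℕ, ∀ n ≥ n₀, mesh.Admissible n → ∀ x ∈ Icc a b,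
    ∀ i : Fin (n + 1), δ ≤ mesh.node α T n ((i : ℕ) + 1) →
      |l1Truncation α T (mesh.node α T n) n (y x) (p x) (Sum.inl i)| ≤ ε ∧
      |l1Truncation α T (mesh.node α T n) n (y x) (p x) (Sum.inr i)| ≤ ε

end

/-! Both mesh families are symmetric with log-concave step sizes, and stability uses nothing else
about them. The entries of the L1 matrix are differences of chord slopes of the concave function `u
^ (1 - α)`, so its off-diagonal entries are nonpositive and its row sums are bounded below. Weight
component `i` by the power `α / 2` of the product of the two steps adjacent to its node. Along a
diagonal of the matrix the chord slopes decrease at least as fast as the weights can grow, so the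
weighted column sums are nonnegative (`weighted_column_nonneg`) and the matrix is coercive in the
weighted inner product (`weighted_coercive`). Since the mesh is symmetric, the weights are invariant
under the reversal performed by `exchangeBar`; the two coupling terms then cancel and the coupled
matrix is coercive as well (`coupled_coercive`). This gives the sign of the eigenvalues and the
invertibility. It also makes the weighted norm of a solution of `κ X'' = A X` convex in space, which
gives uniqueness and, by shooting, existence.

For consistency, the L1 value is the Caputo derivative of the piecewise linear interpolant, so the
truncation error is the integral of the kernel against the difference quotients minus the derivative
(`abs_truncation_le`). Neighbouring steps are comparable, so the quotients obey the same singular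
bound as the derivative. This bounds the error. It is small away from `t = 0` because the layers
contribute little and the derivative is uniformly continuous elsewhere.

For convergence, the truncation error is only known to be bounded near `t = 0`, so two norms are
combined. In the weighted norm, scaled to bounded total mass, the few bad components hardly count,
and the energy estimate makes the error and its interface flux small. The maximum norm is then
reached with a cutoff in time of width `δ` (`exists_cutoff`): inside the window the row sums are of
size `δ ^ (-α)`, as large as desired, and the maximum principle divides the bounded truncation error
by this rate. The coupling and the near part of the commutator with the cutoff are absorbed by the
large rate; the far part is controlled by the weighted norm. See `coupled_sup_dirichlet`,
`coupled_sup_neumann` and `IsErrorSolution.error_bound`. -/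

/-! ### Chord slopes of a concave power, and the L1 weights on log-concave meshes. -/

/-- Chord slope of `u ↦ u ^ (1 - α)`. -/
noncomputable def chordSlope (α u v : ℝ) : ℝ := (v ^ (1 - α) - u ^ (1 - α)) / (v - u)

/-- Concavity: the slope of a chord drops when either end moves to the right. The ends are moved one
at a time, the right one first. -/
lemma chordSlope_anti {α : ℝ} (h₀ : 0 < α) (h₁ : α < 1) {u v u' v' : ℝ} (hu : 0 ≤ u)
    (huv : u < v) (huv' : u' < v') (huu : u ≤ u') (hvv : v ≤ v') :
    chordSlope α u' v' ≤ chordSlope α u v := by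
  have hc : ConcaveOn ℝ (Ici 0) fun x : ℝ => x ^ (1 - α) :=
    Real.concaveOn_rpow (by linarith) (by linarith)
  have key : ∀ {x y z : ℝ}, 0 ≤ x → x < y → y ≤ z →
      chordSlope α x z ≤ chordSlope α x y ∧ chordSlope α y z * (z - y) ≤
        chordSlope α x y * (z - y) := by
    intro x y z hx hxy hyz
    rcases hyz.eq_or_lt with rfl | hyz
    · simp
    have h := hc.slope_anti_adjacent (x := x) (y := y) (z := z) hx
      (show (0:ℝ) ≤ z by linarith) hxy hyz
    have h1 : chordSlope α y z ≤ chordSlope α x y := h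
    refine ⟨?_, mul_le_mul_of_nonneg_right h1 (by linarith)⟩
    have e1 : chordSlope α y z * (z - y) = z ^ (1 - α) - y ^ (1 - α) :=
      div_mul_cancel₀ _ (by linarith)
    have e2 : chordSlope α x y * (y - x) = y ^ (1 - α) - x ^ (1 - α) :=
      div_mul_cancel₀ _ (by linarith)
    have h2 := mul_le_mul_of_nonneg_right h1 (show 0 ≤ z - y by linarith)
    rw [chordSlope, div_le_iff₀ (by linarith)]
    linarith
  have step1 : chordSlope α u v' ≤ chordSlope α u v := (key hu huv hvv).1
  refine le_trans ?_ step1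
  rcases huu.eq_or_lt with rfl | huu
  · exact le_rfl
  have h := hc.slope_anti_adjacent (x := u) (y := u') (z := v') hu
      (show (0:ℝ) ≤ v' by linarith) huu huv'
  have h1 : chordSlope α u' v' ≤ chordSlope α u u' := h
  have e1 : chordSlope α u' v' * (v' - u') = v' ^ (1 - α) - u' ^ (1 - α) :=
    div_mul_cancel₀ _ (by linarith)
  have e2 : chordSlope α u u' * (u' - u) = u' ^ (1 - α) - u ^ (1 - α) :=
    div_mul_cancel₀ _ (by linarith)
  have h2 := mul_le_mul_of_nonneg_right h1 (show 0 ≤ u' - u by linarith)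
  change _ ≤ _ / _
  rw [le_div_iff₀ (by linarith : 0 < v' - u)]
  linarith

lemma chordSlope_scale {α q u v : ℝ} (hq : 0 < q) (hu : 0 ≤ u) (huv : u < v) :
    chordSlope α (q * u) (q * v) = q ^ (-α) * chordSlope α u v := by
  have e : q ^ (1 - α) = q * q ^ (-α) := by
    rw [sub_eq_add_neg, Real.rpow_add hq, Real.rpow_one]
  have : v - u ≠ 0 := by linarith
  rw [chordSlope, chordSlope, Real.mul_rpow hq.le hu, Real.mul_rpow hq.le (by linarith), e,
    ← mul_sub, ← mul_sub]
  field_simp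

/-- This and the next bound are Bernoulli's inequality with exponent `1 - α`, that is, the tangents
to the concave power at `v` and at `u`. -/
lemma chordSlope_lower {α : ℝ} (h₀ : 0 < α) (h₁ : α < 1) {u v : ℝ} (hu : 0 ≤ u) (huv : u < v) :
    (1 - α) * v ^ (-α) ≤ chordSlope α u v := by
  have hv : 0 < v := by linarith
  have hb := rpow_one_add_le_one_add_mul_self (s := u / v - 1)
    (by have := div_nonneg hu hv.le; linarith) (p := 1 - α) (by linarith) (by linarith)
  rw [add_sub_cancel, Real.div_rpow hu hv.le, div_le_iff₀ (Real.rpow_pos_of_pos hv _)] at hb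
  rw [chordSlope, le_div_iff₀ (by linarith)]
  have e : v ^ (1 - α) = v * v ^ (-α) := by
    rw [sub_eq_add_neg, Real.rpow_add hv, Real.rpow_one]
  have : (1 + (1 - α) * (u / v - 1)) * v ^ (1 - α)
      = v ^ (1 - α) - (1 - α) * v ^ (-α) * (v - u) := by
    rw [e]; field_simp; ring
  linarith

lemma chordSlope_upper {α : ℝ} (h₀ : 0 < α) (h₁ : α < 1) {u v : ℝ} (hu : 0 < u) (huv : u < v) :
    chordSlope α u v ≤ (1 - α) * u ^ (-α) := by
  have hv : 0 < v := by linarith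
  have hb := rpow_one_add_le_one_add_mul_self (s := v / u - 1)
    (by have := div_nonneg hv.le hu.le; linarith) (p := 1 - α) (by linarith) (by linarith)
  rw [add_sub_cancel, Real.div_rpow hv.le hu.le, div_le_iff₀ (Real.rpow_pos_of_pos hu _)] at hb
  rw [chordSlope, div_le_iff₀ (by linarith)]
  have e : u ^ (1 - α) = u * u ^ (-α) := by
    rw [sub_eq_add_neg, Real.rpow_add hu, Real.rpow_one]
  have : (1 + (1 - α) * (v / u - 1)) * u ^ (1 - α)
      = u ^ (1 - α) + (1 - α) * u ^ (-α) * (v - u) := by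
    rw [e]; field_simp
  linarith

/-- The slope, on the cell `[t_k, t_{k+1}]`, of `s ↦ -(t_{i+1} - s) ^ (1 - α)`; zero for the cells
to the right of `t_{i+1}`. -/
noncomputable def cellWeight (α : ℝ) (t : ℕ → ℝ) (i k : ℕ) : ℝ :=
  if k ≤ i then chordSlope α (t (i + 1) - t (k + 1)) (t (i + 1) - t k) else 0

/-- In this form the row sums telescope, and the sign of an off-diagonal entry is the monotonicity
of `cellWeight` in the cell. -/
lemma l1Matrix_apply (α : ℝ) (t : ℕ → ℝ) (n : ℕ) (i k : Fin (n + 1)) :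
    l1Matrix α t n i k =
      (Real.Gamma (2 - α))⁻¹ * (cellWeight α t i k - cellWeight α t i (k + 1)) := by
  have e : ∀ k' ≤ (i : ℕ), ((t (i + 1) - t k') ^ (1 - α) - (t (i + 1) - t (k' + 1)) ^ (1 - α)) /
      (t (k' + 1) - t k') = cellWeight α t i k' := by
    intro k' hk
    rw [cellWeight, if_pos hk, chordSlope]
    congr 1; ring
  simp only [l1Matrix, Matrix.of_apply, l1Coeff]
  congr 1
  rcases lt_trichotomy (k : ℕ) (i : ℕ) with h | h | h
  · rw [if_pos h, ← e _ h.le, ← e _ h, show (i : ℕ) + 1 - (i - k + 1) = k by omega,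
      show (i : ℕ) + 1 - (i - k) = k + 1 by omega]
  · rw [if_neg (by omega), if_pos h, ← e _ h.le, cellWeight, if_neg (by omega),
      show (i : ℕ) + 1 - 1 = k by omega, sub_zero]
  · rw [if_neg (by omega), if_neg (by omega), cellWeight, cellWeight, if_neg (by omega),
      if_neg (by omega), sub_zero]

/-- The properties of a mesh `0 = t_0 < ⋯ < t_{n+1} = T` that give the stability of the
L1 scheme: it is symmetric, and its step sizes form a log-concave sequence. -/
structure LogConcaveMesh (T : ℝ) (n : ℕ) (t : ℕ → ℝ) : Prop where
  one_le : 1 ≤ n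
  zero : t 0 = 0
  lt_succ : ∀ j ≤ n, t j < t (j + 1)
  symm : ∀ j ≤ n + 1, t (n + 1 - j) = T - t j
  logConcave : ∀ j, j + 2 ≤ n →
    (t (j + 1) - t j) * (t (j + 3) - t (j + 2)) ≤ (t (j + 2) - t (j + 1)) ^ 2

namespace LogConcaveMesh

variable {T α : ℝ} {n : ℕ} {t : ℕ → ℝ}

lemma last (h : LogConcaveMesh T n t) : t (n + 1) = T := by
  have := h.symm 0 (by omega)
  rw [h.zero] at this
  simpa using this

lemma lt (h : LogConcaveMesh T n t) {j k : ℕ} (hjk : j < k) (hk : k ≤ n + 1) : t j < t k := by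
  induction k, hjk using Nat.le_induction with
  | base => exact h.lt_succ _ (by omega)
  | succ m hm ih => exact (ih (by omega)).trans (h.lt_succ m (by omega))

lemma le (h : LogConcaveMesh T n t) {j k : ℕ} (hjk : j ≤ k) (hk : k ≤ n + 1) : t j ≤ t k := by
  rcases hjk.eq_or_lt with rfl | h'
  · exact le_rfl
  · exact (h.lt h' hk).le

lemma nonneg (h : LogConcaveMesh T n t) {j : ℕ} (hj : j ≤ n + 1) : 0 ≤ t j := by
  rw [← h.zero]; exact h.le (Nat.zero_le _) hj

lemma le_last (h : LogConcaveMesh T n t) {j : ℕ} (hj : j ≤ n + 1) : t j ≤ T := by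
  rw [← h.last]; exact h.le hj le_rfl

lemma pos (h : LogConcaveMesh T n t) : 0 < T := by
  rw [← h.last, ← h.zero]; exact h.lt (Nat.succ_pos _) le_rfl

/-- Ratios of consecutive steps decrease. -/
lemma ratio_anti (h : LogConcaveMesh T n t) {j k : ℕ} (hjk : j ≤ k) (hk : k + 1 ≤ n) :
    (t (k + 2) - t (k + 1)) * (t (j + 1) - t j) ≤ (t (j + 2) - t (j + 1)) * (t (k + 1) - t k) := by
  induction k, hjk using Nat.le_induction with
  | base => exact le_rfl
  | succ m hm ih =>
    have h1 := ih (by omega)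
    have h2 := h.logConcave m (by omega)
    have p0 := h.lt_succ j (by omega)
    have p1 := h.lt_succ (j + 1) (by omega)
    have p2 := h.lt_succ m (by omega)
    have p3 := h.lt_succ (m + 1) (by omega)
    have p4 := h.lt_succ (m + 2) (by omega)
    set a := t (j + 1) - t j
    set b := t (j + 2) - t (j + 1)
    set c := t (m + 1) - t m
    set d := t (m + 2) - t (m + 1)
    set e := t (m + 3) - t (m + 2)
    have ha : 0 < a := sub_pos.2 p0
    have hb : 0 < b := sub_pos.2 p1
    have hc : 0 < c := sub_pos.2 p2
    have hd : 0 < d := sub_pos.2 p3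
    change e * a ≤ b * d
    have : c * (e * a) ≤ c * (b * d) := by
      calc c * (e * a) = (c * e) * a := by ring
        _ ≤ d ^ 2 * a := by gcongr
        _ = d * (d * a) := by ring
        _ ≤ d * (b * c) := by gcongr
        _ = c * (b * d) := by ring
    exact le_of_mul_le_mul_left this hc

/-- The tail of the mesh, shifted by one cell, is stretched by the last ratio of steps. -/
lemma stretch (h : LogConcaveMesh T n t) {i k : ℕ} (hk : k ≤ i + 1) (hi : i + 1 ≤ n) :
    (t (i + 2) - t (i + 1)) * (t (i + 1) - t k) ≤
      (t (i + 2) - t (k + 1)) * (t (i + 1) - t i) := by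
  obtain ⟨d, hd⟩ : ∃ d, k + d = i + 1 := ⟨i + 1 - k, by omega⟩
  induction d generalizing k with
  | zero => obtain rfl : k = i + 1 := by omega
            simp
  | succ d ih =>
    have h1 := ih (k := k + 1) (by omega) (by omega)
    -- Every step ratio before the last one is at least the last one, so each further cell preserves
    -- the inequality.
    have h2 := h.ratio_anti (j := k) (k := i) (by omega) hi
    linarith

lemma cellWeight_eq (α : ℝ) (t : ℕ → ℝ) {i k : ℕ} (hk : k ≤ i) :
    cellWeight α t i k = chordSlope α (t (i + 1) - t (k + 1)) (t (i + 1) - t k) := if_pos hk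

lemma cellWeight_nonneg (h : LogConcaveMesh T n t) (h₀ : 0 < α) (h₁ : α < 1) {i : ℕ} (hi : i ≤ n)
    (k : ℕ) : 0 ≤ cellWeight α t i k := by
  unfold cellWeight
  split_ifs with hk
  · have h1 := h.lt (show k < k + 1 by omega) (by omega)
    have h2 := h.le (show k + 1 ≤ i + 1 by omega) (by omega)
    exact (mul_nonneg (by linarith) (Real.rpow_nonneg (by linarith) _)).trans
      (chordSlope_lower h₀ h₁ (by linarith) (by linarith))
  · exact le_rfl

lemma cellWeight_lower (h : LogConcaveMesh T n t) (h₀ : 0 < α) (h₁ : α < 1) {i k : ℕ} (hi : i ≤ n)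
    (hk : k ≤ i) : (1 - α) * (t (i + 1) - t k) ^ (-α) ≤ cellWeight α t i k := by
  rw [cellWeight_eq α t hk]
  have h1 := h.lt (show k < k + 1 by omega) (by omega)
  have h2 := h.le (show k + 1 ≤ i + 1 by omega) (by omega)
  exact chordSlope_lower h₀ h₁ (by linarith) (by linarith)

lemma cellWeight_upper (h : LogConcaveMesh T n t) (h₀ : 0 < α) (h₁ : α < 1) {i k : ℕ} (hi : i ≤ n)
    (hk : k < i) : cellWeight α t i k ≤ (1 - α) * (t (i + 1) - t (k + 1)) ^ (-α) := by
  rw [cellWeight_eq α t hk.le]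
  have h1 := h.lt (show k < k + 1 by omega) (by omega)
  have h2 := h.lt (show k + 1 < i + 1 by omega) (by omega)
  exact chordSlope_upper h₀ h₁ (by linarith) (by linarith)

lemma cellWeight_mono (h : LogConcaveMesh T n t) (h₀ : 0 < α) (h₁ : α < 1) {i k : ℕ} (hi : i ≤ n)
    (hk : k < i) : cellWeight α t i k ≤ cellWeight α t i (k + 1) := by
  rw [cellWeight_eq α t hk.le, cellWeight_eq α t hk]
  have h1 := h.lt (show k < k + 1 by omega) (by omega)
  have h2 := h.lt (show k + 1 < k + 2 by omega) (by omega)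
  have h3 := h.le (show k + 2 ≤ i + 1 by omega) (by omega)
  exact chordSlope_anti h₀ h₁ (by change 0 ≤ t (i + 1) - t (k + 2); linarith)
    (by change t (i + 1) - t (k + 2) < _; linarith) (by linarith)
    (by change t (i + 1) - t (k + 2) ≤ _; linarith) (by linarith)

/-- Moving one cell to the right along a diagonal changes the cell weights by at most the
power `-α` of the ratio of steps. -/
lemma cellWeight_diagonal (h : LogConcaveMesh T n t) (h₀ : 0 < α) (h₁ : α < 1) {i k : ℕ}
    (hi : i + 1 ≤ n) (hk : k ≤ i) :
    cellWeight α t (i + 1) (k + 1) ≤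
      ((t (i + 2) - t (i + 1)) / (t (i + 1) - t i)) ^ (-α) * cellWeight α t i k := by
  rw [cellWeight_eq α t hk, cellWeight_eq α t (Nat.succ_le_succ hk)]
  have p0 := h.lt_succ i (by omega)
  have p1 := h.lt_succ (i + 1) (by omega)
  have h1 := h.lt (show k < k + 1 by omega) (by omega)
  have h1' := h.lt (show k + 1 < k + 2 by omega) (by omega)
  have h2 := h.le (show k + 1 ≤ i + 1 by omega) (by omega)
  have hq : 0 < (t (i + 2) - t (i + 1)) / (t (i + 1) - t i) :=
    div_pos (sub_pos.2 p1) (sub_pos.2 p0)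
  rw [← chordSlope_scale hq (by linarith) (by linarith)]
  -- By `stretch`, scaling the ends of the old chord by the step ratio puts them to the left of the
  -- ends of the new one. Concavity and the homogeneity of the power then give the factor.
  have st : ∀ k' ≤ i + 1, (t (i + 2) - t (i + 1)) / (t (i + 1) - t i) * (t (i + 1) - t k') ≤
      t (i + 2) - t (k' + 1) := by
    intro k' hk'
    rw [div_mul_eq_mul_div, div_le_iff₀ (sub_pos.2 p0)]
    exact h.stretch hk' hi
  refine chordSlope_anti h₀ h₁ (mul_nonneg hq.le (by linarith))
    (mul_lt_mul_of_pos_left (by linarith) hq) ?_ (st (k + 1) (by omega)) (st k (by omega))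
  change t (i + 2) - t (k + 2) < t (i + 2) - t (k + 1)
  linarith

end LogConcaveMesh

/-! ### Coercivity of the L1 matrix and of the coupled matrix in a weighted inner product. -/

/-- A matrix with nonpositive off-diagonal entries whose weighted column sums are nonnegative
inherits coercivity, in the weighted inner product, from its row sums. -/
lemma weighted_coercive {ι : Type*} [Fintype ι] (A : Matrix ι ι ℝ) (w v : ι → ℝ) (lam : ℝ)
    (hoff : ∀ i k, i ≠ k → A i k ≤ 0) (hrow : ∀ i, lam ≤ ∑ k, A i k)
    (hw : ∀ i, 0 ≤ w i) (hcol : ∀ k, 0 ≤ ∑ i, w i * A i k) :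
    lam / 2 * ∑ i, w i * v i ^ 2 ≤ ∑ i, w i * v i * (A *ᵥ v) i := by
  -- For `A i k ≤ 0` one has `2 v_i v_k A_ik ≥ A_ik (v_i ^ 2 + v_k ^ 2)`. Summation turns the two
  -- squares into row sums and weighted column sums.
  have h1 : ∀ i, (∑ k, A i k) * v i ^ 2 + ∑ k, A i k * v k ^ 2 ≤ 2 * (v i * (A *ᵥ v) i) := by
    intro i
    simp only [Matrix.mulVec, dotProduct, Finset.sum_mul, Finset.mul_sum]
    rw [← Finset.sum_add_distrib]
    refine Finset.sum_le_sum fun k _ => ?_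
    by_cases hik : i = k
    · subst hik; apply le_of_eq; ring
    · nlinarith [hoff i k hik, mul_nonneg (neg_nonneg.2 (hoff i k hik)) (sq_nonneg (v i - v k))]
  have h2 : ∑ i, w i * (lam * v i ^ 2 + ∑ k, A i k * v k ^ 2) ≤
      2 * ∑ i, w i * v i * (A *ᵥ v) i := by
    rw [Finset.mul_sum]
    refine Finset.sum_le_sum fun i _ => ?_
    have := h1 i
    have h3 := mul_le_mul_of_nonneg_right (hrow i) (sq_nonneg (v i))
    calc w i * (lam * v i ^ 2 + ∑ k, A i k * v k ^ 2) ≤ w i * (2 * (v i * (A *ᵥ v) i)) :=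
          mul_le_mul_of_nonneg_left (by linarith) (hw i)
      _ = _ := by ring
  have h3 : 0 ≤ ∑ i, w i * ∑ k, A i k * v k ^ 2 := by
    simp only [Finset.mul_sum]
    rw [Finset.sum_comm]
    refine Finset.sum_nonneg fun k _ => ?_
    have := mul_nonneg (hcol k) (sq_nonneg (v k))
    rw [Finset.sum_mul] at this
    simpa only [mul_assoc] using this
  have h4 : ∑ i, w i * (lam * v i ^ 2 + ∑ k, A i k * v k ^ 2) =
      lam * ∑ i, w i * v i ^ 2 + ∑ i, w i * ∑ k, A i k * v k ^ 2 := by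
    rw [Finset.mul_sum, ← Finset.sum_add_distrib]
    exact Finset.sum_congr rfl fun i _ => by ring
  linarith

/-- Weights that make the L1 matrix of a log-concave mesh accretive. They are invariant under
the reversal of the first `n` indices. -/
noncomputable def energyWeight (α : ℝ) (t : ℕ → ℝ) (n i : ℕ) : ℝ :=
  if i < n then ((t (i + 1) - t i) * (t (i + 2) - t (i + 1))) ^ (α / 2)
  else ((t n - t (n - 1)) * (t (n + 1) - t n)) ^ (α / 2) *
    ((t (n + 1) - t n) / (t n - t (n - 1))) ^ α

/-- The lower bound for the row sums of the L1 matrix. -/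
noncomputable def l1Floor (α T : ℝ) : ℝ := (Real.Gamma (2 - α))⁻¹ * ((1 - α) * T ^ (-α))

lemma inv_gamma_two_sub_pos {α : ℝ} (h₁ : α < 1) : 0 < (Real.Gamma (2 - α))⁻¹ :=
  inv_pos.2 (Real.Gamma_pos_of_pos (by linarith))

lemma l1Floor_pos {α T : ℝ} (h₁ : α < 1) (hT : 0 < T) : 0 < l1Floor α T :=
  mul_pos (inv_gamma_two_sub_pos h₁) (mul_pos (by linarith) (Real.rpow_pos_of_pos hT _))

lemma cellWeight_of_lt (α : ℝ) (t : ℕ → ℝ) {i k : ℕ} (hk : i < k) : cellWeight α t i k = 0 :=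
  if_neg (by omega)

/-- The sum telescopes, because the cell weights vanish to the right of the diagonal. Starting at a
general `k₀` gives the row sums over a window in time. -/
lemma sum_l1Matrix_ge (α : ℝ) (t : ℕ → ℝ) (n : ℕ) (i : Fin (n + 1)) {k₀ : ℕ} (hk₀ : k₀ ≤ n + 1) :
    (∑ k : Fin (n + 1), if k₀ ≤ (k : ℕ) then l1Matrix α t n i k else 0) =
      (Real.Gamma (2 - α))⁻¹ * cellWeight α t i k₀ := by
  simp only [l1Matrix_apply]
  rw [Fin.sum_univ_eq_sum_range (fun k => if k₀ ≤ k then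
    (Real.Gamma (2 - α))⁻¹ * (cellWeight α t i k - cellWeight α t i (k + 1)) else 0) (n + 1),
    ← Finset.sum_filter]
  have : (Finset.range (n + 1)).filter (fun k => k₀ ≤ k) = Finset.Ico k₀ (n + 1) := by
    ext k; simp; omega
  rw [this, ← Finset.mul_sum]
  congr 1
  have h := Finset.sum_Ico_sub (fun k => cellWeight α t i k) hk₀
  rw [cellWeight_of_lt α t i.2] at h
  have h2 : ∀ s : Finset ℕ, ∑ k ∈ s, (cellWeight α t i k - cellWeight α t i (k + 1)) =
      - ∑ k ∈ s, (cellWeight α t i (k + 1) - cellWeight α t i k) := by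
    intro s; rw [← Finset.sum_neg_distrib]; exact Finset.sum_congr rfl fun _ _ => by ring
  rw [h2, h]; ring

lemma sum_l1Matrix (α : ℝ) (t : ℕ → ℝ) (n : ℕ) (i : Fin (n + 1)) :
    ∑ k, l1Matrix α t n i k = (Real.Gamma (2 - α))⁻¹ * cellWeight α t i 0 := by
  simpa using sum_l1Matrix_ge α t n i (Nat.zero_le (n + 1))

/-- Summation by parts: the L1 scheme as a weighted sum of increments. -/
lemma l1Matrix_mulVec (α : ℝ) (t : ℕ → ℝ) (n : ℕ) (Y : ℕ → ℝ) (hY : Y 0 = 0) (i : Fin (n + 1)) :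
    (l1Matrix α t n *ᵥ fun k => Y ((k : ℕ) + 1)) i =
      (Real.Gamma (2 - α))⁻¹ *
        ∑ k ∈ Finset.range ((i : ℕ) + 1), cellWeight α t i k * (Y (k + 1) - Y k) := by
  simp only [Matrix.mulVec, dotProduct, l1Matrix_apply, mul_assoc]
  rw [Fin.sum_univ_eq_sum_range (fun k => (Real.Gamma (2 - α))⁻¹ *
    ((cellWeight α t i k - cellWeight α t i (k + 1)) * Y (k + 1))) (n + 1), ← Finset.mul_sum]
  congr 1
  have key : ∀ m, ∑ k ∈ Finset.range m,
      (cellWeight α t i k - cellWeight α t i (k + 1)) * Y (k + 1) =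
      ∑ k ∈ Finset.range m, cellWeight α t i k * (Y (k + 1) - Y k) - cellWeight α t i m * Y m := by
    intro m
    induction m with
    | zero => simp [hY]
    | succ m ih => rw [Finset.sum_range_succ, ih, Finset.sum_range_succ]; ring
  rw [key, cellWeight_of_lt α t i.2, zero_mul, sub_zero]
  symm
  apply Finset.sum_subset
  · intro k; simp; omega
  · intro k _ hk
    rw [cellWeight_of_lt α t (by simpa using hk), zero_mul]

lemma exchangeBar_symm (n : ℕ) (i k : Fin (n + 1)) : exchangeBar n i k = exchangeBar n k i := by
  simp only [exchangeBar, Matrix.of_apply, add_comm (i : ℕ)]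

lemma abs_exchangeBar_mulVec_le (n : ℕ) (v : Fin (n + 1) → ℝ) (i : Fin (n + 1)) {M : ℝ}
    (hM : ∀ k, |v k| ≤ M) : |(exchangeBar n *ᵥ v) i| ≤ M := by
  have hM0 : 0 ≤ M := (abs_nonneg _).trans (hM i)
  simp only [Matrix.mulVec, dotProduct, exchangeBar, Matrix.of_apply, ite_mul, one_mul, zero_mul]
  by_cases hi : (i : ℕ) + 1 ≤ n
  · rw [Finset.sum_eq_single (⟨n - 1 - i, by omega⟩ : Fin (n + 1))]
    · split_ifs
      · exact hM _
      · simpa using hM0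
    · intro k _ hk
      rw [if_neg]
      intro h
      exact hk (Fin.ext (by simp; omega))
    · simp
  · rw [Finset.sum_eq_zero]
    · simpa using hM0
    · intro k _
      rw [if_neg (by omega)]

namespace LogConcaveMesh

variable {T α : ℝ} {n : ℕ} {t : ℕ → ℝ}

lemma l1Matrix_nonpos (h : LogConcaveMesh T n t) (h₀ : 0 < α) (h₁ : α < 1) {i k : Fin (n + 1)}
    (hik : i ≠ k) : l1Matrix α t n i k ≤ 0 := by
  rw [l1Matrix_apply]
  refine mul_nonpos_of_nonneg_of_nonpos (inv_gamma_two_sub_pos h₁).le ?_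
  have hne : (i : ℕ) ≠ k := fun e => hik (Fin.ext e)
  rcases lt_or_ge (i : ℕ) k with hk | hk
  · rw [cellWeight_of_lt α t hk, cellWeight_of_lt α t (by omega), sub_zero]
  · linarith [h.cellWeight_mono h₀ h₁ (i := i) (k := k) (by omega) (by omega)]

lemma l1Floor_le (h : LogConcaveMesh T n t) (h₀ : 0 < α) (h₁ : α < 1) (i : Fin (n + 1)) :
    l1Floor α T ≤ ∑ k, l1Matrix α t n i k := by
  rw [sum_l1Matrix]
  refine mul_le_mul_of_nonneg_left ?_ (inv_gamma_two_sub_pos h₁).le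
  refine le_trans ?_ (h.cellWeight_lower h₀ h₁ (by omega) (Nat.zero_le _))
  rw [h.zero, sub_zero]
  refine mul_le_mul_of_nonneg_left ?_ (by linarith)
  refine Real.rpow_le_rpow_of_nonpos ?_ (h.le_last (by omega)) (by linarith)
  rw [← h.zero]; exact h.lt (by omega) (by omega)

lemma energyWeight_pos (h : LogConcaveMesh T n t) {i : ℕ} (hi : i ≤ n) :
    0 < energyWeight α t n i := by
  have hn := h.one_le
  unfold energyWeight
  split_ifs with hin
  · exact Real.rpow_pos_of_pos (mul_pos (sub_pos.2 (h.lt (by omega) (by omega)))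
      (sub_pos.2 (h.lt (by omega) (by omega)))) _
  · exact mul_pos (Real.rpow_pos_of_pos (mul_pos (sub_pos.2 (h.lt (by omega) (by omega)))
      (sub_pos.2 (h.lt (by omega) (by omega)))) _) (Real.rpow_pos_of_pos
      (div_pos (sub_pos.2 (h.lt (by omega) (by omega)))
      (sub_pos.2 (h.lt (by omega) (by omega)))) _)

/-- For consecutive steps `p, q, r` this is `p * r ≤ q ^ 2` raised to the power `α / 2`. The last
weight is defined so that equality holds there. -/
lemma energyWeight_succ_le (h : LogConcaveMesh T n t) (h₀ : 0 < α) {i : ℕ}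
    (hi : i + 1 ≤ n) : energyWeight α t n (i + 1) ≤
      energyWeight α t n i * ((t (i + 2) - t (i + 1)) / (t (i + 1) - t i)) ^ α := by
  unfold energyWeight
  rw [if_pos (show i < n by omega)]
  split_ifs with hin
  · have hp := sub_pos.2 (h.lt (show i < i + 1 by omega) (by omega))
    have hq := sub_pos.2 (h.lt (show i + 1 < i + 2 by omega) (by omega))
    have hr := sub_pos.2 (h.lt (show i + 2 < i + 3 by omega) (by omega))
    have hl := h.logConcave i (by omega)
    set p := t (i + 1) - t i
    set q := t (i + 2) - t (i + 1)
    set r := t (i + 3) - t (i + 2)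
    have e : (q / p) ^ α = ((q / p) ^ 2) ^ (α / 2) := by
      rw [← Real.rpow_natCast, ← Real.rpow_mul (by positivity)]
      congr 1; push_cast; ring
    rw [e, ← Real.mul_rpow (by positivity) (by positivity)]
    refine Real.rpow_le_rpow (by positivity) ?_ (by linarith)
    rw [div_pow, mul_div_assoc', le_div_iff₀ (by positivity)]
    calc q * r * p ^ 2 = p * q * (p * r) := by ring
      _ ≤ p * q * q ^ 2 := by gcongr
  · obtain rfl : n = i + 1 := by omega
    simp

/-- A symmetric mesh interchanges the steps adjacent to mirrored nodes, and the weight is symmetric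
in its two steps. -/
lemma energyWeight_reverse (h : LogConcaveMesh T n t) {i k : ℕ} (hik : i + k + 1 = n) :
    energyWeight α t n i = energyWeight α t n k := by
  unfold energyWeight
  rw [if_pos (by omega), if_pos (by omega), mul_comm]
  have e := fun j hj => h.symm j hj
  have e0 := e k (by omega)
  have e1 := e (k + 1) (by omega)
  have e2 := e (k + 2) (by omega)
  rw [show n + 1 - k = i + 2 by omega] at e0
  rw [show n + 1 - (k + 1) = i + 1 by omega] at e1
  rw [show n + 1 - (k + 2) = i by omega] at e2
  rw [e0, e1, e2]
  congr 1; ring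

lemma weighted_column_nonneg (h : LogConcaveMesh T n t) (h₀ : 0 < α) (h₁ : α < 1)
    (k : Fin (n + 1)) : 0 ≤ ∑ i : Fin (n + 1), energyWeight α t n i * l1Matrix α t n i k := by
  have e : ∀ i : Fin (n + 1), energyWeight α t n i * l1Matrix α t n i k =
      (Real.Gamma (2 - α))⁻¹ * (energyWeight α t n i *
        (cellWeight α t i k - cellWeight α t i (k + 1))) := by
    intro i; rw [l1Matrix_apply]; ring
  simp only [e]
  rw [← Finset.mul_sum, Fin.sum_univ_eq_sum_range (fun i => energyWeight α t n i *
    (cellWeight α t i k - cellWeight α t i (k + 1))) (n + 1)]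
  refine mul_nonneg (inv_gamma_two_sub_pos h₁).le ?_
  -- The partial column sum dominates its last positive term. In passing to the next row, the
  -- negative term of that row is covered by what is left of the previous one.
  have key : ∀ m ≤ n, energyWeight α t n m * cellWeight α t m k ≤
      ∑ i ∈ Finset.range (m + 1), energyWeight α t n i *
        (cellWeight α t i k - cellWeight α t i (k + 1)) := by
    intro m hm
    induction m with
    | zero => simp [cellWeight_of_lt α t (Nat.succ_pos k)]
    | succ m ih =>
      rw [Finset.sum_range_succ]
      have h1 := ih (by omega)
      have h2 : energyWeight α t n (m + 1) * cellWeight α t (m + 1) (k + 1) ≤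
          energyWeight α t n m * cellWeight α t m k := by
        rcases le_or_gt (k : ℕ) m with hk | hk
        · have hd := h.cellWeight_diagonal h₀ h₁ hm hk
          have hw := h.energyWeight_succ_le h₀ hm
          have hq : 0 < (t (m + 2) - t (m + 1)) / (t (m + 1) - t m) :=
            div_pos (sub_pos.2 (h.lt (by omega) (by omega)))
              (sub_pos.2 (h.lt (by omega) (by omega)))
          set q := (t (m + 2) - t (m + 1)) / (t (m + 1) - t m)
          -- Along the diagonal the weight grows at most by `q ^ α` and the cell weight shrinks at
          -- least by `q ^ (-α)`; the factors compensate.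
          have hqq : q ^ α * q ^ (-α) = 1 := by
            rw [← Real.rpow_add hq]; simp
          calc _ ≤ (energyWeight α t n m * q ^ α) * (q ^ (-α) * cellWeight α t m k) :=
                mul_le_mul hw hd (h.cellWeight_nonneg h₀ h₁ (by omega) _)
                  (mul_nonneg (h.energyWeight_pos (by omega)).le (Real.rpow_nonneg hq.le _))
            _ = energyWeight α t n m * cellWeight α t m k * (q ^ α * q ^ (-α)) := by ring
            _ = _ := by rw [hqq, mul_one]
        · rw [cellWeight_of_lt α t hk, cellWeight_of_lt α t (by omega)]; simp
      rw [mul_sub]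
      linarith
  exact (mul_nonneg (h.energyWeight_pos le_rfl).le (h.cellWeight_nonneg h₀ h₁ le_rfl _)).trans
    (key n le_rfl)

end LogConcaveMesh

/-- The weights of the state and the adjoint components. -/
noncomputable def stateAdjointWeight (α σ : ℝ) (t : ℕ → ℝ) (n : ℕ) : StateAdjointIndex n → ℝ :=
  Sum.elim (fun i => energyWeight α t n i) (fun i => σ⁻¹ * energyWeight α t n i)

lemma coupledMatrix_mulVec_inl (α σ : ℝ) (t : ℕ → ℝ) (n : ℕ) (v : StateAdjointIndex n → ℝ)
    (i : Fin (n + 1)) : (coupledMatrix α σ t n *ᵥ v) (Sum.inl i) =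
      (l1Matrix α t n *ᵥ (v ∘ Sum.inl)) i + σ⁻¹ * (exchangeBar n *ᵥ (v ∘ Sum.inr)) i := by
  simp [coupledMatrix, Matrix.fromBlocks_mulVec, Matrix.smul_mulVec]

lemma coupledMatrix_mulVec_inr (α σ : ℝ) (t : ℕ → ℝ) (n : ℕ) (v : StateAdjointIndex n → ℝ)
    (i : Fin (n + 1)) : (coupledMatrix α σ t n *ᵥ v) (Sum.inr i) =
      (l1Matrix α t n *ᵥ (v ∘ Sum.inr)) i - (exchangeBar n *ᵥ (v ∘ Sum.inl)) i := by
  simp [coupledMatrix, Matrix.fromBlocks_mulVec, Matrix.neg_mulVec]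
  ring

namespace LogConcaveMesh

variable {T α σ : ℝ} {n : ℕ} {t : ℕ → ℝ}

lemma stateAdjointWeight_pos (h : LogConcaveMesh T n t) (hσ : 0 < σ) (j : StateAdjointIndex n) :
    0 < stateAdjointWeight α σ t n j := by
  rcases j with i | i
  · exact h.energyWeight_pos (by omega)
  · exact mul_pos (inv_pos.2 hσ) (h.energyWeight_pos (by omega))

/-- The exchange matrix is symmetric and links only indices of equal weight, so it stays symmetric
in the weighted product. The factor `σ⁻¹` in the adjoint weight then makes the two coupling terms
opposite. -/
lemma exchange_weight_symm (h : LogConcaveMesh T n t) (y p : Fin (n + 1) → ℝ) :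
    ∑ i : Fin (n + 1), energyWeight α t n i * y i * (exchangeBar n *ᵥ p) i =
      ∑ i : Fin (n + 1), energyWeight α t n i * p i * (exchangeBar n *ᵥ y) i := by
  simp only [Matrix.mulVec, dotProduct, Finset.mul_sum]
  rw [Finset.sum_comm]
  refine Finset.sum_congr rfl fun k _ => Finset.sum_congr rfl fun i _ => ?_
  rw [exchangeBar_symm n i k]
  by_cases hik : (k : ℕ) + i + 1 = n
  · rw [h.energyWeight_reverse hik]; ring
  · simp [exchangeBar, hik]

/-- The coupled matrix is coercive in the weighted inner product: the coupling terms cancel. -/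
lemma coupled_coercive (h : LogConcaveMesh T n t) (h₀ : 0 < α) (h₁ : α < 1) (hσ : 0 < σ)
    (v : StateAdjointIndex n → ℝ) :
    l1Floor α T / 2 * ∑ j, stateAdjointWeight α σ t n j * v j ^ 2 ≤
      ∑ j, stateAdjointWeight α σ t n j * v j * (coupledMatrix α σ t n *ᵥ v) j := by
  have hc := fun u : Fin (n + 1) → ℝ => weighted_coercive (l1Matrix α t n)
    (fun i => energyWeight α t n i) u (l1Floor α T) (fun i k => h.l1Matrix_nonpos h₀ h₁)
    (h.l1Floor_le h₀ h₁) (fun i => (h.energyWeight_pos (by omega)).le)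
    (h.weighted_column_nonneg h₀ h₁)
  have hy := hc (v ∘ Sum.inl)
  have hp := mul_le_mul_of_nonneg_left (hc (v ∘ Sum.inr)) (inv_pos.2 hσ).le
  have hx := h.exchange_weight_symm (α := α) (v ∘ Sum.inl) (v ∘ Sum.inr)
  rw [Fintype.sum_sum_type, Fintype.sum_sum_type]
  simp only [coupledMatrix_mulVec_inl, coupledMatrix_mulVec_inr, stateAdjointWeight,
    Sum.elim_inl, Sum.elim_inr, Function.comp_apply] at *
  have e1 : ∑ i : Fin (n + 1), energyWeight α t n i * v (Sum.inl i) *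
      ((l1Matrix α t n *ᵥ (v ∘ Sum.inl)) i + σ⁻¹ * (exchangeBar n *ᵥ (v ∘ Sum.inr)) i) =
      ∑ i : Fin (n + 1), energyWeight α t n i * v (Sum.inl i) *
        (l1Matrix α t n *ᵥ (v ∘ Sum.inl)) i +
      σ⁻¹ * ∑ i : Fin (n + 1), energyWeight α t n i * v (Sum.inl i) *
        (exchangeBar n *ᵥ (v ∘ Sum.inr)) i := by
    rw [Finset.mul_sum, ← Finset.sum_add_distrib]
    exact Finset.sum_congr rfl fun i _ => by ring
  have e2 : ∑ i : Fin (n + 1), σ⁻¹ * energyWeight α t n i * v (Sum.inr i) *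
      ((l1Matrix α t n *ᵥ (v ∘ Sum.inr)) i - (exchangeBar n *ᵥ (v ∘ Sum.inl)) i) =
      σ⁻¹ * ∑ i : Fin (n + 1), energyWeight α t n i * v (Sum.inr i) *
        (l1Matrix α t n *ᵥ (v ∘ Sum.inr)) i -
      σ⁻¹ * ∑ i : Fin (n + 1), energyWeight α t n i * v (Sum.inr i) *
        (exchangeBar n *ᵥ (v ∘ Sum.inl)) i := by
    rw [Finset.mul_sum, Finset.mul_sum, ← Finset.sum_sub_distrib]
    exact Finset.sum_congr rfl fun i _ => by ring
  have e3 : ∑ i : Fin (n + 1), σ⁻¹ * energyWeight α t n i * v (Sum.inr i) ^ 2 =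
      σ⁻¹ * ∑ i : Fin (n + 1), energyWeight α t n i * v (Sum.inr i) ^ 2 := by
    rw [Finset.mul_sum]
    exact Finset.sum_congr rfl fun i _ => by ring
  rw [e1, e2, e3, hx, mul_add]
  linarith

end LogConcaveMesh

/-! ### A priori bounds for two-point problems in a Hilbert space, by convexity of the norm. -/

lemma norm_le_sqrt_sq_add {E : Type*} [NormedAddCommGroup E] (v : E) (ε : ℝ) :
    ‖v‖ ≤ √(‖v‖ ^ 2 + ε ^ 2) :=
  Real.le_sqrt_of_sq_le (by nlinarith [sq_nonneg ε])

section InnerProduct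

variable {H : Type*} [NormedAddCommGroup H] [InnerProductSpace ℝ H]

/-- If `κ ⟪F, F''⟫ ≥ -ρ ‖F‖`, then the regularised norm of `F` is convex up to `ρ x² / (2 κ)`. -/
lemma convexOn_regularised_norm {a b κ ρ ε : ℝ} (hκ : 0 < κ) (hρ : 0 ≤ ρ) (hε : 0 < ε)
    {F F' F'' : ℝ → H} (hc : ContinuousOn F (Icc a b))
    (h1 : ∀ x ∈ Ioo a b, HasDerivAt F (F' x) x) (h2 : ∀ x ∈ Ioo a b, HasDerivAt F' (F'' x) x)
    (hineq : ∀ x ∈ Ioo a b, -ρ * ‖F x‖ ≤ κ * inner ℝ (F x) (F'' x)) :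
    ConvexOn ℝ (Icc a b) fun x => √(‖F x‖ ^ 2 + ε ^ 2) + ρ / (2 * κ) * x ^ 2 := by
  have hφ : ∀ x, 0 < ‖F x‖ ^ 2 + ε ^ 2 := fun x => by positivity
  have hR : ∀ x, 0 < √(‖F x‖ ^ 2 + ε ^ 2) := fun x => Real.sqrt_pos.2 (hφ x)
  have d0 : ∀ x ∈ Ioo a b, HasDerivAt (fun x => √(‖F x‖ ^ 2 + ε ^ 2))
      (inner ℝ (F x) (F' x) / √(‖F x‖ ^ 2 + ε ^ 2)) x := by
    intro x hx
    have := (((h1 x hx).norm_sq.add_const (ε ^ 2)).sqrt (hφ x).ne')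
    convert this using 1
    have := hR x
    field_simp
  refine convexOn_of_hasDerivWithinAt2_nonneg (convex_Icc a b)
    (f' := fun x => inner ℝ (F x) (F' x) / √(‖F x‖ ^ 2 + ε ^ 2) + ρ / κ * x)
    (f'' := fun x => ((inner ℝ (F x) (F'' x) + inner ℝ (F' x) (F' x)) * √(‖F x‖ ^ 2 + ε ^ 2) -
      inner ℝ (F x) (F' x) * (inner ℝ (F x) (F' x) / √(‖F x‖ ^ 2 + ε ^ 2))) /
      √(‖F x‖ ^ 2 + ε ^ 2) ^ 2 + ρ / κ) ?_ ?_ ?_ ?_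
  · exact ((((hc.norm).pow 2).add continuousOn_const).sqrt).add (by fun_prop)
  · intro x hx
    rw [interior_Icc] at hx
    have := (d0 x hx).add (((hasDerivAt_pow 2 x)).const_mul (ρ / (2 * κ)))
    refine (this.congr_deriv ?_).hasDerivWithinAt
    field_simp
    push_cast
    ring
  · intro x hx
    rw [interior_Icc] at hx
    have := (((h1 x hx).inner ℝ (h2 x hx)).div (d0 x hx) (hR x).ne').add
      ((hasDerivAt_id x).const_mul (ρ / κ))
    refine (this.congr_deriv ?_).hasDerivWithinAt
    rw [mul_one]
  · intro x hx
    rw [interior_Icc] at hx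
    have hi := hineq x hx
    have hR' := hR x
    have hsq : √(‖F x‖ ^ 2 + ε ^ 2) ^ 2 = ‖F x‖ ^ 2 + ε ^ 2 := Real.sq_sqrt (hφ x).le
    have hle : ‖F x‖ ≤ √(‖F x‖ ^ 2 + ε ^ 2) := Real.le_sqrt_of_sq_le (by nlinarith)
    have hcs := abs_real_inner_le_norm (F x) (F' x)
    set R := √(‖F x‖ ^ 2 + ε ^ 2)
    set B : ℝ := inner ℝ (F x) (F'' x)
    set C : ℝ := inner ℝ (F x) (F' x)
    have hA : inner ℝ (F' x) (F' x) = ‖F' x‖ ^ 2 := real_inner_self_eq_norm_sq _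
    rw [hA]
    -- Cauchy–Schwarz makes the part of the second derivative that involves `F'` nonnegative; `hB`
    -- bounds the remaining part by `-ρ / κ`, which the quadratic term compensates.
    have hC : C ^ 2 ≤ R ^ 2 * ‖F' x‖ ^ 2 := by
      rw [← mul_pow, ← sq_abs C]
      exact pow_le_pow_left₀ (abs_nonneg _) (hcs.trans (by gcongr)) 2
    have hB : -ρ / κ * R ≤ B := by
      have : -ρ * R ≤ κ * B := le_trans (by nlinarith) hi
      rw [div_mul_eq_mul_div, div_le_iff₀ hκ]; linarith
    have e : ((B + ‖F' x‖ ^ 2) * R - C * (C / R)) / R ^ 2 + ρ / κ =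
        ((B + ρ / κ * R) * R ^ 2 + (R ^ 2 * ‖F' x‖ ^ 2 - C ^ 2)) / R ^ 3 := by
      field_simp; ring
    rw [e]
    refine div_nonneg (add_nonneg (mul_nonneg ?_ (sq_nonneg _)) (by linarith)) (by positivity)
    have : -ρ / κ * R = -(ρ / κ * R) := by ring
    linarith

/-- A convex function lies below its chord. The chord of the quadratic correction over `[-h, 0]` is
the right-hand side, and `ε` tends to zero. The factor `-x` is kept so that a bound of the flux at
`0` can be read off. -/
lemma norm_le_of_dirichlet {h κ ρ : ℝ} (hh : 0 < h) (hκ : 0 < κ) (hρ : 0 ≤ ρ)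
    {F F' F'' : ℝ → H} (hc : ContinuousOn F (Icc (-h) 0))
    (h1 : ∀ x ∈ Ioo (-h) 0, HasDerivAt F (F' x) x)
    (h2 : ∀ x ∈ Ioo (-h) 0, HasDerivAt F' (F'' x) x)
    (hineq : ∀ x ∈ Ioo (-h) 0, -ρ * ‖F x‖ ≤ κ * inner ℝ (F x) (F'' x))
    (hl : F (-h) = 0) (hr : F 0 = 0) {x : ℝ} (hx : x ∈ Icc (-h) 0) :
    ‖F x‖ ≤ ρ * h / (2 * κ) * (-x) := by
  refine le_of_forall_pos_le_add fun ε hε => ?_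
  have hconv := (convexOn_regularised_norm hκ hρ hε hc h1 h2 hineq).2
    (left_mem_Icc.2 (by linarith)) (right_mem_Icc.2 (by linarith))
    (show 0 ≤ -x / h from div_nonneg (by linarith [hx.2]) hh.le)
    (show 0 ≤ 1 - -x / h by rw [sub_nonneg, div_le_one hh]; linarith [hx.1]) (by ring)
  have ex : -x / h * (-h) + (1 - -x / h) * 0 = x := by field_simp; ring
  simp only [smul_eq_mul, ex, hl, hr, norm_zero] at hconv
  have e2 : √((0 : ℝ) ^ 2 + ε ^ 2) = ε := by
    rw [zero_pow two_ne_zero, zero_add, Real.sqrt_sq hε.le]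
  rw [e2] at hconv
  have e3 : -x / h * (ε + ρ / (2 * κ) * (-h) ^ 2) + (1 - -x / h) * (ε + ρ / (2 * κ) * 0 ^ 2) =
      ρ * h / (2 * κ) * (-x) + ε := by field_simp; ring
  rw [e3] at hconv
  have := norm_le_sqrt_sq_add (F x) ε
  have h5 : 0 ≤ ρ / (2 * κ) * x ^ 2 := by positivity
  linarith

/-- A convex function is largest at an end point. At `h` its value is known; at `0` its slope is at
least `-s`, so its value exceeds that at `h` by at most `s * h`. -/
lemma norm_le_of_neumann {h κ ρ s : ℝ} (hh : 0 < h) (hκ : 0 < κ) (hρ : 0 ≤ ρ)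
    {F F' F'' : ℝ → H} (hc : ContinuousOn F (Icc 0 h))
    (h1 : ∀ x ∈ Ioo 0 h, HasDerivAt F (F' x) x)
    (h2 : ∀ x ∈ Ioo 0 h, HasDerivAt F' (F'' x) x)
    (hineq : ∀ x ∈ Ioo 0 h, -ρ * ‖F x‖ ≤ κ * inner ℝ (F x) (F'' x))
    {d : H} (hd : HasDerivWithinAt F d (Icc 0 h) 0) (hs : ‖d‖ ≤ s)
    (hr : F h = 0) {x : ℝ} (hx : x ∈ Icc 0 h) :
    ‖F x‖ ≤ s * h + ρ * h ^ 2 / (2 * κ) := by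
  refine le_of_forall_pos_le_add fun ε hε => ?_
  have hconv := convexOn_regularised_norm hκ hρ hε hc h1 h2 hineq
  have h0 : (0 : ℝ) ∈ Icc 0 h := left_mem_Icc.2 hh.le
  have hhm : h ∈ Icc 0 h := right_mem_Icc.2 hh.le
  have hmax := hconv.le_max_of_mem_Icc h0 hhm hx
  have hφ : 0 < ‖F 0‖ ^ 2 + ε ^ 2 := by positivity
  have hdg : HasDerivWithinAt (fun x => √(‖F x‖ ^ 2 + ε ^ 2) + ρ / (2 * κ) * x ^ 2)
      (inner ℝ (F 0) d / √(‖F 0‖ ^ 2 + ε ^ 2)) (Icc 0 h) 0 := by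
    have := ((hd.norm_sq.add_const (ε ^ 2)).sqrt hφ.ne').add
      ((((hasDerivAt_pow 2 (0 : ℝ))).const_mul (ρ / (2 * κ))).hasDerivWithinAt (s := Icc 0 h))
    refine this.congr_deriv ?_
    have := Real.sqrt_pos.2 hφ
    simp
    field_simp
  have hsl := hconv.le_slope_of_hasDerivWithinAt h0 hhm hh hdg
  have hge : -s ≤ inner ℝ (F 0) d / √(‖F 0‖ ^ 2 + ε ^ 2) := by
    rw [le_div_iff₀ (Real.sqrt_pos.2 hφ)]
    have c1 := (abs_le.1 (abs_real_inner_le_norm (F 0) d)).1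
    have c2 := norm_le_sqrt_sq_add (F 0) ε
    have c3 : ‖F 0‖ * ‖d‖ ≤ √(‖F 0‖ ^ 2 + ε ^ 2) * s := by gcongr
    linarith
  have hsl2 := hge.trans hsl
  rw [slope_def_field, le_div_iff₀ (by linarith)] at hsl2
  have hs0 : 0 ≤ s := (norm_nonneg d).trans hs
  have eh : √(‖F h‖ ^ 2 + ε ^ 2) = ε := by
    rw [hr, norm_zero, zero_pow two_ne_zero, zero_add, Real.sqrt_sq hε.le]
  simp only [eh, sub_zero] at hsl2 hmax
  have e3 : ρ / (2 * κ) * h ^ 2 = ρ * h ^ 2 / (2 * κ) := by ring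
  have h5 : 0 ≤ ρ / (2 * κ) * x ^ 2 := by positivity
  have h6 := norm_le_sqrt_sq_add (F x) ε
  have h7 : 0 ≤ s * h := by positivity
  rcases le_max_iff.1 hmax with h8 | h8 <;> linarith

end InnerProduct

/-- This passes estimates from the left subdomain, through the flux at the interface, to the right
one. It serves both for the weighted norm and componentwise. -/
lemma norm_deriv_le_of_linear_bound {E : Type*} [NormedAddCommGroup E] [NormedSpace ℝ E]
    {h K : ℝ} (hh : 0 < h) {F : ℝ → E} {d : E} (hd : HasDerivWithinAt F d (Icc (-h) 0) 0)
    (h0 : F 0 = 0) (hK : ∀ x ∈ Icc (-h) 0, ‖F x‖ ≤ K * (-x)) : ‖d‖ ≤ K := by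
  have ht := (hasDerivWithinAt_iff_tendsto_slope.1 hd).norm
  have hne : (𝓝[Icc (-h) 0 \ {0}] (0 : ℝ)).NeBot := by
    rw [Icc_sdiff_right]
    exact mem_closure_iff_nhdsWithin_neBot.1 (by
      rw [closure_Ico (by linarith : -h ≠ 0)]; exact right_mem_Icc.2 (by linarith))
  refine le_of_tendsto ht ?_
  filter_upwards [self_mem_nhdsWithin] with y hy
  have hy0 : y < 0 := lt_of_le_of_ne hy.1.2 hy.2
  rw [slope_def_module, h0, sub_zero, sub_zero, norm_smul, norm_inv, Real.norm_eq_abs,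
    abs_of_neg hy0, inv_mul_le_iff₀ (by linarith)]
  linarith [hK y hy.1]

/-! ### Maximum principle for systems, and barriers. -/

/-- If `c` were negative, the second derivative test would make `x` a local maximum too; then `f`
would be constant near `x` and `c` would be zero. -/
lemma second_deriv_nonneg_of_isLocalMin {f f' : ℝ → ℝ} {c x : ℝ}
    (h1 : ∀ᶠ y in 𝓝 x, HasDerivAt f (f' y) y) (h2 : HasDerivAt f' c x) (hm : IsLocalMin f x) :
    0 ≤ c := by
  by_contra hc
  push Not at hc
  have e1 : deriv f =ᶠ[𝓝 x] f' := h1.mono fun y hy => hy.deriv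
  have e2 : deriv (deriv f) x = c := by rw [e1.deriv_eq, h2.deriv]
  have hM := isLocalMax_of_deriv_deriv_neg (by rw [e2]; exact hc) hm.deriv_eq_zero
    h1.self_of_nhds.continuousAt
  have hconst : f =ᶠ[𝓝 x] fun _ => f x := by
    filter_upwards [hm, hM] with y hy1 hy2 using le_antisymm hy2 hy1
  have : deriv (deriv f) x = 0 := by
    have h3 : deriv f =ᶠ[𝓝 x] deriv fun _ => f x := hconst.deriv
    rw [h3.deriv_eq]; simp
  linarith

/-- Minimum principle for a system coupled by a matrix with nonpositive off-diagonal entries and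
positive row sums, with a Dirichlet or a Neumann condition at the left end point. -/
lemma system_minimum_principle {ι : Type*} (S : Finset ι) (A : ι → ι → ℝ)
    {a b κ lam : ℝ} (hab : a < b) (hκ : 0 < κ) (hlam : 0 < lam) {v v' v'' : ι → ℝ → ℝ}
    (hc : ∀ j ∈ S, ContinuousOn (v j) (Icc a b))
    (h1 : ∀ j ∈ S, ∀ x ∈ Ioo a b, HasDerivAt (v j) (v' j x) x)
    (h2 : ∀ j ∈ S, ∀ x ∈ Ioo a b, HasDerivAt (v' j) (v'' j x) x)
    (hoff : ∀ j ∈ S, ∀ k ∈ S, j ≠ k → A j k ≤ 0) (hrow : ∀ j ∈ S, lam ≤ ∑ k ∈ S, A j k)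
    (hineq : ∀ j ∈ S, ∀ x ∈ Ioo a b, κ * v'' j x ≤ ∑ k ∈ S, A j k * v k x)
    (hl : ∀ j ∈ S, 0 ≤ v j a ∨ ∃ d < 0, HasDerivWithinAt (v j) d (Icc a b) a)
    (hr : ∀ j ∈ S, 0 ≤ v j b) : ∀ j ∈ S, ∀ x ∈ Icc a b, 0 ≤ v j x := by
  by_contra! hneg
  obtain ⟨j₀, hj₀, x₀, hx₀, hlt⟩ := hneg
  have hmin : ∀ j, ∃ x ∈ Icc a b, j ∈ S → ∀ y ∈ Icc a b, v j x ≤ v j y := by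
    intro j
    by_cases hj : j ∈ S
    · obtain ⟨x, hx, hxm⟩ := isCompact_Icc.exists_isMinOn (nonempty_Icc.2 hab.le) (hc j hj)
      exact ⟨x, hx, fun _ y hy => hxm hy⟩
    · exact ⟨a, left_mem_Icc.2 hab.le, fun h => absurd h hj⟩
  choose ξ hξ hξm using hmin
  -- The minimum is taken over points and components at once. At a negative minimum the off-diagonal
  -- signs bound the matrix term by the row sum times the minimum, a negative number, while the
  -- second derivative is nonnegative.
  obtain ⟨j, hj, hjm⟩ := S.exists_min_image (fun j => v j (ξ j)) ⟨j₀, hj₀⟩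
  have hglob : ∀ k ∈ S, ∀ y ∈ Icc a b, v j (ξ j) ≤ v k y := fun k hk y hy =>
    (hjm k hk).trans (hξm k hk y hy)
  have hval : v j (ξ j) < 0 := (hglob j₀ hj₀ x₀ hx₀).trans_lt hlt
  have hright : ξ j ≠ b := fun e => by have := hr j hj; rw [← e] at this; linarith
  have hleft : ξ j ≠ a := by
    intro e
    rcases hl j hj with h | ⟨d, hd, hder⟩
    · rw [← e] at h; linarith
    · have ht := hasDerivWithinAt_iff_tendsto_slope.1 hder
      have hne : (𝓝[Icc a b \ {a}] a).NeBot := by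
        rw [Icc_sdiff_left]
        exact mem_closure_iff_nhdsWithin_neBot.1 (by
          rw [closure_Ioc hab.ne]; exact left_mem_Icc.2 hab.le)
      have : 0 ≤ d := by
        refine ge_of_tendsto ht ?_
        filter_upwards [self_mem_nhdsWithin] with y hy
        have hya : a < y := lt_of_le_of_ne hy.1.1 (Ne.symm hy.2)
        rw [slope_def_field]
        refine div_nonneg ?_ (by linarith)
        have := hglob j hj y hy.1
        rw [e] at this
        linarith
      linarith
  have hin : ξ j ∈ Ioo a b :=
    ⟨lt_of_le_of_ne (hξ j).1 (Ne.symm hleft), lt_of_le_of_ne (hξ j).2 hright⟩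
  have hnhds : Ioo a b ∈ 𝓝 (ξ j) := Ioo_mem_nhds hin.1 hin.2
  have hnn := second_deriv_nonneg_of_isLocalMin
    (Filter.eventually_of_mem hnhds fun y hy => h1 j hj y hy) (h2 j hj _ hin)
    (Filter.eventually_of_mem hnhds fun y hy => hglob j hj y (Ioo_subset_Icc_self hy))
  have hsum : ∑ k ∈ S, A j k * v k (ξ j) ≤ ∑ k ∈ S, A j k * v j (ξ j) := by
    refine Finset.sum_le_sum fun k hk => ?_
    by_cases hjk : j = k
    · rw [hjk]
    · exact mul_le_mul_of_nonpos_left (hglob k hk _ (hξ j)) (hoff j hj k hk hjk)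
  rw [← Finset.sum_mul] at hsum
  have h3 := hineq j hj _ hin
  have h4 := mul_le_mul_of_nonpos_right (hrow j hj) hval.le
  have h5 : lam * v j (ξ j) < 0 := mul_neg_of_pos_of_neg hlam hval
  have h6 := mul_nonneg hκ.le hnn
  linarith

section Barrier

variable {ι : Type*} (S : Finset ι) (A : ι → ι → ℝ) {κ lam F : ℝ} {z z' z'' : ι → ℝ → ℝ}

/-- The minimum principle is applied to `β + z` and `β - z`. The Neumann inequality is strict
because only a strictly negative slope excludes a minimum at the left end. -/
lemma abs_le_barrier {a b : ℝ} (hab : a < b) (hκ : 0 < κ) (hlam : 0 < lam)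
    (hc : ∀ j ∈ S, ContinuousOn (z j) (Icc a b))
    (h1 : ∀ j ∈ S, ∀ x ∈ Ioo a b, HasDerivAt (z j) (z' j x) x)
    (h2 : ∀ j ∈ S, ∀ x ∈ Ioo a b, HasDerivAt (z' j) (z'' j x) x)
    (hoff : ∀ j ∈ S, ∀ k ∈ S, j ≠ k → A j k ≤ 0) (hrow : ∀ j ∈ S, lam ≤ ∑ k ∈ S, A j k)
    (hineq : ∀ j ∈ S, ∀ x ∈ Ioo a b, |κ * z'' j x - ∑ k ∈ S, A j k * z k x| ≤ F)
    {β β' β'' : ℝ → ℝ} (hβ : ∀ x, HasDerivAt β (β' x) x) (hβ' : ∀ x, HasDerivAt β' (β'' x) x)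
    (hβn : ∀ x ∈ Icc a b, 0 ≤ β x) (hβeq : ∀ x, κ * β'' x = lam * β x - F)
    (hl : ∀ j ∈ S, z j a = 0 ∨ ∃ d, |d| < -β' a ∧ HasDerivWithinAt (z j) d (Icc a b) a)
    (hr : ∀ j ∈ S, z j b = 0) : ∀ j ∈ S, ∀ x ∈ Icc a b, |z j x| ≤ β x := by
  have key : ∀ c : ℝ, |c| = 1 → ∀ j ∈ S, ∀ x ∈ Icc a b, 0 ≤ β x + c * z j x := by
    intro c hc1
    refine system_minimum_principle S A hab hκ hlam (v' := fun j x => β' x + c * z' j x)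
      (v'' := fun j x => β'' x + c * z'' j x) ?_ ?_ ?_ hoff hrow ?_ ?_ ?_
    · intro j hj
      exact (continuousOn_of_forall_continuousAt fun x _ => (hβ x).continuousAt).add
        (continuousOn_const.mul (hc j hj))
    · exact fun j hj x hx => (hβ x).add ((h1 j hj x hx).const_mul c)
    · exact fun j hj x hx => (hβ' x).add ((h2 j hj x hx).const_mul c)
    · intro j hj x hx
      have e : ∑ k ∈ S, A j k * (β x + c * z k x) =
          (∑ k ∈ S, A j k) * β x + c * ∑ k ∈ S, A j k * z k x := by
        rw [Finset.sum_mul, Finset.mul_sum, ← Finset.sum_add_distrib]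
        exact Finset.sum_congr rfl fun k _ => by ring
      rw [e]
      have i1 := mul_le_mul_of_nonneg_right (hrow j hj) (hβn x (Ioo_subset_Icc_self hx))
      have i2 : c * (κ * z'' j x - ∑ k ∈ S, A j k * z k x) ≤ F := by
        refine (le_abs_self _).trans ?_
        rw [abs_mul, hc1, one_mul]; exact hineq j hj x hx
      have := hβeq x
      linarith
    · intro j hj
      rcases hl j hj with h | ⟨d, hd, hder⟩
      · left; rw [h, mul_zero, add_zero]; exact hβn a (left_mem_Icc.2 hab.le)
      · right
        refine ⟨β' a + c * d, ?_, (hβ a).hasDerivWithinAt.add (hder.const_mul c)⟩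
        have : c * d ≤ |d| := (le_abs_self _).trans (by rw [abs_mul, hc1, one_mul])
        linarith
    · intro j hj
      rw [hr j hj, mul_zero, add_zero]; exact hβn b (right_mem_Icc.2 hab.le)
  intro j hj x hx
  have k1 := key 1 (by simp) j hj x hx
  have k2 := key (-1) (by simp) j hj x hx
  rw [abs_le]
  constructor <;> linarith

/-- The barrier is `F / lam * (1 - exp (μ x))` with `κ μ ^ 2 = lam`. It is at most `F / lam`, and
its tangent at `0` gives the linear bound. -/
lemma abs_le_of_dirichlet_barrier {h : ℝ} (hh : 0 < h) (hκ : 0 < κ) (hlam : 0 < lam) (hF : 0 ≤ F)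
    (hc : ∀ j ∈ S, ContinuousOn (z j) (Icc (-h) 0))
    (h1 : ∀ j ∈ S, ∀ x ∈ Ioo (-h) 0, HasDerivAt (z j) (z' j x) x)
    (h2 : ∀ j ∈ S, ∀ x ∈ Ioo (-h) 0, HasDerivAt (z' j) (z'' j x) x)
    (hoff : ∀ j ∈ S, ∀ k ∈ S, j ≠ k → A j k ≤ 0) (hrow : ∀ j ∈ S, lam ≤ ∑ k ∈ S, A j k)
    (hineq : ∀ j ∈ S, ∀ x ∈ Ioo (-h) 0, |κ * z'' j x - ∑ k ∈ S, A j k * z k x| ≤ F)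
    (hl : ∀ j ∈ S, z j (-h) = 0) (hr : ∀ j ∈ S, z j 0 = 0) :
    ∀ j ∈ S, ∀ x ∈ Icc (-h) 0, |z j x| ≤ F / lam ∧ |z j x| ≤ F / √(κ * lam) * (-x) := by
  have hμ2 : κ * √(lam / κ) ^ 2 = lam := by rw [Real.sq_sqrt (by positivity)]; field_simp
  have hμ : √(lam / κ) / lam = 1 / √(κ * lam) := by
    rw [div_eq_div_iff hlam.ne' (Real.sqrt_pos.2 (by positivity)).ne', ← Real.sqrt_mul
      (by positivity), one_mul, show lam / κ * (κ * lam) = lam ^ 2 by field_simp,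
      Real.sqrt_sq hlam.le]
  set μ := √(lam / κ)
  have hμ0 : 0 ≤ μ := Real.sqrt_nonneg _
  have hexp : ∀ x, HasDerivAt (fun x => Real.exp (μ * x)) (Real.exp (μ * x) * μ) x := fun x => by
    simpa using ((hasDerivAt_id x).const_mul μ).exp
  intro j hj x hx
  have hb := abs_le_barrier S A (by linarith : -h < 0) hκ hlam hc h1 h2 hoff hrow hineq
    (β := fun x => F / lam * (1 - Real.exp (μ * x)))
    (β' := fun x => F / lam * (0 - Real.exp (μ * x) * μ))
    (β'' := fun x => F / lam * (0 - Real.exp (μ * x) * μ * μ))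
    (fun x => ((hasDerivAt_const x 1).sub (hexp x)).const_mul _)
    (fun x => ((hasDerivAt_const x 0).sub ((hexp x).mul_const μ)).const_mul _)
    (fun x hx => mul_nonneg (by positivity) (sub_nonneg.2 (Real.exp_le_one_iff.2
      (mul_nonpos_of_nonneg_of_nonpos hμ0 hx.2))))
    (fun x => by
      have : κ * (F / lam * (0 - Real.exp (μ * x) * μ * μ)) =
        -(F / lam * Real.exp (μ * x) * (κ * μ ^ 2)) := by ring
      rw [this, hμ2]; field_simp; ring)
    (fun j hj => Or.inl (hl j hj)) hr j hj x hx
  have hFl : 0 ≤ F / lam := by positivity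
  constructor
  · refine hb.trans ?_
    nlinarith [Real.exp_pos (μ * x)]
  · refine hb.trans ?_
    have : 1 - Real.exp (μ * x) ≤ μ * (-x) := by
      have := Real.add_one_le_exp (μ * x); linarith
    calc F / lam * (1 - Real.exp (μ * x)) ≤ F / lam * (μ * (-x)) := by gcongr
      _ = F * (μ / lam) * (-x) := by ring
      _ = _ := by rw [hμ]; ring

/-- The barrier is the constant `F / lam` plus a decaying exponential of slope `-(s + ε μ)` at `0`.
The surplus `ε μ` provides the strict inequality, and `ε` tends to zero. -/
lemma abs_le_of_neumann_barrier {h s : ℝ} (hh : 0 < h) (hκ : 0 < κ) (hlam : 0 < lam) (hF : 0 ≤ F)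
    (hc : ∀ j ∈ S, ContinuousOn (z j) (Icc 0 h))
    (h1 : ∀ j ∈ S, ∀ x ∈ Ioo 0 h, HasDerivAt (z j) (z' j x) x)
    (h2 : ∀ j ∈ S, ∀ x ∈ Ioo 0 h, HasDerivAt (z' j) (z'' j x) x)
    (hoff : ∀ j ∈ S, ∀ k ∈ S, j ≠ k → A j k ≤ 0) (hrow : ∀ j ∈ S, lam ≤ ∑ k ∈ S, A j k)
    (hineq : ∀ j ∈ S, ∀ x ∈ Ioo 0 h, |κ * z'' j x - ∑ k ∈ S, A j k * z k x| ≤ F)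
    (hl : ∀ j ∈ S, ∃ d, |d| ≤ s ∧ HasDerivWithinAt (z j) d (Icc 0 h) 0)
    (hr : ∀ j ∈ S, z j h = 0) :
    ∀ j ∈ S, ∀ x ∈ Icc 0 h, |z j x| ≤ F / lam + s / √(lam / κ) := by
  have hμ2 : κ * √(lam / κ) ^ 2 = lam := by rw [Real.sq_sqrt (by positivity)]; field_simp
  have hμ0 : 0 < √(lam / κ) := Real.sqrt_pos.2 (by positivity)
  set μ := √(lam / κ)
  have hexp : ∀ x, HasDerivAt (fun x => Real.exp (-μ * x)) (Real.exp (-μ * x) * (-μ)) x :=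
    fun x => by simpa using ((hasDerivAt_id x).const_mul (-μ)).exp
  intro j hj x hx
  have hs0 : 0 ≤ s := by obtain ⟨d, hd, _⟩ := hl j hj; exact (abs_nonneg _).trans hd
  refine le_of_forall_pos_le_add fun ε hε => ?_
  have hs' : 0 ≤ s + ε * μ := by positivity
  have hb := abs_le_barrier S A hh hκ hlam hc h1 h2 hoff hrow hineq
    (β := fun x => F / lam + (s + ε * μ) / μ * Real.exp (-μ * x))
    (β' := fun x => 0 + (s + ε * μ) / μ * (Real.exp (-μ * x) * (-μ)))
    (β'' := fun x => 0 + (s + ε * μ) / μ * (Real.exp (-μ * x) * (-μ) * (-μ)))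
    (fun x => (hasDerivAt_const x _).add ((hexp x).const_mul _))
    (fun x => (hasDerivAt_const x _).add (((hexp x).mul_const (-μ)).const_mul _))
    (fun x hx => by positivity)
    (fun x => by
      have : κ * (0 + (s + ε * μ) / μ * (Real.exp (-μ * x) * (-μ) * (-μ))) =
        (s + ε * μ) / μ * Real.exp (-μ * x) * (κ * μ ^ 2) := by ring
      rw [this, hμ2]; field_simp; ring)
    (fun j hj => by
      obtain ⟨d, hd, hder⟩ := hl j hj
      refine Or.inr ⟨d, ?_, hder⟩
      have : -(0 + (s + ε * μ) / μ * (Real.exp (-μ * 0) * (-μ))) = s + ε * μ := by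
        simp; field_simp
      rw [this]
      have : 0 < ε * μ := by positivity
      linarith) hr j hj x hx
  refine hb.trans ?_
  have he : Real.exp (-μ * x) ≤ 1 := Real.exp_le_one_iff.2 (by nlinarith [hx.1])
  calc F / lam + (s + ε * μ) / μ * Real.exp (-μ * x) ≤ F / lam + (s + ε * μ) / μ * 1 := by gcongr
    _ = _ := by field_simp; ring

end Barrier

/-! ### The convexity bounds in the weighted Euclidean norm. -/

section WeightedNorm

variable {ι : Type} [Fintype ι]

/-- The embedding `v ↦ (√W_j v_j)_j` into Euclidean space. -/
noncomputable def weightedEmbed (W : ι → ℝ) : (ι → ℝ) →L[ℝ] EuclideanSpace ℝ ι :=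
  LinearMap.toContinuousLinearMap
    { toFun := fun v => WithLp.toLp 2 fun j => √(W j) * v j
      map_add' := fun u v => by ext j; simp [mul_add]
      map_smul' := fun c v => by ext j; simp [mul_left_comm] }

lemma weightedEmbed_apply (W v : ι → ℝ) (j : ι) : weightedEmbed W v j = √(W j) * v j := rfl

lemma inner_weightedEmbed {W : ι → ℝ} (hW : ∀ j, 0 ≤ W j) (u v : ι → ℝ) :
    inner ℝ (weightedEmbed W u) (weightedEmbed W v) = ∑ j, W j * u j * v j := by
  rw [EuclideanSpace.inner_eq_star_dotProduct]
  simp only [dotProduct, weightedEmbed_apply, Pi.star_apply, star_trivial]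
  refine Finset.sum_congr rfl fun j _ => ?_
  calc _ = (√(W j) * √(W j)) * u j * v j := by ring
    _ = _ := by rw [Real.mul_self_sqrt (hW j)]

lemma norm_sq_weightedEmbed {W : ι → ℝ} (hW : ∀ j, 0 ≤ W j) (v : ι → ℝ) :
    ‖weightedEmbed W v‖ ^ 2 = ∑ j, W j * v j ^ 2 := by
  rw [← real_inner_self_eq_norm_sq, inner_weightedEmbed hW]
  exact Finset.sum_congr rfl fun j _ => by ring

lemma eq_zero_of_weightedEmbed {W : ι → ℝ} (hW : ∀ j, 0 < W j) {v : ι → ℝ}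
    (hv : ‖weightedEmbed W v‖ = 0) : v = 0 := by
  funext j
  have := congrArg (fun u : EuclideanSpace ℝ ι => u j) (norm_eq_zero.1 hv)
  simpa [weightedEmbed_apply, (Real.sqrt_pos.2 (hW j)).ne'] using this

variable {A : Matrix ι ι ℝ} {W : ι → ℝ} {κ h ρ : ℝ} {E E' E'' R : ℝ → ι → ℝ}

/-- Accretivity discards the matrix term, so only the residual enters the hypothesis of the
convexity bounds. -/
lemma weighted_inner_lower (hW : ∀ j, 0 ≤ W j) (hA : ∀ v, 0 ≤ ∑ j, W j * v j * (A *ᵥ v) j)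
    {u w r : ι → ℝ} (he : κ • w = A *ᵥ u + r) (hr : ‖weightedEmbed W r‖ ≤ ρ) :
    -ρ * ‖weightedEmbed W u‖ ≤ κ * inner ℝ (weightedEmbed W u) (weightedEmbed W w) := by
  rw [← real_inner_smul_right, ← map_smul, he, map_add, inner_add_right, inner_weightedEmbed hW]
  have h1 := (abs_le.1 (abs_real_inner_le_norm (weightedEmbed W u) (weightedEmbed W r))).1
  have h2 := mul_le_mul_of_nonneg_left hr (norm_nonneg (weightedEmbed W u))
  linarith [hA u]

lemma weighted_dirichlet_bound (hW : ∀ j, 0 ≤ W j)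
    (hA : ∀ v, 0 ≤ ∑ j, W j * v j * (A *ᵥ v) j) (hh : 0 < h) (hκ : 0 < κ) (hρ : 0 ≤ ρ)
    (hc : ContinuousOn E (Icc (-h) 0)) (h1 : ∀ x ∈ Ioo (-h) 0, HasDerivAt E (E' x) x)
    (h2 : ∀ x ∈ Ioo (-h) 0, HasDerivAt E' (E'' x) x)
    (heq : ∀ x ∈ Ioo (-h) 0, κ • E'' x = A *ᵥ E x + R x)
    (hR : ∀ x ∈ Ioo (-h) 0, ‖weightedEmbed W (R x)‖ ≤ ρ) (hl : E (-h) = 0) (hr : E 0 = 0)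
    {x : ℝ} (hx : x ∈ Icc (-h) 0) :
    ‖weightedEmbed W (E x)‖ ≤ ρ * h / (2 * κ) * (-x) :=
  norm_le_of_dirichlet (F := fun x => weightedEmbed W (E x))
    (F' := fun x => weightedEmbed W (E' x)) (F'' := fun x => weightedEmbed W (E'' x)) hh hκ hρ
    ((weightedEmbed W).continuous.comp_continuousOn hc)
    (fun x hx => (weightedEmbed W).hasFDerivAt.comp_hasDerivAt x (h1 x hx))
    (fun x hx => (weightedEmbed W).hasFDerivAt.comp_hasDerivAt x (h2 x hx))
    (fun x hx => weighted_inner_lower hW hA (heq x hx) (hR x hx))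
    (by simp [hl]) (by simp [hr]) hx

lemma weighted_neumann_bound (hW : ∀ j, 0 ≤ W j)
    (hA : ∀ v, 0 ≤ ∑ j, W j * v j * (A *ᵥ v) j) (hh : 0 < h) (hκ : 0 < κ) (hρ : 0 ≤ ρ)
    (hc : ContinuousOn E (Icc 0 h)) (h1 : ∀ x ∈ Ioo 0 h, HasDerivAt E (E' x) x)
    (h2 : ∀ x ∈ Ioo 0 h, HasDerivAt E' (E'' x) x)
    (heq : ∀ x ∈ Ioo 0 h, κ • E'' x = A *ᵥ E x + R x)
    (hR : ∀ x ∈ Ioo 0 h, ‖weightedEmbed W (R x)‖ ≤ ρ) {d : ι → ℝ} {s : ℝ}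
    (hd : HasDerivWithinAt E d (Icc 0 h) 0) (hs : ‖weightedEmbed W d‖ ≤ s) (hr : E h = 0)
    {x : ℝ} (hx : x ∈ Icc 0 h) :
    ‖weightedEmbed W (E x)‖ ≤ s * h + ρ * h ^ 2 / (2 * κ) :=
  norm_le_of_neumann (F := fun x => weightedEmbed W (E x))
    (F' := fun x => weightedEmbed W (E' x)) (F'' := fun x => weightedEmbed W (E'' x)) hh hκ hρ
    ((weightedEmbed W).continuous.comp_continuousOn hc)
    (fun x hx => (weightedEmbed W).hasFDerivAt.comp_hasDerivAt x (h1 x hx))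
    (fun x hx => (weightedEmbed W).hasFDerivAt.comp_hasDerivAt x (h2 x hx))
    (fun x hx => weighted_inner_lower hW hA (heq x hx) (hR x hx))
    ((weightedEmbed W).hasFDerivAt.comp_hasDerivWithinAt (0 : ℝ) hd) hs
    (by simp [hr]) hx

end WeightedNorm

/-! ### Unique solvability of the semi-discrete system. -/

section TwiceDifferentiable

variable {E : Type} [NormedAddCommGroup E] [NormedSpace ℝ E] {a b : ℝ} {f : ℝ → E}

lemma TwiceDifferentiable.hasDerivAt (h : TwiceDifferentiable a b f) {x : ℝ} (hx : x ∈ Ioo a b) :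
    HasDerivAt f (deriv f x) x :=
  ((h.1 x (Ioo_subset_Icc_self hx)).differentiableAt (Icc_mem_nhds hx.1 hx.2)).hasDerivAt

lemma TwiceDifferentiable.hasDerivAt_deriv (h : TwiceDifferentiable a b f) {x : ℝ}
    (hx : x ∈ Ioo a b) : HasDerivAt (deriv f) (deriv (deriv f) x) x :=
  ((h.2 x hx).differentiableAt (Ioo_mem_nhds hx.1 hx.2)).hasDerivAt

lemma twiceDifferentiable_of_hasDerivAt {f' f'' : ℝ → E} (h1 : ∀ x, HasDerivAt f (f' x) x)
    (h2 : ∀ x, HasDerivAt f' (f'' x) x) : TwiceDifferentiable a b f := by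
  have e : deriv f = f' := funext fun x => (h1 x).deriv
  refine ⟨fun x _ => (h1 x).differentiableAt.differentiableWithinAt, ?_⟩
  rw [e]
  exact fun x _ => (h2 x).differentiableAt.differentiableWithinAt

end TwiceDifferentiable

section SemiDiscrete

variable {ι : Type} [Fintype ι] {A : Matrix ι ι ℝ} {W : ι → ℝ} {κ₁ κ₂ h₁ h₂ : ℝ}

lemma IsSemiDiscreteSolution.unique (hW : ∀ j, 0 < W j)
    (hA : ∀ v, 0 ≤ ∑ j, W j * v j * (A *ᵥ v) j) (hκ₁ : 0 < κ₁) (hκ₂ : 0 < κ₂) (hh₁ : 0 < h₁)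
    (hh₂ : 0 < h₂) {g : ι → ℝ} {X₁ X₂ Z₁ Z₂ : ℝ → ι → ℝ}
    (hX : IsSemiDiscreteSolution A κ₁ κ₂ h₁ h₂ g X₁ X₂)
    (hZ : IsSemiDiscreteSolution A κ₁ κ₂ h₁ h₂ g Z₁ Z₂) :
    EqOn X₁ Z₁ (Icc (-h₁) 0) ∧ EqOn X₂ Z₂ (Icc 0 h₂) := by
  have e1 : EqOn X₁ Z₁ (Icc (-h₁) 0) := by
    intro x hx
    have hb := weighted_dirichlet_bound (E := fun x => X₁ x - Z₁ x) (R := fun _ => 0) (ρ := 0)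
      (fun j => (hW j).le) hA hh₁ hκ₁ le_rfl
      (hX.left_space.1.continuousOn.sub hZ.left_space.1.continuousOn)
      (fun x hx => (hX.left_space.hasDerivAt hx).sub (hZ.left_space.hasDerivAt hx))
      (fun x hx => (hX.left_space.hasDerivAt_deriv hx).sub (hZ.left_space.hasDerivAt_deriv hx))
      (fun x hx => by
        rw [smul_sub, ← hX.left_eq x hx, ← hZ.left_eq x hx, Matrix.mulVec_sub, add_zero])
      (fun x _ => by simp) (by simp [hX.left_outer, hZ.left_outer])
      (by simp [hX.interface, hZ.interface]) hx
    rw [zero_mul, zero_div, zero_mul] at hb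
    exact sub_eq_zero.1 (eq_zero_of_weightedEmbed hW (le_antisymm hb (norm_nonneg _)))
  refine ⟨e1, ?_⟩
  have hmem : (0 : ℝ) ∈ Icc 0 h₂ := left_mem_Icc.2 hh₂.le
  have hflux : derivWithin X₂ (Icc 0 h₂) 0 = derivWithin Z₂ (Icc 0 h₂) 0 := by
    have h0 : derivWithin X₁ (Icc (-h₁) 0) 0 = derivWithin Z₁ (Icc (-h₁) 0) 0 :=
      derivWithin_congr e1 (e1 (right_mem_Icc.2 (by linarith)))
    have := hX.flux
    rw [h0, ← hZ.flux] at this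
    exact smul_right_injective _ hκ₂.ne' this
  intro x hx
  have hb := weighted_neumann_bound (E := fun x => X₂ x - Z₂ x) (R := fun _ => 0) (ρ := 0)
    (s := 0) (fun j => (hW j).le) hA hh₂ hκ₂ le_rfl
    (hX.right_space.1.continuousOn.sub hZ.right_space.1.continuousOn)
    (fun x hx => (hX.right_space.hasDerivAt hx).sub (hZ.right_space.hasDerivAt hx))
    (fun x hx => (hX.right_space.hasDerivAt_deriv hx).sub (hZ.right_space.hasDerivAt_deriv hx))
    (fun x hx => by
      rw [smul_sub, ← hX.right_eq x hx, ← hZ.right_eq x hx, Matrix.mulVec_sub, add_zero])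
    (fun x _ => by simp)
    ((hX.right_space.1 0 hmem).hasDerivWithinAt.sub (hZ.right_space.1 0 hmem).hasDerivWithinAt)
    (by simp [hflux]) (by simp [hX.right_outer, hZ.right_outer]) hx
  rw [zero_mul, zero_mul, zero_div, add_zero] at hb
  exact sub_eq_zero.1 (eq_zero_of_weightedEmbed hW (le_antisymm hb (norm_nonneg _)))

/-- The solution operator of the initial value problem for `X'' = B X`. -/
lemma exists_second_order_flow (B : Matrix ι ι ℝ) :
    ∃ Ψ Ψ' : ℝ → ((ι → ℝ) × (ι → ℝ)) →ₗ[ℝ] (ι → ℝ),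
      (∀ u x, HasDerivAt (fun x => Ψ x u) (Ψ' x u) x) ∧
      (∀ u x, HasDerivAt (fun x => Ψ' x u) (B *ᵥ Ψ x u) x) ∧
      (∀ u, Ψ 0 u = u.1) ∧ ∀ u, Ψ' 0 u = u.2 := by
  let V := (ι → ℝ) × (ι → ℝ)
  let M : V →L[ℝ] V := LinearMap.toContinuousLinearMap
    ((LinearMap.snd ℝ (ι → ℝ) (ι → ℝ)).prod (B.mulVecLin ∘ₗ LinearMap.fst ℝ (ι → ℝ) (ι → ℝ)))
  have hM : ∀ u : V, M u = (u.2, B *ᵥ u.1) := fun u => rfl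
  have hd : ∀ (u : V) (x : ℝ), HasDerivAt (fun x : ℝ => NormedSpace.exp (x • M) u)
      (M (NormedSpace.exp (x • M) u)) x := by
    intro u x
    exact (hasDerivAt_exp_smul_const' (𝕂 := ℝ) M x).clm_apply (hasDerivAt_const x u) |>.congr_deriv
      (by simp)
  refine ⟨fun x => LinearMap.fst ℝ _ _ ∘ₗ (NormedSpace.exp (x • M) : V →L[ℝ] V).toLinearMap,
    fun x => LinearMap.snd ℝ _ _ ∘ₗ (NormedSpace.exp (x • M) : V →L[ℝ] V).toLinearMap,
    ?_, ?_, ?_, ?_⟩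
  · intro u x
    have := (ContinuousLinearMap.fst ℝ (ι → ℝ) (ι → ℝ)).hasFDerivAt.comp_hasDerivAt x (hd u x)
    exact this
  · intro u x
    have := (ContinuousLinearMap.snd ℝ (ι → ℝ) (ι → ℝ)).hasFDerivAt.comp_hasDerivAt x (hd u x)
    exact this
  · intro u; simp [NormedSpace.exp_zero]
  · intro u; simp [NormedSpace.exp_zero]

/-- Shooting. The map from the unknown initial datum at `0` to the value at the outer end is linear
between spaces of equal dimension. The a priori bounds with zero residual make it injective, hence
surjective. -/
lemma exists_isSemiDiscreteSolution (hW : ∀ j, 0 < W j)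
    (hA : ∀ v, 0 ≤ ∑ j, W j * v j * (A *ᵥ v) j) (hκ₁ : 0 < κ₁) (hκ₂ : 0 < κ₂) (hh₁ : 0 < h₁)
    (hh₂ : 0 < h₂) (g : ι → ℝ) :
    ∃ X₁ X₂ : ℝ → ι → ℝ, IsSemiDiscreteSolution A κ₁ κ₂ h₁ h₂ g X₁ X₂ := by
  have hscale : ∀ κ : ℝ, 0 < κ → ∀ v : ι → ℝ, κ • (κ⁻¹ • A) *ᵥ v = A *ᵥ v := by
    intro κ hκ v
    rw [Matrix.smul_mulVec, smul_smul, mul_inv_cancel₀ hκ.ne', one_smul]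
  obtain ⟨Φ, Φ', hΦ, hΦ', hΦ0, hΦ0'⟩ := exists_second_order_flow (κ₁⁻¹ • A)
  obtain ⟨Ψ, Ψ', hΨ, hΨ', hΨ0, hΨ0'⟩ := exists_second_order_flow (κ₂⁻¹ • A)
  have inj1 : Function.Injective (Φ (-h₁) ∘ₗ LinearMap.inr ℝ (ι → ℝ) (ι → ℝ)) := by
    rw [injective_iff_map_eq_zero]
    intro c hc
    have hz : ∀ x ∈ Icc (-h₁) 0, Φ x (0, c) = 0 := by
      intro x hx
      have hb := weighted_dirichlet_bound (E := fun x => Φ x (0, c)) (R := fun _ => 0) (ρ := 0)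
        (fun j => (hW j).le) hA hh₁ hκ₁ le_rfl
        (continuousOn_of_forall_continuousAt fun x _ => (hΦ _ x).continuousAt)
        (fun x _ => hΦ _ x) (fun x _ => hΦ' _ x) (fun x _ => by rw [hscale _ hκ₁, add_zero])
        (fun x _ => by simp) hc (hΦ0 _) hx
      rw [zero_mul, zero_div, zero_mul] at hb
      exact eq_zero_of_weightedEmbed hW (le_antisymm hb (norm_nonneg _))
    have hm : (0 : ℝ) ∈ Icc (-h₁) 0 := right_mem_Icc.2 (by linarith)
    have hu := (uniqueDiffOn_Icc (by linarith : -h₁ < 0)) 0 hm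
    have d1 := (hΦ (0, c) 0).hasDerivWithinAt (s := Icc (-h₁) 0)
    have d2 : HasDerivWithinAt (fun x => Φ x (0, c)) 0 (Icc (-h₁) 0) 0 :=
      (hasDerivWithinAt_const (0 : ℝ) _ (0 : ι → ℝ)).congr hz (hz 0 hm)
    rw [hΦ0'] at d1
    exact (hu.eq_deriv _ d1 d2)
  have inj2 : Function.Injective (Ψ h₂ ∘ₗ LinearMap.inl ℝ (ι → ℝ) (ι → ℝ)) := by
    rw [injective_iff_map_eq_zero]
    intro c hc
    have d0 := (hΨ (c, 0) 0).hasDerivWithinAt (s := Icc 0 h₂)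
    rw [hΨ0'] at d0
    have hb := weighted_neumann_bound (E := fun x => Ψ x (c, 0)) (R := fun _ => 0) (ρ := 0)
      (s := 0) (fun j => (hW j).le) hA hh₂ hκ₂ le_rfl
      (continuousOn_of_forall_continuousAt fun x _ => (hΨ _ x).continuousAt)
      (fun x _ => hΨ _ x) (fun x _ => hΨ' _ x) (fun x _ => by rw [hscale _ hκ₂, add_zero])
      (fun x _ => by simp) d0 (by simp) hc (left_mem_Icc.2 hh₂.le)
    rw [zero_mul, zero_mul, zero_div, add_zero] at hb
    refine (hΨ0 (c, 0)).symm.trans ?_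
    exact eq_zero_of_weightedEmbed hW (le_antisymm hb (norm_nonneg _))
  -- `q` is the slope at `0` that hits zero at `-h₁`. The flux condition prescribes the slope `(κ₁ /
  -- κ₂) • q` on the right, and `c` is the value at `0` that hits zero at `h₂`.
  obtain ⟨q, hq⟩ := LinearMap.injective_iff_surjective.1 inj1 (-Φ (-h₁) (g, 0))
  obtain ⟨c, hc⟩ := LinearMap.injective_iff_surjective.1 inj2
    (-Ψ h₂ (0, (κ₁ / κ₂) • q))
  have split : ∀ u w : ι → ℝ, ((u, w) : (ι → ℝ) × (ι → ℝ)) = (u, 0) + (0, w) := by simp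
  refine ⟨fun x => Φ x (g, q), fun x => Ψ x (c, (κ₁ / κ₂) • q),
    twiceDifferentiable_of_hasDerivAt (hΦ _) (hΦ' _),
    twiceDifferentiable_of_hasDerivAt (hΨ _) (hΨ' _), ?_, ?_, ?_, hΦ0 _, ?_, ?_⟩
  · intro x _
    rw [show deriv (fun x => Φ x (g, q)) = fun x => Φ' x (g, q) from
      funext fun x => (hΦ _ x).deriv, (hΦ' _ x).deriv, hscale _ hκ₁]
  · intro x _
    rw [show deriv (fun x => Ψ x (c, (κ₁ / κ₂) • q)) = fun x => Ψ' x (c, (κ₁ / κ₂) • q) from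
      funext fun x => (hΨ _ x).deriv, (hΨ' _ x).deriv, hscale _ hκ₂]
  · rw [split, map_add]
    exact (congrArg (Φ (-h₁) (g, 0) + ·) hq).trans (add_neg_cancel _)
  · rw [(hΨ _ 0).hasDerivWithinAt.derivWithin
        ((uniqueDiffOn_Icc hh₂) 0 (left_mem_Icc.2 hh₂.le)),
      (hΦ _ 0).hasDerivWithinAt.derivWithin
        ((uniqueDiffOn_Icc (by linarith : -h₁ < 0)) 0 (right_mem_Icc.2 (by linarith))), hΨ0', hΦ0']
    change κ₂ • (κ₁ / κ₂) • q = κ₁ • q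
    rw [smul_smul, mul_div_cancel₀ _ hκ₂.ne']
  · rw [split, map_add]
    exact (congrArg (· + Ψ h₂ (0, (κ₁ / κ₂) • q)) hc).trans (neg_add_cancel _)

end SemiDiscrete

/-! ### Eigenvalues of the coupled matrix. -/

section Eigenvalues

lemma charpoly_fromBlocks_coupling {m : Type} [Fintype m] [DecidableEq m] (A J : Matrix m m ℂ)
    {c z τ : ℂ} (hc : c ≠ 0) (hz : c * τ = z) (hcz : c * z = -1) :
    (Matrix.fromBlocks A (τ • J) (-J) A).charpoly =
      (A + z • J).charpoly * (A + (-z) • J).charpoly := by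
  -- The coupled matrix preserves the graphs `p = c y` and `p = -c y`, on which it acts as `A + z J`
  -- and `A - z J`. In the application `c = i √σ` and `z = i / √σ`.
  let P : (Matrix (m ⊕ m) (m ⊕ m) ℂ)ˣ :=
    { val := Matrix.fromBlocks 1 1 (c • 1) ((-c) • 1)
      inv := Matrix.fromBlocks ((1 / 2 : ℂ) • 1) ((1 / (2 * c)) • 1)
        ((1 / 2 : ℂ) • 1) ((-(1 / (2 * c))) • 1)
      val_inv := by
        rw [Matrix.fromBlocks_multiply, ← Matrix.fromBlocks_one]
        congr 1 <;> simp only [one_mul, Matrix.smul_mul, smul_smul, ← add_smul]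
        · norm_num
        · simp
        · simp
        · rw [show c * (1 / (2 * c)) + -c * -(1 / (2 * c)) = 1 by field_simp; norm_num, one_smul]
      inv_val := by
        rw [Matrix.fromBlocks_multiply, ← Matrix.fromBlocks_one]
        congr 1 <;> simp only [mul_one, Matrix.smul_mul, one_mul, smul_smul, ← add_smul]
        · rw [show (1 / 2 : ℂ) + 1 / (2 * c) * c = 1 by field_simp; norm_num, one_smul]
        · rw [show (1 / 2 : ℂ) + 1 / (2 * c) * -c = 0 by field_simp; norm_num, zero_smul]
        · rw [show (1 / 2 : ℂ) + -(1 / (2 * c)) * c = 0 by field_simp; norm_num, zero_smul]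
        · rw [show (1 / 2 : ℂ) + -(1 / (2 * c)) * -c = 1 by field_simp; norm_num, one_smul] }
  have hmul : Matrix.fromBlocks A (τ • J) (-J) A * P.val =
      P.val * Matrix.fromBlocks (A + z • J) 0 0 (A + (-z) • J) := by
    change Matrix.fromBlocks A (τ • J) (-J) A * Matrix.fromBlocks 1 1 (c • 1) ((-c) • 1) =
      Matrix.fromBlocks 1 1 (c • 1) ((-c) • 1) * _
    rw [Matrix.fromBlocks_multiply, Matrix.fromBlocks_multiply]
    congr 1 <;> simp only [one_mul, mul_one, Matrix.smul_mul, Matrix.mul_smul, smul_smul,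
      mul_zero, add_zero, zero_add, smul_add]
    · rw [hz]
    · rw [neg_mul, hz]
    · rw [hcz, neg_one_smul, add_comm]
    · rw [neg_mul_neg, hcz, neg_one_smul, add_comm]
  have : Matrix.fromBlocks A (τ • J) (-J) A =
      P.val * Matrix.fromBlocks (A + z • J) 0 0 (A + (-z) • J) * (P⁻¹).val := by
    rw [← hmul, mul_assoc, Units.mul_inv, mul_one]
  rw [this, Matrix.coe_units_inv, Matrix.charpoly_units_conj, Matrix.charpoly_fromBlocks_zero₁₂]

lemma eigenvalueMultiset_coupledMatrix (α : ℝ) {σ : ℝ} (hσ : 0 < σ) (t : ℕ → ℝ) (n : ℕ) :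
    eigenvalueMultiset ((coupledMatrix α σ t n).map Complex.ofReal) =
      eigenvalueMultiset (shiftedMatrix α t n (Complex.I / (Real.sqrt σ : ℂ))) +
      eigenvalueMultiset (shiftedMatrix α t n (-(Complex.I / (Real.sqrt σ : ℂ)))) := by
  have hs : (Real.sqrt σ : ℂ) ≠ 0 := by
    exact_mod_cast (Real.sqrt_pos.2 hσ).ne'
  have hs2 : (Real.sqrt σ : ℂ) * (Real.sqrt σ : ℂ) = (σ : ℂ) := by
    exact_mod_cast Real.mul_self_sqrt hσ.le
  have hm : (coupledMatrix α σ t n).map Complex.ofReal =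
      Matrix.fromBlocks ((l1Matrix α t n).map Complex.ofReal)
        ((σ : ℂ)⁻¹ • (exchangeBar n).map Complex.ofReal) (-(exchangeBar n).map Complex.ofReal)
        ((l1Matrix α t n).map Complex.ofReal) := by
    rw [coupledMatrix, Matrix.fromBlocks_map]
    congr 1
    · ext i k; simp
    · ext i k; simp
  unfold eigenvalueMultiset shiftedMatrix
  rw [hm, charpoly_fromBlocks_coupling _ _ (c := Complex.I * Real.sqrt σ)
    (z := Complex.I / Real.sqrt σ) (mul_ne_zero Complex.I_ne_zero hs) ?_ ?_,
    Polynomial.roots_mul]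
  · exact mul_ne_zero (Matrix.charpoly_monic _).ne_zero (Matrix.charpoly_monic _).ne_zero
  · rw [← hs2]; field_simp
  · field_simp; exact Complex.I_sq

variable {ι : Type} [Fintype ι] [DecidableEq ι] {A : Matrix ι ι ℝ} {W : ι → ℝ} {c : ℝ}

/-- Adding the weighted energies of the real and imaginary parts of an eigenvector cancels the
contribution of `z.im`; what remains is `z.re` times a positive number, bounded below by coercivity.
-/
lemma re_pos_of_mem_eigenvalueMultiset (hW : ∀ j, 0 < W j) (hc : 0 < c)
    (hA : ∀ v, c * ∑ j, W j * v j ^ 2 ≤ ∑ j, W j * v j * (A *ᵥ v) j) {z : ℂ}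
    (hz : z ∈ eigenvalueMultiset (A.map Complex.ofReal)) : 0 < z.re := by
  have hdet : (Matrix.scalar ι z - A.map Complex.ofReal).det = 0 := by
    rw [← Matrix.eval_charpoly]
    exact (Polynomial.mem_roots'.1 hz).2
  obtain ⟨v, hv0, hv⟩ := Matrix.exists_mulVec_eq_zero_iff.2 hdet
  rw [Matrix.sub_mulVec, sub_eq_zero] at hv
  have hv' : ∀ j, z * v j = ∑ k, (A j k : ℂ) * v k := by
    intro j
    have := congrFun hv j
    simpa [Matrix.mulVec, dotProduct, Matrix.diagonal_apply] using this
  set u := fun j => (v j).re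
  set w := fun j => (v j).im
  have hre : ∀ j, (A *ᵥ u) j = z.re * u j - z.im * w j := by
    intro j
    have := congrArg Complex.re (hv' j)
    simp only [Complex.mul_re, Complex.re_sum, Complex.ofReal_re, Complex.ofReal_im, zero_mul,
      sub_zero] at this
    exact this.symm
  have him : ∀ j, (A *ᵥ w) j = z.re * w j + z.im * u j := by
    intro j
    have := congrArg Complex.im (hv' j)
    simp only [Complex.mul_im, Complex.im_sum, Complex.ofReal_re, Complex.ofReal_im, zero_mul,
      add_zero] at this
    exact this.symm
  have hsum : ∑ j, W j * u j * (A *ᵥ u) j + ∑ j, W j * w j * (A *ᵥ w) j =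
      z.re * (∑ j, W j * u j ^ 2 + ∑ j, W j * w j ^ 2) := by
    rw [← Finset.sum_add_distrib, ← Finset.sum_add_distrib, Finset.mul_sum]
    refine Finset.sum_congr rfl fun j _ => ?_
    rw [hre, him]; ring
  have hpos : 0 < ∑ j, W j * u j ^ 2 + ∑ j, W j * w j ^ 2 := by
    rw [← Finset.sum_add_distrib]
    obtain ⟨j, hj⟩ := Function.ne_iff.1 hv0
    refine Finset.sum_pos' (fun k _ => by have := hW k; positivity) ⟨j, Finset.mem_univ _, ?_⟩
    rw [← mul_add]
    refine mul_pos (hW j) ?_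
    have := Complex.normSq_pos.2 hj
    rw [Complex.normSq_apply] at this
    simp only [u, w]; linarith
  have h1 := hA u
  have h2 := hA w
  have h3 : 0 < z.re * (∑ j, W j * u j ^ 2 + ∑ j, W j * w j ^ 2) := by
    rw [← hsum]; nlinarith
  exact (pos_iff_pos_of_mul_pos h3).2 hpos

lemma isUnit_add_smul_one (hW : ∀ j, 0 < W j) (hc : 0 < c)
    (hA : ∀ v, c * ∑ j, W j * v j ^ 2 ≤ ∑ j, W j * v j * (A *ᵥ v) j) (ξ : ℝ) :
    IsUnit (A + ξ ^ 2 • (1 : Matrix ι ι ℝ)) := by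
  rw [← Matrix.mulVec_injective_iff_isUnit]
  intro u₁ u₂ hu
  set v := u₁ - u₂
  have hv : (A *ᵥ v) + ξ ^ 2 • v = 0 := by
    have : (A + ξ ^ 2 • (1 : Matrix ι ι ℝ)) *ᵥ v = 0 := by
      rw [Matrix.mulVec_sub]; exact sub_eq_zero.2 hu
    rwa [Matrix.add_mulVec, Matrix.smul_mulVec, Matrix.one_mulVec] at this
  have hj : ∀ j, (A *ᵥ v) j = -(ξ ^ 2 * v j) := fun j => by
    have := congrFun hv j
    simp only [Pi.add_apply, Pi.smul_apply, smul_eq_mul, Pi.zero_apply] at this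
    linarith
  have h1 := hA v
  have h2 : ∑ j, W j * v j * (A *ᵥ v) j = -(ξ ^ 2 * ∑ j, W j * v j ^ 2) := by
    rw [Finset.mul_sum, ← Finset.sum_neg_distrib]
    exact Finset.sum_congr rfl fun j _ => by rw [hj]; ring
  have h3 : 0 ≤ ∑ j, W j * v j ^ 2 :=
    Finset.sum_nonneg fun j _ => mul_nonneg (hW j).le (sq_nonneg _)
  have h4 : ∑ j, W j * v j ^ 2 = 0 := by
    rw [h2] at h1
    nlinarith [mul_nonneg (sq_nonneg ξ) h3]
  refine sub_eq_zero.1 (eq_zero_of_weightedEmbed hW ?_)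
  exact pow_eq_zero_iff two_ne_zero |>.1 (by rw [norm_sq_weightedEmbed fun j => (hW j).le, h4])

end Eigenvalues

/-! ### The two mesh families: log-concavity, symmetry, step sizes. -/

section PowerIncrements

/-- The increments of `x ↦ x ^ r` on the integers. -/
noncomputable def powIncrement (r : ℝ) (j : ℕ) : ℝ := ((j : ℝ) + 1) ^ r - (j : ℝ) ^ r

variable {r : ℝ}

lemma powIncrement_pos (hr : 0 < r) (j : ℕ) : 0 < powIncrement r j :=
  sub_pos.2 (Real.rpow_lt_rpow (Nat.cast_nonneg j) (by linarith) hr)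

lemma powIncrement_mono (hr : 1 ≤ r) : Monotone (powIncrement r) := by
  refine monotone_nat_of_le_succ fun j => ?_
  have h := (convexOn_rpow hr).slope_mono_adjacent (x := (j : ℝ)) (y := (j : ℝ) + 1)
    (z := (j : ℝ) + 1 + 1) (mem_Ici.2 (Nat.cast_nonneg j)) (show (0 : ℝ) ≤ _ by positivity) (by linarith)
    (by linarith)
  simp only [add_sub_cancel_left, div_one] at h
  simpa only [powIncrement, Nat.cast_succ] using h

/-- Cauchy's mean value theorem for `(x + 1) ^ r` and `x ^ r`: the ratio of consecutive increments
is `((ξ + 1) / ξ) ^ (r - 1)`. -/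
lemma powIncrement_mul_rpow (r : ℝ) (j : ℕ) (hr : 1 ≤ r) : ∃ ξ : ℝ, (j : ℝ) < ξ ∧ ξ < j + 1 ∧
    powIncrement r j * (ξ + 1) ^ (r - 1) = powIncrement r (j + 1) * ξ ^ (r - 1) := by
  have hf : ∀ x : ℝ, 0 < x → HasDerivAt (fun x : ℝ => (x + 1) ^ r) (r * (x + 1) ^ (r - 1)) x := by
    intro x hx
    have := ((hasDerivAt_id x).add_const 1).rpow_const (p := r) (Or.inr hr)
    simpa [mul_comm] using this
  have hg : ∀ x : ℝ, 0 < x → HasDerivAt (fun x : ℝ => x ^ r) (r * x ^ (r - 1)) x := by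
    intro x hx
    exact Real.hasDerivAt_rpow_const (Or.inr hr)
  have hpos : ∀ x ∈ Ioo (j : ℝ) (j + 1), 0 < x := fun x hx => (Nat.cast_nonneg j).trans_lt hx.1
  have c1 : Continuous fun x : ℝ => x ^ r := Real.continuous_rpow_const (by linarith)
  obtain ⟨ξ, hξ, h⟩ := exists_ratio_hasDerivAt_eq_ratio_slope (fun x : ℝ => (x + 1) ^ r)
    (fun x => r * (x + 1) ^ (r - 1)) (by linarith : (j : ℝ) < j + 1)
    ((c1.comp (continuous_id.add continuous_const)).continuousOn) (fun x hx => hf x (hpos x hx))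
    (fun x : ℝ => x ^ r) (fun x => r * x ^ (r - 1)) c1.continuousOn
    (fun x hx => hg x (hpos x hx))
  refine ⟨ξ, hξ.1, hξ.2, ?_⟩
  have e1 : powIncrement r (j + 1) = ((j : ℝ) + 1 + 1) ^ r - ((j : ℝ) + 1) ^ r := by
    simp [powIncrement]
  rw [e1, powIncrement]
  have hr0 : r ≠ 0 := by linarith
  refine mul_left_cancel₀ hr0 ?_
  linear_combination h

/-- Successive ratios are values of the decreasing function `((ξ + 1) / ξ) ^ (r - 1)` at points of
successive unit intervals. -/
lemma powIncrement_logConcave (hr : 1 ≤ r) (j : ℕ) :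
    powIncrement r j * powIncrement r (j + 2) ≤ powIncrement r (j + 1) ^ 2 := by
  obtain ⟨ξ, h1, h2, h3⟩ := powIncrement_mul_rpow r j hr
  obtain ⟨ζ, h4, h5, h6⟩ := powIncrement_mul_rpow r (j + 1) hr
  push_cast at h4
  have p0 := powIncrement_pos (by linarith : 0 < r) j
  have p1 := powIncrement_pos (by linarith : 0 < r) (j + 1)
  have p2 := powIncrement_pos (by linarith : 0 < r) (j + 2)
  have hξ : 0 < ξ := (Nat.cast_nonneg j).trans_lt h1
  have hζ : 0 < ζ := hξ.trans (h2.trans h4)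
  have hmon : ((ζ + 1) * ξ) ^ (r - 1) ≤ (ζ * (ξ + 1)) ^ (r - 1) :=
    Real.rpow_le_rpow (by positivity) (by nlinarith) (by linarith)
  rw [Real.mul_rpow (by positivity) hξ.le, Real.mul_rpow hζ.le (by positivity)] at hmon
  set a := powIncrement r j
  set b := powIncrement r (j + 1)
  set c := powIncrement r (j + 2)
  have hA : 0 < (ξ + 1) ^ (r - 1) := Real.rpow_pos_of_pos (by linarith) _
  have hD : 0 < ζ ^ (r - 1) := Real.rpow_pos_of_pos hζ _
  set A := (ξ + 1) ^ (r - 1)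
  set B := ξ ^ (r - 1)
  set Z := (ζ + 1) ^ (r - 1)
  set D := ζ ^ (r - 1)
  have : a * c * (A * D) ≤ b ^ 2 * (A * D) := by
    calc a * c * (A * D) = (a * A) * (c * D) := by ring
      _ = (b * B) * (b * Z) := by rw [h3, h6]
      _ = b ^ 2 * (Z * B) := by ring
      _ ≤ b ^ 2 * (D * A) := by gcongr
      _ = _ := by ring
  exact le_of_mul_le_mul_right this (by positivity)

lemma powIncrement_le (hr : 1 ≤ r) (j : ℕ) : powIncrement r j ≤ r * ((j : ℝ) + 1) ^ (r - 1) := by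
  have hj : (0 : ℝ) < j + 1 := by positivity
  have hb := one_add_mul_self_le_rpow_one_add (s := -1 / ((j : ℝ) + 1))
    (by rw [le_div_iff₀ hj]; linarith [Nat.cast_nonneg (α := ℝ) j]) hr
  have e : 1 + -1 / ((j : ℝ) + 1) = j / (j + 1) := by field_simp; ring
  rw [e, Real.div_rpow (Nat.cast_nonneg j) hj.le, le_div_iff₀ (Real.rpow_pos_of_pos hj _)] at hb
  have e2 : ((j : ℝ) + 1) ^ r = (j + 1) * ((j : ℝ) + 1) ^ (r - 1) := by
    rw [← Real.rpow_one_add' hj.le (by linarith)]; congr 1; ring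
  have e3 : (1 + r * (-1 / ((j : ℝ) + 1))) * ((j : ℝ) + 1) ^ r =
      ((j : ℝ) + 1) ^ r - r * ((j : ℝ) + 1) ^ (r - 1) := by
    rw [e2]; field_simp; ring
  rw [powIncrement]
  linarith

end PowerIncrements

namespace TimeMesh

lemma one_lt_gradingExponent {α : ℝ} (h₀ : 0 < α) (h₁ : α < 1) : 1 < (2 - α) / α := by
  rw [lt_div_iff₀ h₀]; linarith

section Graded

variable {α T : ℝ} {m : ℕ}

lemma node_graded_left {j : ℕ} (hj : j ≤ m + 1) :
    bothSidedGraded.node α T (2 * m + 1) j =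
      T / 2 / ((m : ℝ) + 1) ^ ((2 - α) / α) * (j : ℝ) ^ ((2 - α) / α) := by
  have e : (((2 * m + 1 : ℕ) : ℝ) + 1) / 2 = m + 1 := by push_cast; ring
  rw [node, if_pos (by omega), e, Real.div_rpow (Nat.cast_nonneg j) (by positivity)]
  ring

lemma node_graded_right {j k : ℕ} (hj : m + 1 ≤ j) (hk : j + k = 2 * m + 2) :
    bothSidedGraded.node α T (2 * m + 1) j =
      T - T / 2 / ((m : ℝ) + 1) ^ ((2 - α) / α) * (k : ℝ) ^ ((2 - α) / α) := by
  have e : (((2 * m + 1 : ℕ) : ℝ) + 1) / 2 = m + 1 := by push_cast; ring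
  have e2 : ((2 * m + 1 : ℕ) : ℝ) + 1 - j = k := by
    have : ((j + k : ℕ) : ℝ) = ((2 * m + 2 : ℕ) : ℝ) := by rw [hk]
    push_cast at this ⊢; linarith
  rcases hj.eq_or_lt with rfl | hj
  · obtain rfl : k = m + 1 := by omega
    rw [node_graded_left le_rfl]
    have : (0 : ℝ) < ((m : ℝ) + 1) ^ ((2 - α) / α) := Real.rpow_pos_of_pos (by positivity) _
    push_cast
    field_simp
    ring
  · rw [node, if_neg (by omega), e, e2, Real.div_rpow (Nat.cast_nonneg k) (by positivity)]
    ring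

/-- The minimum folds the two halves into one formula: a step depends only on the number of cells to
the nearer end. -/
lemma node_graded_step {j k : ℕ} (hjk : j + k = 2 * m + 1) :
    bothSidedGraded.node α T (2 * m + 1) (j + 1) - bothSidedGraded.node α T (2 * m + 1) j =
      T / 2 / ((m : ℝ) + 1) ^ ((2 - α) / α) * powIncrement ((2 - α) / α) (min j k) := by
  rcases le_or_gt j m with h | h
  · rw [node_graded_left (by omega), node_graded_left (by omega), min_eq_left (by omega),
      powIncrement]
    push_cast; ring
  · rw [node_graded_right (j := j + 1) (k := k) (by omega) (by omega),
      node_graded_right (j := j) (k := k + 1) (by omega) (by omega), min_eq_right (by omega),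
      powIncrement]
    push_cast; ring

lemma logConcaveMesh_graded (h₀ : 0 < α) (h₁ : α < 1) (hT : 0 < T) :
    LogConcaveMesh T (2 * m + 1) (bothSidedGraded.node α T (2 * m + 1)) := by
  have hr := one_lt_gradingExponent h₀ h₁
  have hK : 0 < T / 2 / ((m : ℝ) + 1) ^ ((2 - α) / α) :=
    div_pos (by linarith) (Real.rpow_pos_of_pos (by positivity) _)
  refine ⟨by omega, ?_, ?_, ?_, ?_⟩
  · rw [node_graded_left (by omega)]
    rw [Nat.cast_zero, Real.zero_rpow (by linarith), mul_zero]
  · intro j hj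
    rw [← sub_pos, node_graded_step (k := 2 * m + 1 - j) (by omega)]
    exact mul_pos hK (powIncrement_pos (by linarith) _)
  · intro j hj
    rcases le_or_gt j (m + 1) with h | h
    · rw [node_graded_left h, node_graded_right (k := j) (by omega) (by omega)]
    · rw [node_graded_right (j := j) (k := 2 * m + 2 - j) (by omega) (by omega),
        node_graded_left (j := 2 * m + 1 + 1 - j) (by omega)]
      ring
  · intro j hj
    rw [node_graded_step (j := j) (k := 2 * m + 1 - j) (by omega),
      node_graded_step (j := j + 1) (k := 2 * m - j) (by omega),
      node_graded_step (j := j + 2) (k := 2 * m - 1 - j) (by omega)]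
    have key : powIncrement ((2 - α) / α) (min j (2 * m + 1 - j)) *
        powIncrement ((2 - α) / α) (min (j + 2) (2 * m - 1 - j)) ≤
        powIncrement ((2 - α) / α) (min (j + 1) (2 * m - j)) ^ 2 := by
      rcases lt_trichotomy (j + 1) m with h | h | h
      · rw [min_eq_left (by omega), min_eq_left (by omega), min_eq_left (by omega)]
        exact powIncrement_logConcave hr.le j
      -- At the fold no outer increment has a larger index than the middle one, so monotonicity of
      -- the increments suffices.
      · rw [pow_two]
        exact mul_le_mul (powIncrement_mono hr.le (by omega)) (powIncrement_mono hr.le (by omega))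
          (powIncrement_pos (by linarith) _).le (powIncrement_pos (by linarith) _).le
      · rcases Nat.eq_or_lt_of_le (Nat.succ_le_of_lt h) with h | h
        · rw [pow_two]
          exact mul_le_mul (powIncrement_mono hr.le (by omega))
            (powIncrement_mono hr.le (by omega))
            (powIncrement_pos (by linarith) _).le (powIncrement_pos (by linarith) _).le
        · rw [min_eq_right (by omega), min_eq_right (by omega), min_eq_right (by omega), mul_comm]
          have := powIncrement_logConcave hr.le (2 * m - 1 - j)
          rwa [show 2 * m - 1 - j + 2 = 2 * m + 1 - j by omega,
            show 2 * m - 1 - j + 1 = 2 * m - j by omega] at this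
    set K := T / 2 / ((m : ℝ) + 1) ^ ((2 - α) / α)
    nlinarith [mul_le_mul_of_nonneg_left key (sq_nonneg K)]

end Graded

lemma logConcaveMesh_uniform (α : ℝ) {T : ℝ} (hT : 0 < T) {n : ℕ} (hn : 1 ≤ n) :
    LogConcaveMesh T n (uniform.node α T n) := by
  have hn1 : (0 : ℝ) < n + 1 := by positivity
  have hs : ∀ j : ℕ, uniform.node α T n (j + 1) - uniform.node α T n j = T / (n + 1) := by
    intro j; simp only [node]; push_cast; field_simp; ring
  refine ⟨hn, by simp [node], ?_, ?_, ?_⟩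
  · intro j _
    rw [← sub_pos, hs]; positivity
  · intro j hj
    simp only [node]
    rw [Nat.cast_sub hj]; push_cast; field_simp
  · intro j _
    rw [hs, hs (j + 1), hs (j + 2), pow_two]

variable {α T : ℝ}

lemma logConcaveMesh (mesh : TimeMesh) (h₀ : 0 < α) (h₁ : α < 1) (hT : 0 < T) {n : ℕ}
    (hn : mesh.Admissible n) : LogConcaveMesh T n (mesh.node α T n) := by
  cases mesh with
  | uniform => exact logConcaveMesh_uniform α hT hn
  | bothSidedGraded =>
    obtain ⟨m, rfl⟩ : Odd n := hn
    exact logConcaveMesh_graded h₀ h₁ hT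

/-- The steps are of size `O(1/n)`, and the ratio of the first two is bounded. -/
lemma exists_step_bound (mesh : TimeMesh) (h₀ : 0 < α) (h₁ : α < 1) (hT : 0 < T) :
    ∃ C : ℝ, 1 ≤ C ∧ ∀ n, mesh.Admissible n →
      (∀ j ≤ n, mesh.node α T n (j + 1) - mesh.node α T n j ≤ C / (n + 1)) ∧
      mesh.node α T n 2 - mesh.node α T n 1 ≤
        C * (mesh.node α T n 1 - mesh.node α T n 0) := by
  cases mesh with
  | uniform =>
    refine ⟨max 1 T, le_max_left _ _, fun n _ => ?_⟩
    have hn1 : (0 : ℝ) < n + 1 := by positivity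
    have hs : ∀ j : ℕ, uniform.node α T n (j + 1) - uniform.node α T n j = T / (n + 1) := by
      intro j; simp only [node]; push_cast; field_simp; ring
    refine ⟨fun j _ => ?_, ?_⟩
    · rw [hs]; gcongr; exact le_max_right _ _
    · rw [hs 0, hs 1]
      exact le_mul_of_one_le_left (by positivity) (le_max_left _ _)
  | bothSidedGraded =>
    have hr := one_lt_gradingExponent h₀ h₁
    set r := (2 - α) / α with hrdef
    -- `2 ^ r` bounds the ratio of the first two steps, and `T * r` bounds `n + 1` times the largest
    -- step, which is in the middle.
    refine ⟨max (2 ^ r) (T * r), le_max_of_le_left (Real.one_le_rpow (by norm_num) (by linarith)),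
      fun n hn => ?_⟩
    obtain ⟨m, rfl⟩ : Odd n := hn
    have hm : (0 : ℝ) < m + 1 := by positivity
    have hK : 0 < T / 2 / ((m : ℝ) + 1) ^ r :=
      div_pos (by linarith) (Real.rpow_pos_of_pos hm _)
    refine ⟨fun j hj => ?_, ?_⟩
    · rw [node_graded_step (k := 2 * m + 1 - j) (by omega), ← hrdef]
      have e2 : ((m : ℝ) + 1) ^ r = (m + 1) * ((m : ℝ) + 1) ^ (r - 1) := by
        rw [← Real.rpow_one_add' hm.le (by linarith)]; congr 1; ring
      calc _ ≤ T / 2 / ((m : ℝ) + 1) ^ r * (r * ((m : ℝ) + 1) ^ (r - 1)) := by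
            gcongr
            exact (powIncrement_mono hr.le (by omega)).trans (powIncrement_le hr.le m)
        _ = T * r / (((2 * m + 1 : ℕ) : ℝ) + 1) := by
            have : 0 < ((m : ℝ) + 1) ^ (r - 1) := Real.rpow_pos_of_pos hm _
            rw [e2]; push_cast; field_simp; ring
        _ ≤ _ := by gcongr; exact le_max_right _ _
    · rw [node_graded_step (j := 1) (k := 2 * m) (by omega),
        node_graded_step (j := 0) (k := 2 * m + 1) (by omega), ← hrdef, mul_left_comm]
      refine mul_le_mul_of_nonneg_left ?_ hK.le
      have e0 : powIncrement r (min 0 (2 * m + 1)) = 1 := by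
        simp [powIncrement, Real.zero_rpow (by linarith : r ≠ 0)]
      have e1 : powIncrement r 1 ≤ 2 ^ r := by
        simp only [powIncrement, Nat.cast_one, Real.one_rpow]; norm_num
      rw [e0, mul_one]
      exact (powIncrement_mono hr.le (min_le_left _ _)).trans (e1.trans (le_max_left _ _))

/-- Nodes with a proportionally large index stay away from `0`. -/
lemma exists_node_lower_bound (mesh : TimeMesh) (h₀ : 0 < α) (h₁ : α < 1) (hT : 0 < T) {θ : ℝ}
    (hθ : 0 < θ) : ∃ δ > 0, ∀ n, mesh.Admissible n → ∀ j ≤ n + 1, θ * ((n : ℝ) + 1) ≤ j →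
      δ ≤ mesh.node α T n j := by
  cases mesh with
  | uniform =>
    refine ⟨θ * T, by positivity, fun n _ j _ hj => ?_⟩
    have hn1 : (0 : ℝ) < n + 1 := by positivity
    simp only [node]
    gcongr
    rwa [le_div_iff₀ hn1]
  | bothSidedGraded =>
    have hr := one_lt_gradingExponent h₀ h₁
    -- In the left half the relative index is at least `2 * θ`; nodes in the right half are at least
    -- `T / 2`.
    refine ⟨min ((2 * θ) ^ ((2 - α) / α)) 1 * (T / 2), by positivity, fun n hn j hjn hj => ?_⟩
    have hmesh := logConcaveMesh bothSidedGraded h₀ h₁ hT hn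
    obtain ⟨m, rfl⟩ : Odd n := hn
    have hm : (0 : ℝ) < m + 1 := by positivity
    rcases le_or_gt j (m + 1) with h | h
    · rw [node_graded_left h]
      calc min ((2 * θ) ^ ((2 - α) / α)) 1 * (T / 2) ≤
          ((j : ℝ) / (m + 1)) ^ ((2 - α) / α) * (T / 2) := by
            gcongr
            refine (min_le_left _ _).trans (Real.rpow_le_rpow (by positivity) ?_ (by linarith))
            rw [le_div_iff₀ hm]
            push_cast at hj; linarith
        _ = _ := by rw [Real.div_rpow (Nat.cast_nonneg j) hm.le]; ring
    · have h1 := hmesh.le (show m + 1 ≤ j by omega) (by omega)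
      rw [node_graded_left le_rfl] at h1
      have : (0 : ℝ) < ((m : ℝ) + 1) ^ ((2 - α) / α) := Real.rpow_pos_of_pos hm _
      push_cast at h1
      rw [div_mul_cancel₀ _ this.ne'] at h1
      refine le_trans ?_ h1
      have : min ((2 * θ) ^ ((2 - α) / α)) 1 ≤ 1 := min_le_right _ _
      nlinarith

end TimeMesh

/-! ### Consistency of the L1 scheme. -/

section Majorant

/-- An integrable majorant, on `(0, τ)`, of the Caputo kernel times
`e + c (s ^ (a - 1) + (T - s) ^ (b - 1))`. -/
noncomputable def kernelMajorant (α a b e c τ s : ℝ) : ℝ :=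
  e * (τ - s) ^ (-α) +
    c * ((τ / 2) ^ (-α) * s ^ (a - 1) + (τ / 2) ^ (a - 1) * (τ - s) ^ (-α) + (τ - s) ^ (b - 1 - α))

variable {α a b e c τ T : ℝ}

/-- Of the singularities at `0` and `τ`, only one is active on each side of `τ / 2`. Since `τ ≤ T`
and `b < 1`, the singularity at `T` may be moved to `τ`. -/
lemma kernel_mul_le_majorant (h₀ : 0 < α) (ha₁ : a < 1) (hb₁ : b < 1) (hc : 0 ≤ c) {s : ℝ}
    (hs : 0 < s) (hsτ : s < τ) (hτ : τ ≤ T) :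
    (τ - s) ^ (-α) * (e + c * (s ^ (a - 1) + (T - s) ^ (b - 1))) ≤
      kernelMajorant α a b e c τ s := by
  have hd : 0 < τ - s := by linarith
  have hτ0 : 0 < τ / 2 := by linarith
  have p1 : 0 < (τ - s) ^ (-α) := Real.rpow_pos_of_pos hd _
  have p2 : 0 < s ^ (a - 1) := Real.rpow_pos_of_pos hs _
  have p3 : 0 < (τ / 2) ^ (-α) := Real.rpow_pos_of_pos hτ0 _
  have p4 : 0 < (τ / 2) ^ (a - 1) := Real.rpow_pos_of_pos hτ0 _
  have i1 : (τ - s) ^ (-α) * s ^ (a - 1) ≤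
      (τ / 2) ^ (-α) * s ^ (a - 1) + (τ / 2) ^ (a - 1) * (τ - s) ^ (-α) := by
    rcases le_or_gt s (τ / 2) with h | h
    · have : (τ - s) ^ (-α) ≤ (τ / 2) ^ (-α) :=
        Real.rpow_le_rpow_of_nonpos hτ0 (by linarith) (by linarith)
      nlinarith [mul_le_mul_of_nonneg_right this p2.le, mul_pos p4 p1]
    · have : s ^ (a - 1) ≤ (τ / 2) ^ (a - 1) :=
        Real.rpow_le_rpow_of_nonpos hτ0 h.le (by linarith)
      nlinarith [mul_le_mul_of_nonneg_left this p1.le, mul_pos p3 p2]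
  have i2 : (τ - s) ^ (-α) * (T - s) ^ (b - 1) ≤ (τ - s) ^ (b - 1 - α) := by
    have e1 : (τ - s) ^ (b - 1 - α) = (τ - s) ^ (-α) * (τ - s) ^ (b - 1) := by
      rw [← Real.rpow_add hd]; congr 1; ring
    rw [e1]
    exact mul_le_mul_of_nonneg_left
      (Real.rpow_le_rpow_of_nonpos hd (by linarith) (by linarith)) p1.le
  have i3 := mul_le_mul_of_nonneg_left (add_le_add i1 i2) hc
  rw [kernelMajorant]
  linarith

lemma intervalIntegrable_sub_rpow (τ : ℝ) {p : ℝ} (hp : -1 < p) (x y : ℝ) :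
    IntervalIntegrable (fun s : ℝ => (τ - s) ^ p) MeasureTheory.volume x y := by
  have := (intervalIntegral.intervalIntegrable_rpow' (a := τ - x) (b := τ - y) hp).comp_sub_left τ
  simpa using this

lemma integral_sub_rpow (τ : ℝ) {p : ℝ} (hp : -1 < p) (x y : ℝ) :
    ∫ s in x..y, (τ - s) ^ p = ((τ - x) ^ (p + 1) - (τ - y) ^ (p + 1)) / (p + 1) := by
  rw [intervalIntegral.integral_comp_sub_left (fun u : ℝ => u ^ p) τ, integral_rpow (Or.inl hp)]

lemma intervalIntegrable_kernelMajorant (h₁ : α < 1) (ha : 0 < a) (hb : α < b) (x y : ℝ) :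
    IntervalIntegrable (kernelMajorant α a b e c τ) MeasureTheory.volume x y := by
  unfold kernelMajorant
  have k := intervalIntegrable_sub_rpow τ (by linarith : -1 < -α) x y
  have k2 := intervalIntegrable_sub_rpow τ (by linarith : -1 < b - 1 - α) x y
  have k3 := intervalIntegral.intervalIntegrable_rpow' (a := x) (b := y)
    (by linarith : -1 < a - 1)
  exact (k.const_mul e).add ((((k3.const_mul _).add (k.const_mul _)).add k2).const_mul c)

/-- The only term that can blow up as `τ` tends to zero is `τ ^ (a - α)`. With `a = α` the bound is
uniform; with `a` slightly smaller it is uniform only away from `0`, which is why smallness of the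
error is restricted to `δ ≤ τ`. -/
lemma integral_kernelMajorant_le (h₁ : α < 1) (ha : 0 < a)
    (hb : α < b) (he : 0 ≤ e) (hc : 0 ≤ c) (hτ : 0 < τ) (hτT : τ ≤ T) :
    ∫ s in (0 : ℝ)..τ, kernelMajorant α a b e c τ s ≤
      e * (T ^ (1 - α) / (1 - α)) +
        c * ((2 / a + 2 / (1 - α)) * τ ^ (a - α) + T ^ (b - α) / (b - α)) := by
  have k := intervalIntegrable_sub_rpow τ (by linarith : -1 < -α) 0 τ
  have k2 := intervalIntegrable_sub_rpow τ (by linarith : -1 < b - 1 - α) 0 τ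
  have k3 := intervalIntegral.intervalIntegrable_rpow' (a := 0) (b := τ)
    (by linarith : -1 < a - 1)
  unfold kernelMajorant
  rw [intervalIntegral.integral_add (k.const_mul e)
      ((((k3.const_mul _).add (k.const_mul _)).add k2).const_mul c),
    intervalIntegral.integral_const_mul, intervalIntegral.integral_const_mul,
    intervalIntegral.integral_add ((k3.const_mul _).add (k.const_mul _)) k2,
    intervalIntegral.integral_add (k3.const_mul _) (k.const_mul _),
    intervalIntegral.integral_const_mul, intervalIntegral.integral_const_mul,
    integral_sub_rpow τ (by linarith : -1 < -α), integral_sub_rpow τ (by linarith : -1 < b - 1 - α),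
    integral_rpow (Or.inl (by linarith : -1 < a - 1))]
  have e1 : -α + 1 = 1 - α := by ring
  have e2 : b - 1 - α + 1 = b - α := by ring
  have e3 : a - 1 + 1 = a := by ring
  rw [e1, e2, e3, sub_self, sub_zero, Real.zero_rpow (by linarith : 1 - α ≠ 0),
    Real.zero_rpow (by linarith : b - α ≠ 0), Real.zero_rpow ha.ne', sub_zero, sub_zero, sub_zero]
  have hα1 : 0 < 1 - α := by linarith
  have hbα : 0 < b - α := by linarith
  have t1 : (τ / 2) ^ (-α) * (τ ^ a / a) ≤ 2 / a * τ ^ (a - α) := by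
    have : (τ / 2) ^ (-α) ≤ 2 * τ ^ (-α) := by
      rw [Real.div_rpow hτ.le (by norm_num), Real.rpow_neg (by norm_num : (0 : ℝ) ≤ 2), div_inv_eq_mul,
        mul_comm]
      gcongr
      calc (2 : ℝ) ^ α ≤ 2 ^ (1 : ℝ) := Real.rpow_le_rpow_of_exponent_le (by norm_num) h₁.le
        _ = 2 := Real.rpow_one 2
    calc _ ≤ 2 * τ ^ (-α) * (τ ^ a / a) := by gcongr
      _ = 2 / a * (τ ^ a * τ ^ (-α)) := by ring
      _ = _ := by rw [← Real.rpow_add hτ]; rfl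
  have t2 : (τ / 2) ^ (a - 1) * (τ ^ (1 - α) / (1 - α)) ≤ 2 / (1 - α) * τ ^ (a - α) := by
    have : (τ / 2) ^ (a - 1) ≤ 2 * τ ^ (a - 1) := by
      rw [Real.div_rpow hτ.le (by norm_num), show a - 1 = -(1 - a) by ring,
        Real.rpow_neg (by norm_num : (0 : ℝ) ≤ 2), div_inv_eq_mul, mul_comm]
      gcongr
      calc (2 : ℝ) ^ (1 - a) ≤ 2 ^ (1 : ℝ) :=
            Real.rpow_le_rpow_of_exponent_le (by norm_num) (by linarith)
        _ = 2 := Real.rpow_one 2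
    calc _ ≤ 2 * τ ^ (a - 1) * (τ ^ (1 - α) / (1 - α)) := by gcongr
      _ = 2 / (1 - α) * (τ ^ (a - 1) * τ ^ (1 - α)) := by ring
      _ = _ := by rw [← Real.rpow_add hτ]; ring_nf
  have t3 : τ ^ (1 - α) ≤ T ^ (1 - α) := Real.rpow_le_rpow hτ.le hτT hα1.le
  have t4 : τ ^ (b - α) ≤ T ^ (b - α) := Real.rpow_le_rpow hτ.le hτT hbα.le
  refine add_le_add (by gcongr) (mul_le_mul_of_nonneg_left ?_ hc)
  have t5 : τ ^ (b - α) / (b - α) ≤ T ^ (b - α) / (b - α) := by gcongr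
  linarith

end Majorant

section Truncation

variable {T α : ℝ} {n : ℕ} {t : ℕ → ℝ}

/-- A pointwise bound of the error of the difference quotients on the cells gives a bound of the
truncation error of the L1 scheme. -/
lemma LogConcaveMesh.abs_truncation_le (h : LogConcaveMesh T n t) (h₀ : 0 < α) (h₁ : α < 1)
    {f : ℝ → ℝ} (hf0 : f 0 = 0) (hfc : ContinuousOn (deriv f) (Ioo 0 T))
    {b₀ c₀ : ℝ} (hb₀ : α < b₀) (hb₀' : b₀ < 1) (hc₀ : 0 ≤ c₀)
    (hbound : ∀ s ∈ Ioo 0 T, |deriv f s| ≤ c₀ * (s ^ (α - 1) + (T - s) ^ (b₀ - 1)))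
    {a b e c : ℝ} (ha : 0 < a) (ha₁ : a < 1) (hb : α < b) (hb₁ : b < 1) (he : 0 ≤ e) (hc : 0 ≤ c)
    (i : Fin (n + 1))
    (hcell : ∀ k ≤ n, ∀ s ∈ Ioo (t k) (t (k + 1)),
      |(f (t (k + 1)) - f (t k)) / (t (k + 1) - t k) - deriv f s| ≤
        e + c * (s ^ (a - 1) + (T - s) ^ (b - 1))) :
    |(l1Matrix α t n *ᵥ fun k => f (t ((k : ℕ) + 1))) i - caputoLeft α f (t ((i : ℕ) + 1))| ≤
      (Real.Gamma (1 - α))⁻¹ * (e * (T ^ (1 - α) / (1 - α)) +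
        c * ((2 / a + 2 / (1 - α)) * t ((i : ℕ) + 1) ^ (a - α) + T ^ (b - α) / (b - α))) := by
  have hin : (i : ℕ) ≤ n := by omega
  set τ := t ((i : ℕ) + 1) with hτdef
  have hτ0 : 0 < τ := by rw [← h.zero]; exact h.lt (by omega) (by omega)
  have hτT : τ ≤ T := h.le_last (by omega)
  have hΓ : 0 < Real.Gamma (1 - α) := Real.Gamma_pos_of_pos (by linarith)
  have hα1 : 0 < 1 - α := by linarith
  have hker := fun x y => intervalIntegrable_sub_rpow τ (by linarith : -1 < -α) x y
  have hcellsub : ∀ k ≤ (i : ℕ), t k < t (k + 1) ∧ 0 ≤ t k ∧ t (k + 1) ≤ τ := fun k hk =>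
    ⟨h.lt_succ k (by omega), h.nonneg (by omega), h.le (by omega) (by omega)⟩
  have hint : IntervalIntegrable (fun s => (τ - s) ^ (-α) * deriv f s) MeasureTheory.volume 0 τ := by
    refine (intervalIntegrable_kernelMajorant (e := 0) (c := c₀) (τ := τ) h₁ h₀ hb₀ 0 τ).mono_fun'
      ?_ ?_
    · rw [uIoc_of_le hτ0.le, ← MeasureTheory.Measure.restrict_congr_set
        (MeasureTheory.Ioo_ae_eq_Ioc (a := (0 : ℝ)) (b := τ))]
      refine ContinuousOn.aestronglyMeasurable ?_ measurableSet_Ioo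
      refine ContinuousOn.mul (fun s hs => ?_) (hfc.mono (Ioo_subset_Ioo_right hτT))
      refine ContinuousAt.continuousWithinAt ?_
      exact ContinuousAt.rpow_const (by fun_prop) (Or.inl (by linarith [hs.2]))
    · rw [uIoc_of_le hτ0.le, ← MeasureTheory.Measure.restrict_congr_set
        (MeasureTheory.Ioo_ae_eq_Ioc (a := (0 : ℝ)) (b := τ))]
      refine (MeasureTheory.ae_restrict_iff' measurableSet_Ioo).2 (Eventually.of_forall ?_)
      intro s hs
      have hk : 0 ≤ (τ - s) ^ (-α) := Real.rpow_nonneg (by linarith [hs.2]) _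
      change ‖(τ - s) ^ (-α) * deriv f s‖ ≤ _
      rw [Real.norm_eq_abs, abs_mul, abs_of_nonneg hk]
      refine le_trans ?_ (kernel_mul_le_majorant (e := 0) h₀ h₁ hb₀' hc₀ hs.1 hs.2 hτT)
      rw [zero_add]
      exact mul_le_mul_of_nonneg_left (hbound s ⟨hs.1, hs.2.trans_le hτT⟩) hk
  have hcellint : ∀ k ≤ (i : ℕ), ∀ g : ℝ → ℝ, IntervalIntegrable g MeasureTheory.volume 0 τ →
      IntervalIntegrable g MeasureTheory.volume (t k) (t (k + 1)) := by
    intro k hk g hg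
    obtain ⟨c1, c2, c3⟩ := hcellsub k hk
    refine hg.mono_set ?_
    rw [uIcc_of_le c1.le, uIcc_of_le hτ0.le]
    exact Icc_subset_Icc c2 c3
  have hadj : ∀ g : ℝ → ℝ, IntervalIntegrable g MeasureTheory.volume 0 τ →
      ∑ k ∈ Finset.range ((i : ℕ) + 1), ∫ s in t k..t (k + 1), g s = ∫ s in (0 : ℝ)..τ, g s := by
    intro g hg
    rw [intervalIntegral.sum_integral_adjacent_intervals
      (fun k hk => hcellint k (by omega) g hg), h.zero]
  -- A cell weight is `1 - α` times the mean of the kernel over the cell, and `Γ(2 - α) = (1 - α)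
  -- Γ(1 - α)` removes the factor. So the L1 value is the kernel integrated against the difference
  -- quotients.
  have hL : (l1Matrix α t n *ᵥ fun k => f (t ((k : ℕ) + 1))) i = (Real.Gamma (1 - α))⁻¹ *
      ∑ k ∈ Finset.range ((i : ℕ) + 1), ∫ s in t k..t (k + 1),
        (τ - s) ^ (-α) * ((f (t (k + 1)) - f (t k)) / (t (k + 1) - t k)) := by
    have hY : (fun j => f (t j)) 0 = 0 := by simp [h.zero, hf0]
    rw [l1Matrix_mulVec α t n (fun j => f (t j)) hY i, show (2 : ℝ) - α = 1 - α + 1 by ring,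
      Real.Gamma_add_one hα1.ne', mul_inv, mul_comm (1 - α)⁻¹, mul_assoc, Finset.mul_sum]
    congr 1
    refine Finset.sum_congr rfl fun k hk => ?_
    have hk : k ≤ (i : ℕ) := by simpa [Nat.lt_succ_iff] using hk
    obtain ⟨c1, c2, c3⟩ := hcellsub k hk
    rw [intervalIntegral.integral_mul_const, integral_sub_rpow τ (by linarith : -1 < -α),
      LogConcaveMesh.cellWeight_eq α t hk, chordSlope, show -α + 1 = 1 - α by ring,
      show t ((i : ℕ) + 1) - t k - (t ((i : ℕ) + 1) - t (k + 1)) = t (k + 1) - t k by ring]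
    have : t (k + 1) - t k ≠ 0 := by linarith
    field_simp
    exact mul_comm _ _
  rw [hL, caputoLeft, ← hadj _ hint, ← mul_sub, ← Finset.sum_sub_distrib, abs_mul,
    abs_of_pos (inv_pos.2 hΓ)]
  refine mul_le_mul_of_nonneg_left ?_ (inv_pos.2 hΓ).le
  refine (Finset.abs_sum_le_sum_abs _ _).trans
    (le_trans ?_ (integral_kernelMajorant_le h₁ ha hb he hc hτ0 hτT))
  rw [← hadj _ (intervalIntegrable_kernelMajorant h₁ ha hb 0 τ)]
  refine Finset.sum_le_sum fun k hk => ?_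
  have hk : k ≤ (i : ℕ) := by simpa [Nat.lt_succ_iff] using hk
  obtain ⟨c1, c2, c3⟩ := hcellsub k hk
  rw [← intervalIntegral.integral_sub ((hker _ _).mul_const _) (hcellint k hk _ hint)]
  rw [← Real.norm_eq_abs]
  refine intervalIntegral.norm_integral_le_of_norm_le c1.le ?_
    (intervalIntegrable_kernelMajorant h₁ ha hb _ _)
  filter_upwards [MeasureTheory.Measure.ae_ne MeasureTheory.volume (t (k + 1))] with s hne hs
  have hs' : s ∈ Ioo (t k) (t (k + 1)) := ⟨hs.1, lt_of_le_of_ne hs.2 hne⟩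
  have hk' : 0 ≤ (τ - s) ^ (-α) := Real.rpow_nonneg (by linarith [hs'.2]) _
  rw [← mul_sub, Real.norm_eq_abs, abs_mul, abs_of_nonneg hk']
  exact (mul_le_mul_of_nonneg_left (hcell k (by omega) s hs') hk').trans
    (kernel_mul_le_majorant h₀ ha₁ hb₁ hc (by linarith [hs'.1]) (by linarith [hs'.2]) hτT)

/-- The mean of `x ^ (a - 1)` over a cell is comparable with its value at any point of the cell when
the ends have bounded ratio. In the cell that touches `0` the factor `1 / a` is enough. -/
lemma rpow_increment_le {a R p q s : ℝ} (ha : 0 < a) (ha₁ : a < 1) (hR : 1 ≤ R) (hp : 0 ≤ p)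
    (hpq : p = 0 ∨ q ≤ R * p) (hs : s ∈ Ioo p q) :
    (q ^ a - p ^ a) / a ≤ R / a * s ^ (a - 1) * (q - p) := by
  have hs0 : 0 < s := hp.trans_lt hs.1
  have hq0 : 0 < q := hs0.trans hs.2
  have hsp : 0 < s ^ (a - 1) := Real.rpow_pos_of_pos hs0 _
  rw [div_le_iff₀ ha]
  have key : q ^ a - p ^ a ≤ R * s ^ (a - 1) * (q - p) := by
    rcases hpq with rfl | hpq
    · rw [Real.zero_rpow ha.ne', sub_zero, sub_zero]
      have e1 : q ^ a = q ^ (a - 1) * q := by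
        rw [← Real.rpow_add_one hq0.ne']; congr 1; ring
      rw [e1]
      have : q ^ (a - 1) ≤ s ^ (a - 1) :=
        Real.rpow_le_rpow_of_nonpos hs0 hs.2.le (by linarith)
      refine mul_le_mul_of_nonneg_right ?_ hq0.le
      nlinarith
    · have hp0 : 0 < p := by
        rcases hp.eq_or_lt with rfl | hp
        · rw [mul_zero] at hpq; linarith
        · exact hp
      have hu := chordSlope_upper (α := 1 - a) (by linarith) (by linarith) hp0 (hs.1.trans hs.2)
      rw [chordSlope, sub_sub_cancel, div_le_iff₀ (by linarith [hs.1, hs.2]), neg_sub] at hu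
      have hqp : 0 ≤ q - p := by linarith [hs.1, hs.2]
      refine hu.trans (mul_le_mul_of_nonneg_right ?_ hqp)
      have h1 : p ^ (a - 1) ≤ (s / R) ^ (a - 1) := by
        refine Real.rpow_le_rpow_of_nonpos (by positivity) ?_ (by linarith)
        rw [div_le_iff₀ (by linarith)]
        linarith [hs.2]
      have h2 : (s / R) ^ (a - 1) ≤ R * s ^ (a - 1) := by
        rw [Real.div_rpow hs0.le (by linarith), show a - 1 = -(1 - a) by ring,
          Real.rpow_neg (by linarith : 0 ≤ R), div_inv_eq_mul, mul_comm]
        refine mul_le_mul_of_nonneg_right ?_ (Real.rpow_nonneg hs0.le _)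
        calc R ^ (1 - a) ≤ R ^ (1 : ℝ) := Real.rpow_le_rpow_of_exponent_le hR (by linarith)
          _ = R := Real.rpow_one R
      have h3 : 0 < p ^ (a - 1) := Real.rpow_pos_of_pos hp0 _
      calc a * p ^ (a - 1) ≤ 1 * p ^ (a - 1) := by gcongr
        _ ≤ _ := by rw [one_mul]; exact h1.trans h2
  calc q ^ a - p ^ a ≤ R * s ^ (a - 1) * (q - p) := key
    _ = _ := by field_simp

/-- Step ratios decrease, so the first one bounds them all. -/
lemma LogConcaveMesh.step_succ_le (h : LogConcaveMesh T n t) {C : ℝ}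
    (hC : t 2 - t 1 ≤ C * (t 1 - t 0)) {k : ℕ} (hk : k + 1 ≤ n) :
    t (k + 2) - t (k + 1) ≤ C * (t (k + 1) - t k) := by
  have h1 := h.ratio_anti (Nat.zero_le k) hk
  simp only [zero_add] at h1
  have p0 : 0 < t 1 - t 0 := sub_pos.2 (h.lt (by omega) (by omega))
  have pk : 0 < t (k + 1) - t k := sub_pos.2 (h.lt (by omega) (by omega))
  have h2 := mul_le_mul_of_nonneg_right hC pk.le
  refine le_of_mul_le_mul_right ?_ p0
  linarith

/-- The mirror image of the previous bound. -/
lemma LogConcaveMesh.step_le_succ (h : LogConcaveMesh T n t) {C : ℝ}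
    (hC : t 2 - t 1 ≤ C * (t 1 - t 0)) {k : ℕ} (hk : k + 1 ≤ n) :
    t (k + 1) - t k ≤ C * (t (k + 2) - t (k + 1)) := by
  have h1 := h.step_succ_le hC (k := n - 1 - k) (by omega)
  have e0 := h.symm k (by omega)
  have e1 := h.symm (k + 1) (by omega)
  have e2 := h.symm (k + 2) (by omega)
  rw [show n + 1 - k = n - 1 - k + 2 by omega] at e0
  rw [show n + 1 - (k + 1) = n - 1 - k + 1 by omega] at e1
  rw [show n + 1 - (k + 2) = n - 1 - k by omega] at e2
  rw [e0, e1, e2] at h1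
  linarith

lemma LogConcaveMesh.node_succ_le (h : LogConcaveMesh T n t) {C : ℝ} (hC0 : 0 ≤ C)
    (hC : t 2 - t 1 ≤ C * (t 1 - t 0)) {k : ℕ} (hk : k ≤ n) :
    t k = 0 ∨ t (k + 1) ≤ (1 + C) * t k := by
  rcases k with _ | k
  · exact Or.inl h.zero
  · right
    have h1 := h.step_succ_le hC (k := k) (by omega)
    have h2 := mul_nonneg hC0 (h.nonneg (show k ≤ n + 1 by omega))
    change t (k + 2) ≤ _
    linarith

/-- The difference quotients inherit the bound of the derivative. -/
lemma LogConcaveMesh.abs_differenceQuotient_le (h : LogConcaveMesh T n t) {C : ℝ} (hC0 : 0 ≤ C)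
    (hC : t 2 - t 1 ≤ C * (t 1 - t 0)) {f : ℝ → ℝ} {a b c : ℝ} (ha : 0 < a) (ha₁ : a < 1)
    (hb : 0 < b) (hb₁ : b < 1) (hc : 0 ≤ c) (hf : ContinuousOn f (Icc 0 T))
    (hd : ∀ s ∈ Ioo 0 T, DifferentiableAt ℝ f s)
    (hbound : ∀ s ∈ Ioo 0 T, |deriv f s| ≤ c * (s ^ (a - 1) + (T - s) ^ (b - 1)))
    {k : ℕ} (hk : k ≤ n) {s : ℝ} (hs : s ∈ Ioo (t k) (t (k + 1))) :
    |(f (t (k + 1)) - f (t k)) / (t (k + 1) - t k)| ≤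
      c * ((1 + C) / a + (1 + C) / b) * (s ^ (a - 1) + (T - s) ^ (b - 1)) := by
  have hlt := h.lt_succ k hk
  have hp := h.nonneg (show k ≤ n + 1 by omega)
  have hq := h.le_last (show k + 1 ≤ n + 1 by omega)
  set p := t k
  set q := t (k + 1)
  have hG : ∀ x ∈ Ioo 0 T, HasDerivAt (fun x => c * (x ^ a / a - (T - x) ^ b / b))
      (c * (x ^ (a - 1) + (T - x) ^ (b - 1))) x := by
    intro x hx
    have d1 := (Real.hasDerivAt_rpow_const (p := a) (Or.inl hx.1.ne')).div_const a
    have d2 := (((hasDerivAt_id x).const_sub T).rpow_const (p := b)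
      (Or.inl (by simp only [id]; linarith [hx.2]))).div_const b
    refine ((d1.sub d2).const_mul c).congr_deriv ?_
    simp only [id]
    field_simp
    ring
  have hGc : ContinuousOn (fun x => c * (x ^ a / a - (T - x) ^ b / b)) (Icc 0 T) := by
    refine Continuous.continuousOn ?_
    have c1 : Continuous fun x : ℝ => x ^ a := Real.continuous_rpow_const ha.le
    have c2 : Continuous fun x : ℝ => x ^ b := Real.continuous_rpow_const hb.le
    exact continuous_const.mul ((c1.div_const a).sub
      ((c2.comp (continuous_const.sub continuous_id)).div_const b))
  -- The singular bound has the explicit primitive `G` of `hG`. Monotonicity of `G + f` and `G - f`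
  -- up to the closed end points replaces integration of the derivative of `f`.
  have hmono : ∀ σ : ℝ, |σ| = 1 →
      MonotoneOn (fun x => c * (x ^ a / a - (T - x) ^ b / b) + σ * f x) (Icc 0 T) := by
    intro σ hσ
    have hder : ∀ x ∈ Ioo 0 T, HasDerivAt (fun x => c * (x ^ a / a - (T - x) ^ b / b) + σ * f x)
        (c * (x ^ (a - 1) + (T - x) ^ (b - 1)) + σ * deriv f x) x := fun x hx =>
      (hG x hx).add ((hd x hx).hasDerivAt.const_mul σ)
    refine monotoneOn_of_deriv_nonneg (convex_Icc 0 T) (hGc.add (continuousOn_const.mul hf)) ?_ ?_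
    · rw [interior_Icc]
      exact fun x hx => (hder x hx).differentiableAt.differentiableWithinAt
    · rw [interior_Icc]
      intro x hx
      rw [(hder x hx).deriv]
      have : |σ * deriv f x| ≤ c * (x ^ (a - 1) + (T - x) ^ (b - 1)) := by
        rw [abs_mul, hσ, one_mul]; exact hbound x hx
      linarith [(abs_le.1 this).1]
  have hpm : p ∈ Icc 0 T := ⟨hp, by linarith⟩
  have hqm : q ∈ Icc 0 T := ⟨by linarith, hq⟩
  have m1 := hmono 1 (by simp) hpm hqm hlt.le
  have m2 := hmono (-1) (by simp) hpm hqm hlt.le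
  simp only at m1 m2
  have i1 := rpow_increment_le ha ha₁ (by linarith : 1 ≤ 1 + C) hp (h.node_succ_le hC0 hC hk) hs
  have i2 := rpow_increment_le (p := T - q) (q := T - p) (s := T - s) hb hb₁
    (by linarith : 1 ≤ 1 + C) (by linarith)
    -- The singularity at `T` is treated by reflecting the cell.
    (by
      have := h.node_succ_le hC0 hC (k := n - k) (by omega)
      have e0 := h.symm k (by omega)
      have e1 := h.symm (k + 1) (by omega)
      rw [show n + 1 - k = n - k + 1 by omega] at e0
      rw [show n + 1 - (k + 1) = n - k by omega] at e1
      rwa [e0, e1] at this)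
    ⟨by linarith [hs.2], by linarith [hs.1]⟩
  rw [sub_sub_sub_cancel_left] at i2
  have hqp : 0 < q - p := by linarith
  rw [abs_div, abs_of_pos hqp, div_le_iff₀ hqp]
  have hsp : 0 < s ^ (a - 1) := Real.rpow_pos_of_pos (by linarith [hs.1]) _
  have hsq : 0 < (T - s) ^ (b - 1) := Real.rpow_pos_of_pos (by linarith [hs.2]) _
  have hfle : |f q - f p| ≤ c * ((q ^ a - p ^ a) / a + ((T - p) ^ b - (T - q) ^ b) / b) := by
    have e : c * ((q ^ a - p ^ a) / a + ((T - p) ^ b - (T - q) ^ b) / b) =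
        c * (q ^ a / a - (T - q) ^ b / b) - c * (p ^ a / a - (T - p) ^ b / b) := by ring
    rw [e, abs_le]
    constructor <;> linarith
  refine hfle.trans ?_
  rw [mul_assoc, mul_assoc]
  refine mul_le_mul_of_nonneg_left ((add_le_add i1 i2).trans ?_) hc
  have hA : 0 ≤ (1 + C) / a := by positivity
  have hB : 0 ≤ (1 + C) / b := by positivity
  nlinarith [mul_nonneg (mul_nonneg hA hsq.le) hqp.le, mul_nonneg (mul_nonneg hB hsp.le) hqp.le]

end Truncation

section ForwardConsistency

variable {α T a b : ℝ} {u : ℝ → ℝ → ℝ}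

/-- The exponent at `T` is lowered to one strictly between `α` and `1`, as the majorant requires;
this costs only a power of `T` in the constant. -/
lemma ForwardTimeRegular.exists_deriv_bound (hu : ForwardTimeRegular α T a b u) (h₁ : α < 1)
    (hT : 0 < T) : ∃ c b' : ℝ, 0 ≤ c ∧ α < b' ∧ b' < 1 ∧ ∀ x ∈ Icc a b, ∀ t ∈ Ioo 0 T,
      |deriv (u x) t| ≤ c * (t ^ (α - 1) + (T - t) ^ (b' - 1)) := by
  obtain ⟨C, β, hβ, hC⟩ := hu.deriv_bound
  set b' := min β ((1 + α) / 2)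
  have hb1 : b' ≤ β := min_le_left _ _
  refine ⟨|C| * (1 + T ^ (β - b')), b', by positivity, lt_min hβ (by linarith),
    (min_le_right _ _).trans_lt (by linarith), fun x hx t ht => (hC x hx t ht).trans ?_⟩
  have hTt : 0 < T - t := by linarith [ht.2]
  have p1 : 0 < t ^ (α - 1) := Real.rpow_pos_of_pos ht.1 _
  have p2 : 0 < (T - t) ^ (b' - 1) := Real.rpow_pos_of_pos hTt _
  have p3 : 0 < T ^ (β - b') := Real.rpow_pos_of_pos hT _
  have p4 : (T - t) ^ (β - 1) ≤ T ^ (β - b') * (T - t) ^ (b' - 1) := by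
    have e : (T - t) ^ (β - 1) = (T - t) ^ (β - b') * (T - t) ^ (b' - 1) := by
      rw [← Real.rpow_add hTt]; congr 1; ring
    rw [e]
    gcongr
    linarith [ht.1]
  have p5 : 0 ≤ (T - t) ^ (β - 1) := Real.rpow_nonneg hTt.le _
  calc C * (t ^ (α - 1) + (T - t) ^ (β - 1)) ≤ |C| * (t ^ (α - 1) + (T - t) ^ (β - 1)) :=
        mul_le_mul_of_nonneg_right (le_abs_self C) (by positivity)
    _ ≤ |C| * ((1 + T ^ (β - b')) * (t ^ (α - 1) + (T - t) ^ (b' - 1))) := by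
        refine mul_le_mul_of_nonneg_left ?_ (abs_nonneg C)
        nlinarith [mul_pos p3 p1]
    _ = _ := by ring

/-- In a boundary layer the singular bound is small compared with a slightly more singular one. -/
lemma layer_bound {p q γ η s : ℝ} (hp₁ : p < 1) (hq₁ : q < 1) (hγ : 0 < γ) (hs : 0 < s)
    (hsη : s ≤ η) (hη : η ≤ T / 2) :
    s ^ (p - 1) + (T - s) ^ (q - 1) ≤ (1 + (T / 2) ^ (q - p)) * (η ^ γ * s ^ (p - γ - 1)) := by
  have hT2 : 0 < T / 2 := by linarith
  have i1 : (T - s) ^ (q - 1) ≤ (T / 2) ^ (q - p) * s ^ (p - 1) := by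
    calc (T - s) ^ (q - 1) ≤ (T / 2) ^ (q - 1) :=
          Real.rpow_le_rpow_of_nonpos hT2 (by linarith) (by linarith)
      _ = (T / 2) ^ (q - p) * (T / 2) ^ (p - 1) := by
          rw [← Real.rpow_add hT2]; congr 1; ring
      _ ≤ _ := by
          refine mul_le_mul_of_nonneg_left ?_ (Real.rpow_nonneg hT2.le _)
          exact Real.rpow_le_rpow_of_nonpos hs (by linarith) (by linarith)
  have i2 : s ^ (p - 1) ≤ η ^ γ * s ^ (p - γ - 1) := by
    have e : s ^ (p - 1) = s ^ γ * s ^ (p - γ - 1) := by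
      rw [← Real.rpow_add hs]; congr 1; ring
    rw [e]
    exact mul_le_mul_of_nonneg_right (Real.rpow_le_rpow hs.le hsη hγ.le) (Real.rpow_nonneg hs.le _)
  have p3 : 0 < (T / 2) ^ (q - p) := Real.rpow_pos_of_pos hT2 _
  calc s ^ (p - 1) + (T - s) ^ (q - 1) ≤ (1 + (T / 2) ^ (q - p)) * s ^ (p - 1) := by linarith
    _ ≤ _ := by gcongr

/-- The error of the difference quotients is dominated by the bound of the derivative. -/
lemma ForwardTimeRegular.exists_cell_error_bound (hu : ForwardTimeRegular α T a b u)
    (mesh : TimeMesh) (h₀ : 0 < α) (h₁ : α < 1) (hT : 0 < T) :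
    ∃ c b' : ℝ, 0 ≤ c ∧ α < b' ∧ b' < 1 ∧
      (∀ x ∈ Icc a b, ∀ s ∈ Ioo 0 T, |deriv (u x) s| ≤ c * (s ^ (α - 1) + (T - s) ^ (b' - 1))) ∧
      ∀ n, mesh.Admissible n → ∀ x ∈ Icc a b, ∀ k ≤ n,
        ∀ s ∈ Ioo (mesh.node α T n k) (mesh.node α T n (k + 1)),
        |(u x (mesh.node α T n (k + 1)) - u x (mesh.node α T n k)) /
          (mesh.node α T n (k + 1) - mesh.node α T n k) - deriv (u x) s| ≤
          c * (s ^ (α - 1) + (T - s) ^ (b' - 1)) := by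
  obtain ⟨c, b', hc, hb, hb1, hbound⟩ := hu.exists_deriv_bound h₁ hT
  obtain ⟨C, hC1, hC⟩ := mesh.exists_step_bound h₀ h₁ hT
  have hb0 : 0 < b' := h₀.trans hb
  have hR : 0 ≤ (1 + C) / α + (1 + C) / b' := by positivity
  refine ⟨c * ((1 + C) / α + (1 + C) / b') + c, b', by positivity, hb, hb1, ?_, ?_⟩
  · intro x hx s hs
    refine (hbound x hx s hs).trans ?_
    have : 0 ≤ s ^ (α - 1) + (T - s) ^ (b' - 1) :=
      add_nonneg (Real.rpow_nonneg hs.1.le _) (Real.rpow_nonneg (by linarith [hs.2]) _)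
    rw [add_mul]
    have := mul_nonneg (mul_nonneg hc hR) this
    linarith
  · intro n hn x hx k hk s hs
    have h := mesh.logConcaveMesh h₀ h₁ hT hn
    have hs' : s ∈ Ioo 0 T := ⟨(h.nonneg (by omega)).trans_lt hs.1,
      hs.2.trans_le (h.le_last (by omega))⟩
    have hcont : ContinuousOn (u x) (Icc 0 T) :=
      hu.continuousOn.comp (f := fun t => (x, t)) (by fun_prop) fun t ht => ⟨hx, ht⟩
    have h2 := h.abs_differenceQuotient_le (by linarith) (hC n hn).2 h₀ h₁ hb0 hb1 hc hcont
      (fun s hs => hu.differentiableAt x hx s hs) (hbound x hx) hk hs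
    refine (abs_sub _ _).trans ?_
    rw [add_mul]
    exact add_le_add h2 (hbound x hx s hs')

/-- The uniform bound takes `e = 0` and the exponents of the derivative bound. For smallness the two
layers of width `η` gain a factor `η ^ γ` in exchange for exponents lowered by `γ`, and between them
the mean value theorem and uniform continuity bound the cell error by `e`. -/
lemma ForwardTimeRegular.consistent (hu : ForwardTimeRegular α T a b u)
    (h0 : ∀ x ∈ Icc a b, u x 0 = 0) (mesh : TimeMesh) (h₀ : 0 < α) (h₁ : α < 1) (hT : 0 < T) :
    (∃ M : ℝ, ∀ n, mesh.Admissible n → ∀ x ∈ Icc a b, ∀ i : Fin (n + 1),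
      |(l1Matrix α (mesh.node α T n) n *ᵥ fun k => u x (mesh.node α T n ((k : ℕ) + 1))) i
        - caputoLeft α (u x) (mesh.node α T n ((i : ℕ) + 1))| ≤ M) ∧
    ∀ δ > 0, ∀ ε > 0, ∃ n₀ : ℕ, ∀ n ≥ n₀, mesh.Admissible n → ∀ x ∈ Icc a b,
      ∀ i : Fin (n + 1), δ ≤ mesh.node α T n ((i : ℕ) + 1) →
        |(l1Matrix α (mesh.node α T n) n *ᵥ fun k => u x (mesh.node α T n ((k : ℕ) + 1))) i
          - caputoLeft α (u x) (mesh.node α T n ((i : ℕ) + 1))| ≤ ε := by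
  obtain ⟨c, b', hc, hb, hb1, hbound, hcell⟩ := hu.exists_cell_error_bound mesh h₀ h₁ hT
  have hΓ : 0 < (Real.Gamma (1 - α))⁻¹ := inv_pos.2 (Real.Gamma_pos_of_pos (by linarith))
  have hα1 : 0 < 1 - α := by linarith
  have hfc : ∀ x ∈ Icc a b, ContinuousOn (deriv (u x)) (Ioo 0 T) := fun x hx =>
    hu.continuousOn_deriv.comp (f := fun t => (x, t)) (by fun_prop) fun t ht => ⟨hx, ht⟩
  refine ⟨⟨(Real.Gamma (1 - α))⁻¹ * (0 * (T ^ (1 - α) / (1 - α)) +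
    c * ((2 / α + 2 / (1 - α)) * 1 + T ^ (b' - α) / (b' - α))), fun n hn x hx i => ?_⟩, ?_⟩
  · have h := mesh.logConcaveMesh h₀ h₁ hT hn
    have := h.abs_truncation_le h₀ h₁ (h0 x hx) (hfc x hx) hb hb1 hc (hbound x hx)
      (e := 0) h₀ h₁ hb hb1 le_rfl hc i
      (fun k hk s hs => by rw [zero_add]; exact hcell n hn x hx k hk s hs)
    simpa only [sub_self, Real.rpow_zero] using this
  · intro δ hδ ε hε
    -- After lowering by `γ` the exponents still satisfy `0 < α - γ` and `α < b' - γ`, so the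
    -- majorant remains integrable.
    obtain ⟨γ, hγ0, hγa, hγb⟩ : ∃ γ > 0, γ < α ∧ γ < b' - α :=
      ⟨min (α / 2) ((b' - α) / 2), lt_min (by linarith) (by linarith),
        (min_le_left _ _).trans_lt (by linarith), (min_le_right _ _).trans_lt (by linarith)⟩
    set K := (1 + (T / 2) ^ (b' - α)) + (1 + (T / 2) ^ (α - b'))
    have hK : 0 ≤ K := by positivity
    set B := (2 / (α - γ) + 2 / (1 - α)) * δ ^ (α - γ - α) + T ^ (b' - γ - α) / (b' - γ - α)
    have hαγ : 0 < α - γ := by linarith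
    have hbγ : 0 < b' - γ - α := by linarith
    have hB : 0 ≤ B := by positivity
    obtain ⟨e, he, hesmall⟩ : ∃ e > 0, (Real.Gamma (1 - α))⁻¹ * (e * (T ^ (1 - α) / (1 - α))) ≤
        ε / 2 := by
      have hD : 0 ≤ (Real.Gamma (1 - α))⁻¹ * (T ^ (1 - α) / (1 - α)) := by positivity
      refine ⟨ε / 2 / ((Real.Gamma (1 - α))⁻¹ * (T ^ (1 - α) / (1 - α)) + 1), by positivity, ?_⟩
      rw [mul_left_comm, div_mul_eq_mul_div, div_le_iff₀ (by linarith)]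
      nlinarith
    obtain ⟨η, hη, hηT, hηsmall⟩ : ∃ η > 0, η ≤ T / 2 ∧
        (Real.Gamma (1 - α))⁻¹ * (c * K * η ^ γ * B) ≤ ε / 2 := by
      have hD : 0 ≤ (Real.Gamma (1 - α))⁻¹ * (c * K * B) := by positivity
      set D := (Real.Gamma (1 - α))⁻¹ * (c * K * B)
      refine ⟨min (T / 2) ((ε / 2 / (D + 1)) ^ γ⁻¹), by positivity, min_le_left _ _, ?_⟩
      have : (min (T / 2) ((ε / 2 / (D + 1)) ^ γ⁻¹)) ^ γ ≤ ε / 2 / (D + 1) := by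
        calc _ ≤ ((ε / 2 / (D + 1)) ^ γ⁻¹) ^ γ :=
              Real.rpow_le_rpow (by positivity) (min_le_right _ _) hγ0.le
          _ = _ := Real.rpow_inv_rpow (by positivity) hγ0.ne'
      calc _ = D * (min (T / 2) ((ε / 2 / (D + 1)) ^ γ⁻¹)) ^ γ := by ring
        _ ≤ D * (ε / 2 / (D + 1)) := by gcongr
        _ ≤ ε / 2 := by
          rw [mul_div_assoc', div_le_iff₀ (by linarith)]; nlinarith
    -- The margin `η / 2` leaves room for the intermediate point of a cell, whose length is below `η
    -- / 2`, around a point between the layers.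
    have huc : UniformContinuousOn (fun z : ℝ × ℝ => deriv (u z.1) z.2)
        (Icc a b ×ˢ Icc (η / 2) (T - η / 2)) :=
      (isCompact_Icc.prod isCompact_Icc).uniformContinuousOn_of_continuous
        (hu.continuousOn_deriv.mono (prod_mono le_rfl
          fun s hs => ⟨by linarith [hs.1], by linarith [hs.2]⟩))
    obtain ⟨ρ, hρ, hρu⟩ := Metric.uniformContinuousOn_iff.1 huc e he
    obtain ⟨C, hC1, hC⟩ := mesh.exists_step_bound h₀ h₁ hT
    obtain ⟨n₀, hn₀⟩ := exists_nat_gt (C / min ρ (η / 2))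
    have hmin : 0 < min ρ (η / 2) := by positivity
    refine ⟨n₀, fun n hnn hn x hx i hi => ?_⟩
    have h := mesh.logConcaveMesh h₀ h₁ hT hn
    have hstep : ∀ k ≤ n, mesh.node α T n (k + 1) - mesh.node α T n k < min ρ (η / 2) := by
      intro k hk
      refine ((hC n hn).1 k hk).trans_lt ?_
      rw [div_lt_iff₀ (by positivity)]
      rw [div_lt_iff₀ hmin] at hn₀
      have : (n₀ : ℝ) ≤ n := by exact_mod_cast hnn
      nlinarith
    have hcont : ContinuousOn (u x) (Icc 0 T) :=
      hu.continuousOn.comp (f := fun t => (x, t)) (by fun_prop) fun t ht => ⟨hx, ht⟩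
    have hb'0 : 0 < b' := h₀.trans hb
    have key := h.abs_truncation_le h₀ h₁ (h0 x hx) (hfc x hx) hb hb1 hc (hbound x hx)
      (e := e) (c := c * K * η ^ γ) (a := α - γ) (b := b' - γ) hαγ (by linarith) (by linarith)
      (by linarith) he.le (by positivity) i ?_
    · refine key.trans ?_
      have hle : mesh.node α T n ((i : ℕ) + 1) ^ (α - γ - α) ≤ δ ^ (α - γ - α) :=
        Real.rpow_le_rpow_of_nonpos hδ hi (by linarith)
      have : c * K * η ^ γ * ((2 / (α - γ) + 2 / (1 - α)) *
          mesh.node α T n ((i : ℕ) + 1) ^ (α - γ - α) + T ^ (b' - γ - α) / (b' - γ - α)) ≤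
          c * K * η ^ γ * B :=
        mul_le_mul_of_nonneg_left (add_le_add
          (mul_le_mul_of_nonneg_left hle (by positivity)) le_rfl) (by positivity)
      have h3 := mul_le_mul_of_nonneg_left this hΓ.le
      rw [mul_add]
      linarith
    · intro k hk s hs
      have hp := h.nonneg (show k ≤ n + 1 by omega)
      have hq := h.le_last (show k + 1 ≤ n + 1 by omega)
      have hst := hstep k hk
      have hgen := hcell n hn x hx k hk s hs
      have hs0 : 0 < s := by linarith [hs.1]
      have hsT : s < T := by linarith [hs.2]
      have hA : 0 ≤ η ^ γ * s ^ (α - γ - 1) := by positivity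
      have hB' : 0 ≤ η ^ γ * (T - s) ^ (b' - γ - 1) :=
        mul_nonneg (Real.rpow_nonneg hη.le _) (Real.rpow_nonneg (by linarith) _)
      have hK1 : 0 ≤ 1 + (T / 2) ^ (b' - α) := by positivity
      have hK2 : 0 ≤ 1 + (T / 2) ^ (α - b') := by positivity
      rcases le_or_gt s η with hsη | hsη
      · have hl := layer_bound (p := α) (q := b') h₁ hb1 hγ0 hs0 hsη hηT
        refine hgen.trans ?_
        have : s ^ (α - 1) + (T - s) ^ (b' - 1) ≤
            K * η ^ γ * (s ^ (α - γ - 1) + (T - s) ^ (b' - γ - 1)) := by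
          have := mul_nonneg hK2 hA
          have := mul_nonneg hK hB'
          simp only [K] at *
          linarith
        have := mul_le_mul_of_nonneg_left this hc
        linarith
      rcases le_or_gt (T - s) η with hsη' | hsη'
      · have hl := layer_bound (p := b') (q := α) (T := T) hb1 h₁ hγ0
          (by linarith : 0 < T - s) hsη' hηT
        rw [sub_sub_cancel] at hl
        refine hgen.trans ?_
        have : s ^ (α - 1) + (T - s) ^ (b' - 1) ≤
            K * η ^ γ * (s ^ (α - γ - 1) + (T - s) ^ (b' - γ - 1)) := by
          have := mul_nonneg hK1 hB'
          have := mul_nonneg hK hA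
          simp only [K] at *
          linarith
        have := mul_le_mul_of_nonneg_left this hc
        linarith
      · have hst1 := hst.trans_le (min_le_left _ _)
        have hst2 := hst.trans_le (min_le_right _ _)
        obtain ⟨ξ, hξ, hξd⟩ := exists_deriv_eq_slope (u x) (hs.1.trans hs.2)
          (hcont.mono (Icc_subset_Icc hp hq))
          (fun y hy => (hu.differentiableAt x hx y
            ⟨by linarith [hy.1], by linarith [hy.2]⟩).differentiableWithinAt)
        rw [← hξd]
        have hd := hρu (x, ξ) ⟨hx, by constructor <;> linarith [hs.1, hs.2, hξ.1, hξ.2]⟩ (x, s)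
          ⟨hx, by constructor <;> linarith⟩ (by
            rw [Prod.dist_eq, dist_self, max_eq_right dist_nonneg, Real.dist_eq, abs_lt]
            constructor <;> linarith [hs.1, hs.2, hξ.1, hξ.2])
        rw [Real.dist_eq] at hd
        have : 0 ≤ c * K * η ^ γ * (s ^ (α - γ - 1) + (T - s) ^ (b' - γ - 1)) :=
          mul_nonneg (by positivity) (add_nonneg (Real.rpow_nonneg hs0.le _)
            (Real.rpow_nonneg (by linarith) _))
        linarith

end ForwardConsistency

/-- Time reversal exchanges the two Caputo derivatives. -/
lemma caputoRight_eq_caputoLeft (α T : ℝ) (f : ℝ → ℝ) (τ : ℝ) :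
    caputoRight α T f (T - τ) = caputoLeft α (fun s => f (T - s)) τ := by
  have h := intervalIntegral.integral_comp_sub_left (a := 0) (b := τ)
    (fun r => (r - (T - τ)) ^ (-α) * deriv f r) T
  rw [sub_zero] at h
  rw [caputoRight, caputoLeft, ← h, ← mul_neg, ← intervalIntegral.integral_neg]
  congr 1
  refine intervalIntegral.integral_congr fun s _ => ?_
  rw [deriv_comp_const_sub, mul_neg, show T - s - (T - τ) = τ - s by ring]

section Reversal

variable {α T : ℝ} {n : ℕ} {t : ℕ → ℝ}

/-- Symmetry of the mesh turns the reversed nodes into nodes, so the adjoint error is the forward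
error of the time-reversed function. -/
lemma LogConcaveMesh.l1Truncation_inr (h : LogConcaveMesh T n t) (y p : ℝ → ℝ) (i : Fin (n + 1)) :
    l1Truncation α T t n y p (Sum.inr i) =
      (l1Matrix α t n *ᵥ fun k => p (T - t ((k : ℕ) + 1))) i
        - caputoLeft α (fun s => p (T - s)) (t ((i : ℕ) + 1)) := by
  have e : ∀ k : Fin (n + 1), t (n - (k : ℕ)) = T - t ((k : ℕ) + 1) := by
    intro k
    rw [← h.symm _ (by omega)]; congr 1; omega
  simp only [l1Truncation, Sum.elim_inr, e, caputoRight_eq_caputoLeft]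

end Reversal

lemma SolvesStateAdjoint.l1Consistent {α T σ κ a b : ℝ} {y p : ℝ → ℝ → ℝ}
    (hs : SolvesStateAdjoint α T σ κ a b y p) (mesh : TimeMesh) (h₀ : 0 < α) (h₁ : α < 1)
    (hT : 0 < T) : L1Consistent α T a b mesh y p := by
  obtain ⟨⟨M₁, hM₁⟩, hy⟩ := hs.state_regular.consistent hs.state_initial mesh h₀ h₁ hT
  obtain ⟨⟨M₂, hM₂⟩, hp⟩ := ForwardTimeRegular.consistent (u := fun x t => p x (T - t))
    hs.adjoint_regular
    (fun x hx => by rw [sub_zero]; exact hs.adjoint_final x hx) mesh h₀ h₁ hT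
  refine ⟨⟨max M₁ M₂, fun n hn x hx j => ?_⟩, fun δ hδ ε hε => ?_⟩
  · rcases j with i | i
    · exact (hM₁ n hn x hx i).trans (le_max_left _ _)
    · rw [(mesh.logConcaveMesh h₀ h₁ hT hn).l1Truncation_inr]
      exact (hM₂ n hn x hx i).trans (le_max_right _ _)
  · obtain ⟨n₁, hn₁⟩ := hy δ hδ ε hε
    obtain ⟨n₂, hn₂⟩ := hp δ hδ ε hε
    refine ⟨max n₁ n₂, fun n hnn hn x hx i hi => ⟨?_, ?_⟩⟩
    · exact hn₁ n (le_of_max_le_left hnn) hn x hx i hi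
    · rw [(mesh.logConcaveMesh h₀ h₁ hT hn).l1Truncation_inr]
      exact hn₂ n (le_of_max_le_right hnn) hn x hx i hi

/-! ### Cutoffs in time and their commutator with the L1 matrix. -/

namespace LogConcaveMesh

variable {T α : ℝ} {n : ℕ} {t : ℕ → ℝ}

/-- The moments of the L1 weights near the diagonal. -/
lemma sum_cellWeight_diff_mul_le (h : LogConcaveMesh T n t) (h₀ : 0 < α) (h₁ : α < 1) {η : ℝ}
    (hη : 0 < η) {j : ℕ} (hj : j ≤ n) :
    ∑ k ∈ Finset.range j, (cellWeight α t j (k + 1) - cellWeight α t j k) *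
      min (t (j + 1) - t (k + 1)) η ≤ η ^ (1 - α) := by
  have hα1 : 0 < 1 - α := by linarith
  set f : ℕ → ℝ := fun k => min (t (j + 1) - t k) η with hf
  have hfn : ∀ k ≤ j + 1, 0 ≤ f k := fun k hk =>
    le_min (by linarith [h.le hk (by omega)]) hη.le
  -- Truncating at `η` moves the chord of the cell towards `0`, where the power is steeper.
  have hstep : ∀ k ≤ j, cellWeight α t j k * (f k - f (k + 1)) ≤
      f k ^ (1 - α) - f (k + 1) ^ (1 - α) := by
    intro k hk
    have hlt := h.lt_succ k (by omega)
    have hle := h.le (show k + 1 ≤ j + 1 by omega) (by omega)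
    have hmono : f (k + 1) ≤ f k := min_le_min (by linarith) le_rfl
    rcases hmono.eq_or_lt with he | hlt'
    · rw [he]; simp
    · have h1 : f (k + 1) < η := hlt'.trans_le (min_le_right _ _)
      have h2 : f (k + 1) = t (j + 1) - t (k + 1) := by
        rcases min_choice (t (j + 1) - t (k + 1)) η with h3 | h3
        · exact h3
        · exact absurd h3 h1.ne
      rw [cellWeight_eq α t hk]
      have ha := chordSlope_anti h₀ h₁ (u := f (k + 1)) (v := f k) (u' := t (j + 1) - t (k + 1))
        (v' := t (j + 1) - t k) (hfn _ (by omega)) hlt' (by linarith) h2.le (min_le_left _ _)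
      have := mul_le_mul_of_nonneg_right ha (show 0 ≤ f k - f (k + 1) by linarith)
      refine this.trans (le_of_eq ?_)
      exact div_mul_cancel₀ _ (by linarith)
  -- Summation by parts, followed by telescoping of the powers from `hstep`.
  have key : ∀ m ≤ j, ∑ k ∈ Finset.range m, (cellWeight α t j (k + 1) - cellWeight α t j k) *
      f (k + 1) ≤ f 0 ^ (1 - α) - f m ^ (1 - α) + cellWeight α t j m * f m := by
    intro m hm
    induction m with
    | zero =>
      have := mul_nonneg (h.cellWeight_nonneg h₀ h₁ hj 0) (hfn 0 (by omega))
      simpa using this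
    | succ m ih =>
      rw [Finset.sum_range_succ]
      have := ih (by omega)
      have := hstep m (by omega)
      linarith
  have hlast : f (j + 1) = 0 := by simp [hf, hη.le]
  have h2 := hstep j le_rfl
  rw [hlast, Real.zero_rpow hα1.ne', sub_zero, sub_zero] at h2
  have h3 : f 0 ^ (1 - α) ≤ η ^ (1 - α) :=
    Real.rpow_le_rpow (hfn 0 (by omega)) (min_le_right _ _) hα1.le
  have := key j le_rfl
  linarith

lemma rpow_neg_sub_le {x y : ℝ} (h₀ : 0 < α) (h₁ : α < 1) (hx : 0 < x) (hxy : x ≤ y) :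
    x ^ (-α) - y ^ (-α) ≤ x ^ (-α - 1) * (y - x) := by
  have hy : 0 < y := hx.trans_le hxy
  have e : y ^ (-α) = x ^ (-α) * (x / y) ^ α := by
    rw [Real.div_rpow hx.le hy.le, Real.rpow_neg hx.le, Real.rpow_neg hy.le]
    have := Real.rpow_pos_of_pos hx α
    field_simp
  have h1 : x / y ≤ (x / y) ^ α := by
    have := Real.rpow_le_rpow_of_exponent_ge (by positivity : 0 < x / y)
      ((div_le_one hy).2 hxy) h₁.le
    rwa [Real.rpow_one] at this
  have hp : 0 < x ^ (-α) := Real.rpow_pos_of_pos hx _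
  have e2 : x ^ (-α - 1) = x ^ (-α) / x := Real.rpow_sub_one hx.ne' _
  have h2 : 1 - x / y ≤ (y - x) / x := by
    rw [le_div_iff₀ hx]
    have : (1 - x / y) * x = (y - x) * (x / y) := by field_simp
    rw [this]
    exact mul_le_of_le_one_right (by linarith) ((div_le_one hy).2 hxy)
  rw [e, e2]
  calc x ^ (-α) - x ^ (-α) * (x / y) ^ α ≤ x ^ (-α) * (1 - x / y) := by nlinarith
    _ ≤ x ^ (-α) * ((y - x) / x) := by gcongr
    _ = _ := by ring

/-- Away from the diagonal the entries of the L1 matrix are of the size of the steps. -/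
lemma cellWeight_diff_le (h : LogConcaveMesh T n t) (h₀ : 0 < α) (h₁ : α < 1) {η : ℝ}
    (hη : 0 < η) (hstep : ∀ k ≤ n, t (k + 1) - t k ≤ η / 2) {j k : ℕ} (hj : j ≤ n) (hkj : k < j)
    (hfar : η < t (j + 1) - t (k + 1)) :
    cellWeight α t j (k + 1) - cellWeight α t j k ≤
      (1 - α) * (η / 2) ^ (-α - 1) * (t (k + 2) - t k) := by
  have hs := hstep (k + 1) (by omega)
  -- One more cell is lost on the way to the upper bound of the next weight; steps of at most `η /
  -- 2` keep it at distance `η / 2`. This is why two adjacent cells appear in the bound and in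
  -- `stepSum`.
  have hx : η / 2 ≤ t (j + 1) - t (k + 2) := by
    change t (k + 2) - t (k + 1) ≤ _ at hs; linarith
  have hk1 : k + 1 < j := by
    by_contra hc
    obtain rfl : j = k + 1 := by omega
    change η / 2 ≤ t (k + 2) - t (k + 2) at hx
    linarith
  have hu := h.cellWeight_upper h₀ h₁ hj hk1
  have hl := h.cellWeight_lower h₀ h₁ hj hkj.le
  have hlt := h.lt (show k < k + 2 by omega) (by omega)
  have hx0 : 0 < t (j + 1) - t (k + 2) := by linarith
  have hd := rpow_neg_sub_le h₀ h₁ hx0 (y := t (j + 1) - t k) (by linarith)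
  have hm : (t (j + 1) - t (k + 2)) ^ (-α - 1) ≤ (η / 2) ^ (-α - 1) :=
    Real.rpow_le_rpow_of_nonpos (by linarith) hx (by linarith)
  have e : t (j + 1) - t k - (t (j + 1) - t (k + 2)) = t (k + 2) - t k := by ring
  rw [e] at hd
  have hd2 := hd.trans (mul_le_mul_of_nonneg_right hm (show 0 ≤ t (k + 2) - t k by linarith))
  have := mul_le_mul_of_nonneg_left hd2 (show 0 ≤ 1 - α by linarith)
  linarith

end LogConcaveMesh

/-- The sum of the moduli of the components but the last, weighted by the lengths of the two
adjacent cells. -/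
noncomputable def stepSum (t : ℕ → ℝ) (n : ℕ) (v : Fin (n + 1) → ℝ) : ℝ :=
  ∑ k : Fin (n + 1), if (k : ℕ) < n then (t (k + 2) - t k) * |v k| else 0

/-- The rate of decay of the L1 scheme on a time interval of length `δ`. -/
noncomputable def localRate (α δ : ℝ) : ℝ :=
  (Real.Gamma (2 - α))⁻¹ * ((1 - α) * (2 * δ) ^ (-α))

/-- The bound of the commutator of the L1 matrix with a cutoff in time of width `δ`. -/
noncomputable def commutatorBound (α δ η M s : ℝ) : ℝ :=
  M / δ * ((Real.Gamma (2 - α))⁻¹ * η ^ (1 - α)) +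
    (Real.Gamma (2 - α))⁻¹ * ((1 - α) * (η / 2) ^ (-α - 1)) * s

namespace LogConcaveMesh

variable {T α : ℝ} {n : ℕ} {t : ℕ → ℝ}

/-- The window `S` has length `δ` and ends at node `m + 1`; `χ` rises linearly across it to `1`.
Restriction to the window raises the row sums to the order of `δ ^ (-α)`. The price is the
commutator. Within distance `η` of the diagonal, the Lipschitz constant `1 / δ` of `χ` meets the
moment bound and the supremum `M`. Farther away, `χ` differs by at most `1` and the entries are of
the size of the steps, so only the step sum of `v` enters. -/
lemma exists_cutoff (h : LogConcaveMesh T n t) (h₀ : 0 < α) (h₁ : α < 1) {δ η : ℝ} (hδ : 0 < δ)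
    (hη : 0 < η) (hstepδ : ∀ k ≤ n, t (k + 1) - t k ≤ δ)
    (hstepη : ∀ k ≤ n, t (k + 1) - t k ≤ η / 2) (m : Fin (n + 1)) :
    ∃ (S : Finset (Fin (n + 1))) (χ : Fin (n + 1) → ℝ), m ∈ S ∧ χ m = 1 ∧
      (∀ k, 0 ≤ χ k ∧ χ k ≤ 1) ∧ (∀ j ∈ S, localRate α δ ≤ ∑ k ∈ S, l1Matrix α t n j k) ∧
      ∀ (v : Fin (n + 1) → ℝ) (M s : ℝ), (∀ k, |v k| ≤ M) → stepSum t n v ≤ s →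
        ∀ j ∈ S, |∑ k ∈ S, l1Matrix α t n j k * (χ k * v k) - χ j * (l1Matrix α t n *ᵥ v) j| ≤
          commutatorBound α δ η M s := by
  classical
  have hΓ := inv_gamma_two_sub_pos h₁
  set S : Finset (Fin (n + 1)) :=
    Finset.univ.filter fun k => k ≤ m ∧ t ((m : ℕ) + 1) - t ((k : ℕ) + 1) < δ
  have hS : ∀ k, k ∈ S ↔ k ≤ m ∧ t ((m : ℕ) + 1) - t ((k : ℕ) + 1) < δ := fun k => by simp [S]
  set χ : Fin (n + 1) → ℝ := fun k =>
    if k ≤ m then max 0 (1 - (t ((m : ℕ) + 1) - t ((k : ℕ) + 1)) / δ) else 0 with hχ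
  have hmS : m ∈ S := (hS m).2 ⟨le_rfl, by simpa using hδ⟩
  have hχ01 : ∀ k, 0 ≤ χ k ∧ χ k ≤ 1 := by
    intro k
    simp only [hχ]
    split_ifs with hk
    · refine ⟨le_max_left _ _, max_le zero_le_one ?_⟩
      have := h.le (show (k : ℕ) + 1 ≤ m + 1 by have := Fin.le_def.1 hk; omega) (by omega)
      have : 0 ≤ (t ((m : ℕ) + 1) - t ((k : ℕ) + 1)) / δ := div_nonneg (by linarith) hδ.le
      linarith
    · simp
  have hLzero : ∀ j k : Fin (n + 1), (j : ℕ) < k → l1Matrix α t n j k = 0 := by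
    intro j k hjk
    rw [l1Matrix_apply, cellWeight_of_lt α t hjk, cellWeight_of_lt α t (by omega)]
    simp
  have hLabs : ∀ j k : Fin (n + 1), (k : ℕ) < j → |l1Matrix α t n j k| =
      (Real.Gamma (2 - α))⁻¹ * (cellWeight α t j (k + 1) - cellWeight α t j k) := by
    intro j k hkj
    rw [abs_of_nonpos (h.l1Matrix_nonpos h₀ h₁ (by
      intro e; rw [e] at hkj; exact lt_irrefl _ hkj)), l1Matrix_apply]
    ring
  refine ⟨S, χ, hmS, by simp [hχ], hχ01, ?_, ?_⟩
  · intro j hj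
    -- By lower triangularity, the row sum over the window is the row sum from its first index `k₀`
    -- on, which telescopes.
    obtain ⟨k₀, hk₀, hmin⟩ := S.exists_min_image id ⟨m, hmS⟩
    have hjm := Fin.le_def.1 ((hS j).1 hj).1
    have hk₀j := Fin.le_def.1 (hmin j hj)
    simp only [id] at hk₀j
    have hsum : ∑ k ∈ S, l1Matrix α t n j k =
        ∑ k : Fin (n + 1), if (k₀ : ℕ) ≤ (k : ℕ) then l1Matrix α t n j k else 0 := by
      rw [← Finset.sum_filter]
      refine Finset.sum_subset_zero_on_sdiff ?_ ?_ fun _ _ => rfl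
      · intro k hk
        exact Finset.mem_filter.2 ⟨Finset.mem_univ _, Fin.le_def.1 (hmin k hk)⟩
      · intro k hk
        rw [Finset.mem_sdiff, Finset.mem_filter] at hk
        by_cases hkm : k ≤ m
        · exfalso
          refine hk.2 ((hS k).2 ⟨hkm, ?_⟩)
          have := h.le (show (k₀ : ℕ) + 1 ≤ k + 1 by omega) (by omega)
          have := ((hS k₀).1 hk₀).2
          linarith
        · refine hLzero j k ?_
          have := Fin.lt_def.1 (not_le.1 hkm)
          omega
    rw [hsum, sum_l1Matrix_ge α t n j (by omega)]
    refine mul_le_mul_of_nonneg_left ?_ hΓ.le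
    refine le_trans ?_ (h.cellWeight_lower h₀ h₁ (by omega) hk₀j)
    refine mul_le_mul_of_nonneg_left ?_ (by linarith)
    refine Real.rpow_le_rpow_of_nonpos (sub_pos.2 (h.lt (by omega) (by omega))) ?_ (by linarith)
    have h1 := h.le (show (j : ℕ) + 1 ≤ m + 1 by omega) (by omega)
    have h2 := ((hS k₀).1 hk₀).2
    -- The right node of cell `k₀` lies in the window; its left node is one step further, whence the
    -- `2 * δ` in `localRate`.
    have h3 := hstepδ k₀ (by omega)
    linarith
  · intro v M s hM hs j hj
    have hM0 : 0 ≤ M := (abs_nonneg _).trans (hM m)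
    have hjm := Fin.le_def.1 ((hS j).1 hj).1
    have e1 : ∑ k ∈ S, l1Matrix α t n j k * (χ k * v k) =
        ∑ k, l1Matrix α t n j k * (χ k * v k) := by
      refine Finset.sum_subset (Finset.subset_univ S) fun k _ hk => ?_
      by_cases hkm : k ≤ m
      · have : χ k = 0 := by
          simp only [hχ, if_pos hkm]
          refine max_eq_left ?_
          have : δ ≤ t ((m : ℕ) + 1) - t ((k : ℕ) + 1) := by
            by_contra hc; exact hk ((hS k).2 ⟨hkm, not_le.1 hc⟩)
          rw [sub_nonpos, one_le_div hδ]; exact this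
        rw [this]; ring
      · rw [hLzero j k (by have := Fin.lt_def.1 (not_le.1 hkm); omega), zero_mul]
    have e2 : ∑ k, l1Matrix α t n j k * (χ k * v k) - χ j * (l1Matrix α t n *ᵥ v) j =
        ∑ k, l1Matrix α t n j k * ((χ k - χ j) * v k) := by
      rw [Matrix.mulVec, dotProduct, Finset.mul_sum, ← Finset.sum_sub_distrib]
      exact Finset.sum_congr rfl fun k _ => by ring
    rw [e1, e2]
    refine (Finset.abs_sum_le_sum_abs _ _).trans ?_
    have hterm : ∀ k : Fin (n + 1), |l1Matrix α t n j k * ((χ k - χ j) * v k)| ≤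
        (if (k : ℕ) < j then M / δ * ((Real.Gamma (2 - α))⁻¹ *
          ((cellWeight α t j (k + 1) - cellWeight α t j k) *
            min (t ((j : ℕ) + 1) - t ((k : ℕ) + 1)) η)) else 0) +
        (Real.Gamma (2 - α))⁻¹ * ((1 - α) * (η / 2) ^ (-α - 1)) *
          (if (k : ℕ) < n then (t (k + 2) - t k) * |v k| else 0) := by
      intro k
      have hfarn : 0 ≤ (Real.Gamma (2 - α))⁻¹ * ((1 - α) * (η / 2) ^ (-α - 1)) := by
        have : 0 < 1 - α := by linarith
        positivity
      have hstepn : 0 ≤ (if (k : ℕ) < n then (t (k + 2) - t k) * |v k| else 0) := by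
        split_ifs with hk
        · exact mul_nonneg (by linarith [h.le (show (k : ℕ) ≤ k + 2 by omega) (by omega)])
            (abs_nonneg _)
        · exact le_rfl
      rcases lt_trichotomy (k : ℕ) j with hkj | hkj | hkj
      · rw [if_pos hkj, if_pos (by omega : (k : ℕ) < n), abs_mul, abs_mul, hLabs j k hkj]
        rw [if_pos (by omega : (k : ℕ) < n)] at hstepn
        have hdiff : 0 ≤ cellWeight α t j (k + 1) - cellWeight α t j k :=
          sub_nonneg.2 (h.cellWeight_mono h₀ h₁ (by omega) hkj)
        have hlt := h.lt (show (k : ℕ) + 1 < j + 1 by omega) (by omega)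
        have hχd : |χ k - χ j| ≤ (t ((j : ℕ) + 1) - t ((k : ℕ) + 1)) / δ := by
          simp only [hχ]
          rw [if_pos (Fin.le_def.2 (by omega)), if_pos (Fin.le_def.2 hjm)]
          refine (abs_max_sub_max_le_max _ _ _ _).trans ?_
          rw [sub_self, abs_zero, max_eq_right (abs_nonneg _)]
          have : 1 - (t ((m : ℕ) + 1) - t ((k : ℕ) + 1)) / δ -
              (1 - (t ((m : ℕ) + 1) - t ((j : ℕ) + 1)) / δ) =
              -((t ((j : ℕ) + 1) - t ((k : ℕ) + 1)) / δ) := by ring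
          rw [this, abs_neg, abs_of_nonneg (div_nonneg (by linarith) hδ.le)]
        rcases le_or_gt (t ((j : ℕ) + 1) - t ((k : ℕ) + 1)) η with hn | hf
        · rw [min_eq_left hn]
          refine le_trans ?_ (le_add_of_nonneg_right (mul_nonneg hfarn hstepn))
          calc _ ≤ (Real.Gamma (2 - α))⁻¹ * (cellWeight α t j (k + 1) - cellWeight α t j k) *
                ((t ((j : ℕ) + 1) - t ((k : ℕ) + 1)) / δ * M) := by
                gcongr
                exact hM k
            _ = _ := by ring
        · have hχ1 : |χ k - χ j| ≤ 1 := by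
            rw [abs_le]; constructor <;> linarith [(hχ01 k).1, (hχ01 k).2, (hχ01 j).1, (hχ01 j).2]
          have hfar := h.cellWeight_diff_le h₀ h₁ hη hstepη (by omega) hkj hf
          rw [min_eq_right hf.le]
          refine le_trans ?_ (le_add_of_nonneg_left (by positivity))
          calc _ ≤ (Real.Gamma (2 - α))⁻¹ * ((1 - α) * (η / 2) ^ (-α - 1) * (t (k + 2) - t k)) *
                (1 * |v k|) :=
              mul_le_mul (mul_le_mul_of_nonneg_left hfar hΓ.le)
                (mul_le_mul_of_nonneg_right hχ1 (abs_nonneg _)) (by positivity)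
                (mul_nonneg hΓ.le (hdiff.trans hfar))
            _ = _ := by ring
      · obtain rfl : k = j := Fin.ext hkj
        rw [sub_self, zero_mul, mul_zero, abs_zero, if_neg (lt_irrefl _), zero_add]
        exact mul_nonneg hfarn hstepn
      · rw [hLzero j k hkj, zero_mul, abs_zero, if_neg (by omega), zero_add]
        exact mul_nonneg hfarn hstepn
    refine (Finset.sum_le_sum fun k _ => hterm k).trans ?_
    rw [Finset.sum_add_distrib, ← Finset.mul_sum]
    refine add_le_add ?_ (mul_le_mul_of_nonneg_left hs ?_)
    · rw [Fin.sum_univ_eq_sum_range (fun k => if k < (j : ℕ) then M / δ *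
        ((Real.Gamma (2 - α))⁻¹ * ((cellWeight α t j (k + 1) - cellWeight α t j k) *
          min (t ((j : ℕ) + 1) - t (k + 1)) η)) else 0) (n + 1), ← Finset.sum_filter]
      have : (Finset.range (n + 1)).filter (fun k => k < (j : ℕ)) = Finset.range j := by
        ext k; simp; omega
      rw [this, ← Finset.mul_sum, ← Finset.mul_sum]
      have := h.sum_cellWeight_diff_mul_le h₀ h₁ hη (j := j) (by omega)
      gcongr
    · have : 0 < 1 - α := by linarith
      positivity

section Weights

variable {C : ℝ}

/-- The weights are of order at most `(n + 1) ^ (-α)`, so this scaling gives them bounded total mass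
and no component a large share. -/
lemma energyWeight_le (h : LogConcaveMesh T n t) (h₀ : 0 < α) (h₁ : α < 1) (hC1 : 1 ≤ C)
    (hstep : ∀ k ≤ n, t (k + 1) - t k ≤ C / (n + 1)) (hC : t 2 - t 1 ≤ C * (t 1 - t 0)) {i : ℕ}
    (hi : i ≤ n) : ((n : ℝ) + 1) ^ (α - 1) * energyWeight α t n i ≤ C ^ 2 / (n + 1) := by
  have hn1 : (0 : ℝ) < n + 1 := by positivity
  have hC0 : 0 < C := by linarith
  have hb : 0 ≤ (C / (n + 1)) ^ α := by positivity
  have hlt : ∀ i < n, energyWeight α t n i ≤ (C / (n + 1)) ^ α := by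
    intro i hi
    rw [energyWeight, if_pos hi]
    have p0 := sub_pos.2 (h.lt (show i < i + 1 by omega) (by omega))
    have p1 := sub_pos.2 (h.lt (show i + 1 < i + 2 by omega) (by omega))
    calc _ ≤ ((C / (n + 1)) * (C / (n + 1))) ^ (α / 2) := by
          refine Real.rpow_le_rpow (by positivity) ?_ (by linarith)
          exact mul_le_mul (hstep i (by omega)) (hstep (i + 1) (by omega)) p1.le (by positivity)
      _ = _ := by
          rw [← pow_two, ← Real.rpow_natCast, ← Real.rpow_mul (by positivity)]
          congr 1; push_cast; ring
  have hall : energyWeight α t n i ≤ (C / (n + 1)) ^ α * C := by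
    rcases hi.lt_or_eq with hi | rfl
    · exact (hlt i hi).trans (le_mul_of_one_le_right hb hC1)
    · obtain ⟨k, rfl⟩ : ∃ k, i = k + 1 := ⟨i - 1, by have := h.one_le; omega⟩
      refine (h.energyWeight_succ_le h₀ le_rfl).trans ?_
      have p0 := sub_pos.2 (h.lt (show k < k + 1 by omega) (by omega))
      have p1 := sub_pos.2 (h.lt (show k + 1 < k + 2 by omega) (by omega))
      refine mul_le_mul (hlt k (by omega)) ?_ (by positivity) hb
      calc _ ≤ C ^ α := by
            refine Real.rpow_le_rpow (by positivity) ?_ h₀.le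
            rw [div_le_iff₀ p0]
            exact h.step_succ_le hC (by omega)
        _ ≤ C ^ (1 : ℝ) := Real.rpow_le_rpow_of_exponent_le hC1 h₁.le
        _ = C := Real.rpow_one C
  calc _ ≤ ((n : ℝ) + 1) ^ (α - 1) * ((C / (n + 1)) ^ α * C) := by gcongr
    _ = C ^ α * C / (n + 1) := by
        rw [Real.div_rpow hC0.le hn1.le, Real.rpow_sub_one hn1.ne']
        have := Real.rpow_pos_of_pos hn1 α
        field_simp
    _ ≤ C ^ 2 / (n + 1) := by
        rw [pow_two]
        gcongr
        calc C ^ α ≤ C ^ (1 : ℝ) := Real.rpow_le_rpow_of_exponent_le hC1 h₁.le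
          _ = C := Real.rpow_one C

/-- A step `m` is `m ^ α * m ^ (1 - α)`. The first factor is bounded by a multiple of the weight,
since adjacent steps are comparable, and the second by a multiple of `(n + 1) ^ (α - 1)`. -/
lemma step_le_energyWeight (h : LogConcaveMesh T n t) (h₀ : 0 < α) (h₁ : α < 1) (hC1 : 1 ≤ C)
    (hstep : ∀ k ≤ n, t (k + 1) - t k ≤ C / (n + 1)) (hC : t 2 - t 1 ≤ C * (t 1 - t 0)) {i : ℕ}
    (hi : i < n) :
    t (i + 2) - t i ≤ 2 * C ^ 2 * (((n : ℝ) + 1) ^ (α - 1) * energyWeight α t n i) := by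
  have hn1 : (0 : ℝ) < n + 1 := by positivity
  have hC0 : 0 < C := by linarith
  have p0 := sub_pos.2 (h.lt (show i < i + 1 by omega) (by omega))
  have p1 := sub_pos.2 (h.lt (show i + 1 < i + 2 by omega) (by omega))
  have r0 := h.step_succ_le hC (k := i) (by omega)
  have r1 := h.step_le_succ hC (k := i) (by omega)
  have s0 := hstep i (by omega)
  have s1 := hstep (i + 1) (by omega)
  change t (i + 2) - t (i + 1) ≤ _ at s1
  have key : ∀ m : ℝ, 0 < m → m ≤ C / (n + 1) →
      m ^ 2 ≤ C * ((t (i + 1) - t i) * (t (i + 2) - t (i + 1))) →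
      m ≤ C ^ 2 * (((n : ℝ) + 1) ^ (α - 1) * energyWeight α t n i) := by
    intro m hm hmC hmsq
    rw [energyWeight, if_pos hi]
    have h1 : m ^ α ≤ C * ((t (i + 1) - t i) * (t (i + 2) - t (i + 1))) ^ (α / 2) := by
      calc m ^ α = (m ^ 2) ^ (α / 2) := by
            rw [← Real.rpow_natCast, ← Real.rpow_mul hm.le]; congr 1; push_cast; ring
        _ ≤ (C * ((t (i + 1) - t i) * (t (i + 2) - t (i + 1)))) ^ (α / 2) :=
            Real.rpow_le_rpow (by positivity) hmsq (by linarith)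
        _ = C ^ (α / 2) * ((t (i + 1) - t i) * (t (i + 2) - t (i + 1))) ^ (α / 2) :=
            Real.mul_rpow hC0.le (by positivity)
        _ ≤ _ := by
            gcongr
            calc C ^ (α / 2) ≤ C ^ (1 : ℝ) :=
                  Real.rpow_le_rpow_of_exponent_le hC1 (by linarith)
              _ = C := Real.rpow_one C
    have h2 : m ^ (1 - α) ≤ C * ((n : ℝ) + 1) ^ (α - 1) := by
      calc m ^ (1 - α) ≤ (C / (n + 1)) ^ (1 - α) :=
            Real.rpow_le_rpow hm.le hmC (by linarith)
        _ = C ^ (1 - α) * ((n : ℝ) + 1) ^ (α - 1) := by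
            rw [Real.div_rpow hC0.le hn1.le, show α - 1 = -(1 - α) by ring,
              Real.rpow_neg hn1.le, div_eq_mul_inv]
        _ ≤ _ := by
            gcongr
            calc C ^ (1 - α) ≤ C ^ (1 : ℝ) :=
                  Real.rpow_le_rpow_of_exponent_le hC1 (by linarith)
              _ = C := Real.rpow_one C
    calc m = m ^ α * m ^ (1 - α) := by
          rw [← Real.rpow_add hm, add_sub_cancel, Real.rpow_one]
      _ ≤ (C * ((t (i + 1) - t i) * (t (i + 2) - t (i + 1))) ^ (α / 2)) *
          (C * ((n : ℝ) + 1) ^ (α - 1)) := by gcongr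
      _ = _ := by ring
  have k0 := key _ p0 s0 (by nlinarith)
  have k1 := key _ p1 s1 (by nlinarith)
  linarith

end Weights

end LogConcaveMesh

/-! ### Maximum norm bounds for the coupled equations. -/

namespace LogConcaveMesh

variable {T α σ : ℝ} {n : ℕ} {t : ℕ → ℝ} {δ η κ ℓ G M s : ℝ}

lemma localRate_pos (h₁ : α < 1) (hδ : 0 < δ) : 0 < localRate α δ :=
  mul_pos (inv_gamma_two_sub_pos h₁) (mul_pos (by linarith) (Real.rpow_pos_of_pos (by linarith) _))

section OneBlock

variable {u u' u'' r : ℝ → Fin (n + 1) → ℝ}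

/-- A maximum norm bound for a Dirichlet problem driven by the L1 matrix, from a cutoff in time. -/
lemma sup_dirichlet (h : LogConcaveMesh T n t) (h₀ : 0 < α) (h₁ : α < 1) (hδ : 0 < δ)
    (hη : 0 < η) (hstepδ : ∀ k ≤ n, t (k + 1) - t k ≤ δ)
    (hstepη : ∀ k ≤ n, t (k + 1) - t k ≤ η / 2) (hκ : 0 < κ) (hℓ : 0 < ℓ)
    (hF : 0 ≤ G + commutatorBound α δ η M s) (hc : ContinuousOn u (Icc (-ℓ) 0))
    (hu : ∀ x ∈ Ioo (-ℓ) 0, HasDerivAt u (u' x) x)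
    (hu' : ∀ x ∈ Ioo (-ℓ) 0, HasDerivAt u' (u'' x) x)
    (heq : ∀ x ∈ Ioo (-ℓ) 0, κ • u'' x = l1Matrix α t n *ᵥ u x + r x)
    (hr : ∀ x ∈ Ioo (-ℓ) 0, ∀ i, |r x i| ≤ G) (hM : ∀ x ∈ Ioo (-ℓ) 0, ∀ i, |u x i| ≤ M)
    (hs : ∀ x ∈ Ioo (-ℓ) 0, stepSum t n (u x) ≤ s) (hl : u (-ℓ) = 0) (h0 : u 0 = 0)
    {x : ℝ} (hx : x ∈ Icc (-ℓ) 0) (m : Fin (n + 1)) :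
    |u x m| ≤ (G + commutatorBound α δ η M s) / localRate α δ ∧
      |u x m| ≤ (G + commutatorBound α δ η M s) / √(κ * localRate α δ) * (-x) := by
  obtain ⟨S, χ, hmS, hχm, hχ, hrow, hcom⟩ := h.exists_cutoff h₀ h₁ hδ hη hstepδ hstepη m
  have key := abs_le_of_dirichlet_barrier S (fun j k => l1Matrix α t n j k)
    (z := fun j x => χ j * u x j) (z' := fun j x => χ j * u' x j)
    (z'' := fun j x => χ j * u'' x j) hℓ hκ (localRate_pos h₁ hδ) hF
    (fun j _ => continuousOn_const.mul ((continuous_apply j).comp_continuousOn hc))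
    (fun j _ x hx => (hasDerivAt_pi.1 (hu x hx) j).const_mul _)
    (fun j _ x hx => (hasDerivAt_pi.1 (hu' x hx) j).const_mul _)
    (fun j _ k _ hjk => h.l1Matrix_nonpos h₀ h₁ hjk) hrow
    (fun j hj x hx => ?_) (fun j _ => by simp [hl]) (fun j _ => by simp [h0]) m hmS x hx
  · simpa [hχm] using key
  · have e := congrFun (heq x hx) j
    simp only [Pi.smul_apply, smul_eq_mul, Pi.add_apply] at e
    -- The cut-off function solves the equation on the window, with the cut-off residual and the
    -- commutator as right-hand side.
    have e2 : κ * (χ j * u'' x j) - ∑ k ∈ S, l1Matrix α t n j k * (χ k * u x k) =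
        χ j * r x j - (∑ k ∈ S, l1Matrix α t n j k * (χ k * u x k) -
          χ j * (l1Matrix α t n *ᵥ u x) j) := by linear_combination χ j * e
    rw [e2]
    refine (abs_sub _ _).trans (add_le_add ?_ (hcom (u x) M s (hM x hx) (hs x hx) j hj))
    rw [abs_mul, abs_of_nonneg (hχ j).1]
    exact (mul_le_of_le_one_left (abs_nonneg _) (hχ j).2).trans (hr x hx j)

lemma sup_neumann (h : LogConcaveMesh T n t) (h₀ : 0 < α) (h₁ : α < 1) (hδ : 0 < δ)
    (hη : 0 < η) (hstepδ : ∀ k ≤ n, t (k + 1) - t k ≤ δ)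
    (hstepη : ∀ k ≤ n, t (k + 1) - t k ≤ η / 2) (hκ : 0 < κ) (hℓ : 0 < ℓ)
    (hF : 0 ≤ G + commutatorBound α δ η M s) (hc : ContinuousOn u (Icc 0 ℓ))
    (hu : ∀ x ∈ Ioo 0 ℓ, HasDerivAt u (u' x) x)
    (hu' : ∀ x ∈ Ioo 0 ℓ, HasDerivAt u' (u'' x) x)
    (heq : ∀ x ∈ Ioo 0 ℓ, κ • u'' x = l1Matrix α t n *ᵥ u x + r x)
    (hr : ∀ x ∈ Ioo 0 ℓ, ∀ i, |r x i| ≤ G) (hM : ∀ x ∈ Ioo 0 ℓ, ∀ i, |u x i| ≤ M)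
    (hs : ∀ x ∈ Ioo 0 ℓ, stepSum t n (u x) ≤ s) {d : Fin (n + 1) → ℝ} {D : ℝ}
    (hd : HasDerivWithinAt u d (Icc 0 ℓ) 0) (hD : ∀ i, |d i| ≤ D) (hl : u ℓ = 0)
    {x : ℝ} (hx : x ∈ Icc 0 ℓ) (m : Fin (n + 1)) :
    |u x m| ≤ (G + commutatorBound α δ η M s) / localRate α δ + D / √(localRate α δ / κ) := by
  obtain ⟨S, χ, hmS, hχm, hχ, hrow, hcom⟩ := h.exists_cutoff h₀ h₁ hδ hη hstepδ hstepη m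
  have key := abs_le_of_neumann_barrier S (fun j k => l1Matrix α t n j k) (s := D)
    (z := fun j x => χ j * u x j) (z' := fun j x => χ j * u' x j)
    (z'' := fun j x => χ j * u'' x j) hℓ hκ (localRate_pos h₁ hδ) hF
    (fun j _ => continuousOn_const.mul ((continuous_apply j).comp_continuousOn hc))
    (fun j _ x hx => (hasDerivAt_pi.1 (hu x hx) j).const_mul _)
    (fun j _ x hx => (hasDerivAt_pi.1 (hu' x hx) j).const_mul _)
    (fun j _ k _ hjk => h.l1Matrix_nonpos h₀ h₁ hjk) hrow
    (fun j hj x hx => ?_)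
    (fun j _ => ⟨χ j * d j, ?_, (hasDerivWithinAt_pi.1 hd j).const_mul _⟩)
    (fun j _ => by simp [hl]) m hmS x hx
  · simpa [hχm] using key
  · have e := congrFun (heq x hx) j
    simp only [Pi.smul_apply, smul_eq_mul, Pi.add_apply] at e
    have e2 : κ * (χ j * u'' x j) - ∑ k ∈ S, l1Matrix α t n j k * (χ k * u x k) =
        χ j * r x j - (∑ k ∈ S, l1Matrix α t n j k * (χ k * u x k) -
          χ j * (l1Matrix α t n *ᵥ u x) j) := by linear_combination χ j * e
    rw [e2]
    refine (abs_sub _ _).trans (add_le_add ?_ (hcom (u x) M s (hM x hx) (hs x hx) j hj))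
    rw [abs_mul, abs_of_nonneg (hχ j).1]
    exact (mul_le_of_le_one_left (abs_nonneg _) (hχ j).2).trans (hr x hx j)
  · rw [abs_mul, abs_of_nonneg (hχ j).1]
    exact (mul_le_of_le_one_left (abs_nonneg _) (hχ j).2).trans (hD j)

end OneBlock

/-- The two blocks of a coupled equation are equations for the L1 matrix, with the coupling as a
bounded perturbation. -/
lemma exists_block_equations (hσ : 0 < σ) {v w R : StateAdjointIndex n → ℝ} {M₀ : ℝ}
    (heq : κ • w = coupledMatrix α σ t n *ᵥ v + R) (hR : ∀ j, |R j| ≤ M₀) (hM : ∀ j, |v j| ≤ M) :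
    (κ • (w ∘ Sum.inl) = l1Matrix α t n *ᵥ (v ∘ Sum.inl) +
        (κ • (w ∘ Sum.inl) - l1Matrix α t n *ᵥ (v ∘ Sum.inl)) ∧
      ∀ i, |(κ • (w ∘ Sum.inl) - l1Matrix α t n *ᵥ (v ∘ Sum.inl)) i| ≤ (1 + σ⁻¹) * M + M₀) ∧
    (κ • (w ∘ Sum.inr) = l1Matrix α t n *ᵥ (v ∘ Sum.inr) +
        (κ • (w ∘ Sum.inr) - l1Matrix α t n *ᵥ (v ∘ Sum.inr)) ∧
      ∀ i, |(κ • (w ∘ Sum.inr) - l1Matrix α t n *ᵥ (v ∘ Sum.inr)) i| ≤ (1 + σ⁻¹) * M + M₀) := by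
  have hσ' := inv_pos.2 hσ
  have hM0 : 0 ≤ M := (abs_nonneg _).trans (hM (Sum.inl 0))
  refine ⟨⟨by abel, fun i => ?_⟩, ⟨by abel, fun i => ?_⟩⟩
  · have e := congrFun heq (Sum.inl i)
    rw [Pi.add_apply, coupledMatrix_mulVec_inl, Pi.smul_apply, smul_eq_mul] at e
    have : (κ • (w ∘ Sum.inl) - l1Matrix α t n *ᵥ (v ∘ Sum.inl)) i =
        σ⁻¹ * (exchangeBar n *ᵥ (v ∘ Sum.inr)) i + R (Sum.inl i) := by
      simp only [Pi.sub_apply, Pi.smul_apply, smul_eq_mul, Function.comp_apply]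
      linear_combination e
    rw [this]
    refine (abs_add_le _ _).trans (add_le_add ?_ (hR _))
    rw [abs_mul, abs_of_pos hσ']
    have := abs_exchangeBar_mulVec_le n (v ∘ Sum.inr) i fun k => hM (Sum.inr k)
    nlinarith
  · have e := congrFun heq (Sum.inr i)
    rw [Pi.add_apply, coupledMatrix_mulVec_inr, Pi.smul_apply, smul_eq_mul] at e
    have : (κ • (w ∘ Sum.inr) - l1Matrix α t n *ᵥ (v ∘ Sum.inr)) i =
        -(exchangeBar n *ᵥ (v ∘ Sum.inl)) i + R (Sum.inr i) := by
      simp only [Pi.sub_apply, Pi.smul_apply, smul_eq_mul, Function.comp_apply]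
      linear_combination e
    rw [this]
    refine (abs_add_le _ _).trans (add_le_add ?_ (hR _))
    rw [abs_neg]
    have := abs_exchangeBar_mulVec_le n (v ∘ Sum.inl) i fun k => hM (Sum.inl k)
    nlinarith

section Coupled

variable {E E' E'' R : ℝ → StateAdjointIndex n → ℝ} {M₀ : ℝ}

lemma exists_sup_norm_attained {ι : Type} [Fintype ι] [Nonempty ι] {a b : ℝ} (hab : a ≤ b)
    {f : ℝ → ι → ℝ} (hf : ContinuousOn f (Icc a b)) :
    ∃ x₀ ∈ Icc a b, ∃ j₀, ∀ x ∈ Icc a b, ∀ j, |f x j| ≤ |f x₀ j₀| := by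
  obtain ⟨x₀, hx₀, hmax⟩ := isCompact_Icc.exists_isMaxOn (nonempty_Icc.2 hab) hf.norm
  obtain ⟨j₀, hj₀⟩ := Finite.exists_max fun j => |f x₀ j|
  refine ⟨x₀, hx₀, j₀, fun x hx j => ?_⟩
  have h1 : ‖f x j‖ ≤ ‖f x‖ := norm_le_pi_norm (f x) j
  have h2 : ‖f x‖ ≤ ‖f x₀‖ := hmax hx
  have h3 : ‖f x₀‖ ≤ |f x₀ j₀| := (pi_norm_le_iff_of_nonneg (abs_nonneg _)).2 hj₀
  exact h1.trans (h2.trans h3)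

/-- The coupling is treated as a source. With `Λ` the local rate and `M` the supremum of the error,
coupling and commutator each contribute at most `Λ / 4 * M`, up to constants, so `Λ * M ≤ F ≤ Λ * M
/ 2 + M₀ + 1`. Half of the left side absorbs the `M` on the right, and `F ≤ 2 * (M₀ + 1)`. -/
lemma coupled_sup_dirichlet (h : LogConcaveMesh T n t) (h₀ : 0 < α) (h₁ : α < 1) (hσ : 0 < σ)
    (hδ : 0 < δ) (hη : 0 < η) (hstepδ : ∀ k ≤ n, t (k + 1) - t k ≤ δ)
    (hstepη : ∀ k ≤ n, t (k + 1) - t k ≤ η / 2) (hκ : 0 < κ) (hℓ : 0 < ℓ) (hM₀ : 0 ≤ M₀)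
    (hcom0 : ∀ M, 0 ≤ M → 0 ≤ commutatorBound α δ η M s)
    (hcom : ∀ M, 0 ≤ M → commutatorBound α δ η M s ≤ localRate α δ / 4 * M + 1)
    (hrate : 1 + σ⁻¹ ≤ localRate α δ / 4) (hc : ContinuousOn E (Icc (-ℓ) 0))
    (hE : ∀ x ∈ Ioo (-ℓ) 0, HasDerivAt E (E' x) x)
    (hE' : ∀ x ∈ Ioo (-ℓ) 0, HasDerivAt E' (E'' x) x)
    (heq : ∀ x ∈ Ioo (-ℓ) 0, κ • E'' x = coupledMatrix α σ t n *ᵥ E x + R x)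
    (hR : ∀ x ∈ Ioo (-ℓ) 0, ∀ j, |R x j| ≤ M₀)
    (hsl : ∀ x ∈ Ioo (-ℓ) 0, stepSum t n (E x ∘ Sum.inl) ≤ s)
    (hsr : ∀ x ∈ Ioo (-ℓ) 0, stepSum t n (E x ∘ Sum.inr) ≤ s)
    (hl : E (-ℓ) = 0) (h0 : E 0 = 0) {x : ℝ} (hx : x ∈ Icc (-ℓ) 0) (j : StateAdjointIndex n) :
    |E x j| ≤ 2 * (M₀ + 1) / localRate α δ ∧
      |E x j| ≤ 2 * (M₀ + 1) / √(κ * localRate α δ) * (-x) := by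
  have hσ' := inv_pos.2 hσ
  have hΛ : 0 < localRate α δ := localRate_pos h₁ hδ
  obtain ⟨x₀, hx₀, j₀, hmax⟩ := exists_sup_norm_attained (by linarith) hc
  set M := |E x₀ j₀| with hMdef
  have hM0 : 0 ≤ M := abs_nonneg _
  set F := (1 + σ⁻¹) * M + M₀ + commutatorBound α δ η M s with hFdef
  have hF0 : 0 ≤ F := by have := hcom0 M hM0; positivity
  have hFle : F ≤ localRate α δ * M / 2 + M₀ + 1 := by
    have := hcom M hM0
    nlinarith
  have hb := fun x (hx : x ∈ Ioo (-ℓ) 0) => exists_block_equations hσ (heq x hx) (hR x hx)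
    (hmax x (Ioo_subset_Icc_self hx))
  have hbound : ∀ x ∈ Icc (-ℓ) 0, ∀ j, |E x j| ≤ F / localRate α δ ∧
      |E x j| ≤ F / √(κ * localRate α δ) * (-x) := by
    intro x hx j
    rcases j with i | i
    · exact h.sup_dirichlet h₀ h₁ hδ hη hstepδ hstepη hκ hℓ hF0
        (u := fun x => E x ∘ Sum.inl) (u' := fun x => E' x ∘ Sum.inl)
        (u'' := fun x => E'' x ∘ Sum.inl)
        (continuousOn_pi.2 fun i => continuousOn_pi.1 hc _)
        (fun x hx => hasDerivAt_pi.2 fun i => hasDerivAt_pi.1 (hE x hx) _)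
        (fun x hx => hasDerivAt_pi.2 fun i => hasDerivAt_pi.1 (hE' x hx) _)
        (fun x hx => (hb x hx).1.1) (fun x hx => (hb x hx).1.2)
        (fun x hx i => hmax x (Ioo_subset_Icc_self hx) _) hsl
        (by funext i; simp [hl]) (by funext i; simp [h0]) hx i
    · exact h.sup_dirichlet h₀ h₁ hδ hη hstepδ hstepη hκ hℓ hF0
        (u := fun x => E x ∘ Sum.inr) (u' := fun x => E' x ∘ Sum.inr)
        (u'' := fun x => E'' x ∘ Sum.inr)
        (continuousOn_pi.2 fun i => continuousOn_pi.1 hc _)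
        (fun x hx => hasDerivAt_pi.2 fun i => hasDerivAt_pi.1 (hE x hx) _)
        (fun x hx => hasDerivAt_pi.2 fun i => hasDerivAt_pi.1 (hE' x hx) _)
        (fun x hx => (hb x hx).2.1) (fun x hx => (hb x hx).2.2)
        (fun x hx i => hmax x (Ioo_subset_Icc_self hx) _) hsr
        (by funext i; simp [hl]) (by funext i; simp [h0]) hx i
  have hMF : localRate α δ * M ≤ F := by
    have := (hbound x₀ hx₀ j₀).1
    rwa [le_div_iff₀' hΛ] at this
  have hFs : F ≤ 2 * (M₀ + 1) := by linarith
  obtain ⟨b1, b2⟩ := hbound x hx j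
  refine ⟨b1.trans (by gcongr), b2.trans ?_⟩
  have : 0 ≤ -x := by linarith [hx.2]
  gcongr

/-- The same absorption; it also doubles the contribution of the flux. -/
lemma coupled_sup_neumann (h : LogConcaveMesh T n t) (h₀ : 0 < α) (h₁ : α < 1) (hσ : 0 < σ)
    (hδ : 0 < δ) (hη : 0 < η) (hstepδ : ∀ k ≤ n, t (k + 1) - t k ≤ δ)
    (hstepη : ∀ k ≤ n, t (k + 1) - t k ≤ η / 2) (hκ : 0 < κ) (hℓ : 0 < ℓ) (hM₀ : 0 ≤ M₀)
    (hcom0 : ∀ M, 0 ≤ M → 0 ≤ commutatorBound α δ η M s)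
    (hcom : ∀ M, 0 ≤ M → commutatorBound α δ η M s ≤ localRate α δ / 4 * M + 1)
    (hrate : 1 + σ⁻¹ ≤ localRate α δ / 4) (hc : ContinuousOn E (Icc 0 ℓ))
    (hE : ∀ x ∈ Ioo 0 ℓ, HasDerivAt E (E' x) x)
    (hE' : ∀ x ∈ Ioo 0 ℓ, HasDerivAt E' (E'' x) x)
    (heq : ∀ x ∈ Ioo 0 ℓ, κ • E'' x = coupledMatrix α σ t n *ᵥ E x + R x)
    (hR : ∀ x ∈ Ioo 0 ℓ, ∀ j, |R x j| ≤ M₀)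
    (hsl : ∀ x ∈ Ioo 0 ℓ, stepSum t n (E x ∘ Sum.inl) ≤ s)
    (hsr : ∀ x ∈ Ioo 0 ℓ, stepSum t n (E x ∘ Sum.inr) ≤ s)
    {d : StateAdjointIndex n → ℝ} {D : ℝ} (hd : HasDerivWithinAt E d (Icc 0 ℓ) 0)
    (hD : ∀ j, |d j| ≤ D) (hl : E ℓ = 0) {x : ℝ} (hx : x ∈ Icc 0 ℓ) (j : StateAdjointIndex n) :
    |E x j| ≤ 2 * (M₀ + 1) / localRate α δ + 2 * (D / √(localRate α δ / κ)) := by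
  have hσ' := inv_pos.2 hσ
  have hΛ : 0 < localRate α δ := localRate_pos h₁ hδ
  obtain ⟨x₀, hx₀, j₀, hmax⟩ := exists_sup_norm_attained hℓ.le hc
  set M := |E x₀ j₀| with hMdef
  have hM0 : 0 ≤ M := abs_nonneg _
  set F := (1 + σ⁻¹) * M + M₀ + commutatorBound α δ η M s with hFdef
  have hF0 : 0 ≤ F := by have := hcom0 M hM0; positivity
  have hFle : F ≤ localRate α δ * M / 2 + M₀ + 1 := by
    have := hcom M hM0
    nlinarith
  have hb := fun x (hx : x ∈ Ioo 0 ℓ) => exists_block_equations hσ (heq x hx) (hR x hx)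
    (hmax x (Ioo_subset_Icc_self hx))
  have hbound : ∀ x ∈ Icc 0 ℓ, ∀ j, |E x j| ≤ F / localRate α δ + D / √(localRate α δ / κ) := by
    intro x hx j
    rcases j with i | i
    · exact h.sup_neumann h₀ h₁ hδ hη hstepδ hstepη hκ hℓ hF0
        (u := fun x => E x ∘ Sum.inl) (u' := fun x => E' x ∘ Sum.inl)
        (u'' := fun x => E'' x ∘ Sum.inl)
        (continuousOn_pi.2 fun i => continuousOn_pi.1 hc _)
        (fun x hx => hasDerivAt_pi.2 fun i => hasDerivAt_pi.1 (hE x hx) _)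
        (fun x hx => hasDerivAt_pi.2 fun i => hasDerivAt_pi.1 (hE' x hx) _)
        (fun x hx => (hb x hx).1.1) (fun x hx => (hb x hx).1.2)
        (fun x hx i => hmax x (Ioo_subset_Icc_self hx) _) hsl (d := d ∘ Sum.inl)
        (hasDerivWithinAt_pi.2 fun i => hasDerivWithinAt_pi.1 hd _) (fun i => hD _)
        (by funext i; simp [hl]) hx i
    · exact h.sup_neumann h₀ h₁ hδ hη hstepδ hstepη hκ hℓ hF0
        (u := fun x => E x ∘ Sum.inr) (u' := fun x => E' x ∘ Sum.inr)
        (u'' := fun x => E'' x ∘ Sum.inr)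
        (continuousOn_pi.2 fun i => continuousOn_pi.1 hc _)
        (fun x hx => hasDerivAt_pi.2 fun i => hasDerivAt_pi.1 (hE x hx) _)
        (fun x hx => hasDerivAt_pi.2 fun i => hasDerivAt_pi.1 (hE' x hx) _)
        (fun x hx => (hb x hx).2.1) (fun x hx => (hb x hx).2.2)
        (fun x hx i => hmax x (Ioo_subset_Icc_self hx) _) hsr (d := d ∘ Sum.inr)
        (hasDerivWithinAt_pi.2 fun i => hasDerivWithinAt_pi.1 hd _) (fun i => hD _)
        (by funext i; simp [hl]) hx i
  have hM2 := hbound x₀ hx₀ j₀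
  rw [← hMdef] at hM2
  have hFd : F / localRate α δ ≤ M / 2 + (M₀ + 1) / localRate α δ := by
    rw [div_le_iff₀ hΛ, add_mul, div_mul_cancel₀ _ hΛ.ne']
    linarith
  have := hmax x hx j
  rw [mul_div_assoc]
  linarith

end Coupled

/-! ### The semi-discrete equation for the nodal values. -/

section NodalEquation

variable {a b : ℝ}

lemma exchangeBar_mulVec_apply (n : ℕ) (v : Fin (n + 1) → ℝ) (i : Fin (n + 1)) :
    (exchangeBar n *ᵥ v) i =
      if hi : (i : ℕ) < n then v ⟨n - 1 - i, by omega⟩ else 0 := by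
  simp only [Matrix.mulVec, dotProduct, exchangeBar, Matrix.of_apply, ite_mul, one_mul, zero_mul]
  split_ifs with hi
  · rw [Finset.sum_eq_single (⟨n - 1 - i, by omega⟩ : Fin (n + 1)),
      if_pos (show (i : ℕ) + (n - 1 - i) + 1 = n by omega)]
    · intro k _ hk
      rw [if_neg]
      exact fun h => hk (Fin.ext (by simp; omega))
    · simp
  · exact Finset.sum_eq_zero fun k _ => if_neg (by omega)

lemma twiceDifferentiable_pi {ι : Type} [Fintype ι] {f : ℝ → ι → ℝ}
    (hf : ∀ j, TwiceDifferentiable a b fun x => f x j) :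
    TwiceDifferentiable a b f ∧
      ∀ x ∈ Ioo a b, ∀ j, deriv (deriv f) x j = deriv (deriv fun x => f x j) x := by
  have h1 : EqOn (deriv f) (fun x j => deriv (fun x => f x j) x) (Ioo a b) := fun x hx =>
    deriv_pi fun j => ((hf j).hasDerivAt hx).differentiableAt
  have h2 : ∀ x ∈ Ioo a b,
      HasDerivAt (deriv f) (fun j => deriv (deriv fun x => f x j) x) x := fun x hx =>
    (hasDerivAt_pi.2 fun j => (hf j).hasDerivAt_deriv hx).congr_of_eventuallyEq
      (h1.eventuallyEq_of_mem (Ioo_mem_nhds hx.1 hx.2))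
  exact ⟨⟨differentiableOn_pi.2 fun j => (hf j).1,
    fun x hx => (h2 x hx).differentiableAt.differentiableWithinAt⟩,
    fun x hx j => congrFun (h2 x hx).deriv j⟩

/-- The nodal values of a solution satisfy the semi-discrete equation up to the truncation
error. -/
lemma nodal_equation (h : LogConcaveMesh T n t) {y p : ℝ → ℝ → ℝ}
    (hs : SolvesStateAdjoint α T σ κ a b y p) :
    TwiceDifferentiable a b (fun x => nodalVector t n (y x) (p x)) ∧
      ∀ x ∈ Ioo a b, κ • deriv (deriv fun x => nodalVector t n (y x) (p x)) x =
        coupledMatrix α σ t n *ᵥ nodalVector t n (y x) (p x) -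
          l1Truncation α T t n (y x) (p x) := by
  have ht1 : ∀ i : Fin (n + 1), t ((i : ℕ) + 1) ∈ Ioc 0 T := fun i =>
    ⟨by rw [← h.zero]; exact h.lt (by omega) (by omega), h.le_last (by omega)⟩
  have ht2 : ∀ i : Fin (n + 1), t (n - (i : ℕ)) ∈ Ico 0 T := fun i =>
    ⟨h.nonneg (by omega), by rw [← h.last]; exact h.lt (by omega) (by omega)⟩
  obtain ⟨hd, he⟩ := twiceDifferentiable_pi (a := a) (b := b)
    (f := fun x => nodalVector t n (y x) (p x)) (by
      rintro (i | i)
      · exact hs.state_space _ (ht1 i)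
      · exact hs.adjoint_space _ (ht2 i))
  refine ⟨hd, fun x hx => ?_⟩
  have hxc := Ioo_subset_Icc_self hx
  funext j
  rw [Pi.smul_apply, he x hx j, Pi.sub_apply, smul_eq_mul]
  rcases j with i | i
  · have e := hs.state_eq x hx _ (ht1 i)
    have eJ : (exchangeBar n *ᵥ (nodalVector t n (y x) (p x) ∘ Sum.inr)) i = p x (t (i + 1)) := by
      rw [exchangeBar_mulVec_apply]
      split_ifs with hi
      · simp only [nodalVector, Function.comp_apply, Sum.elim_inr]
        congr 2; omega
      -- The zero last row of the exchange matrix is exact here because the adjoint vanishes at `T`.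
      -- For the adjoint block the same role is played by the zero initial state.
      · rw [show (i : ℕ) = n by omega, h.last, hs.adjoint_final x hxc]
    rw [coupledMatrix_mulVec_inl, eJ]
    simp only [nodalVector, l1Truncation, Sum.elim_inl, Sum.elim_comp_inl]
    rw [e]
    ring
  · have e := hs.adjoint_eq x hx _ (ht2 i)
    have eJ : (exchangeBar n *ᵥ (nodalVector t n (y x) (p x) ∘ Sum.inl)) i = y x (t (n - i)) := by
      rw [exchangeBar_mulVec_apply]
      split_ifs with hi
      · simp only [nodalVector, Function.comp_apply, Sum.elim_inl]
        congr 2; omega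
      · rw [show n - (i : ℕ) = 0 by omega, h.zero, hs.state_initial x hxc]
    rw [coupledMatrix_mulVec_inr, eJ]
    simp only [nodalVector, l1Truncation, Sum.elim_inr, Sum.elim_comp_inr]
    rw [e]
    ring

end NodalEquation

end LogConcaveMesh

/-! ### Smallness in the weighted norm. -/

namespace LogConcaveMesh

variable {T α σ : ℝ} {n : ℕ} {t : ℕ → ℝ} {C : ℝ}

/-- The weight of the coupled coercivity estimate, scaled to a bounded total mass. -/
noncomputable def scaledWeight (α σ : ℝ) (t : ℕ → ℝ) (n : ℕ) : StateAdjointIndex n → ℝ :=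
  fun j => ((n : ℝ) + 1) ^ (α - 1) * stateAdjointWeight α σ t n j

lemma scaledWeight_pos (h : LogConcaveMesh T n t) (hσ : 0 < σ) (j : StateAdjointIndex n) :
    0 < scaledWeight α σ t n j :=
  mul_pos (by positivity) (h.stateAdjointWeight_pos hσ j)

lemma scaledWeight_coercive (h : LogConcaveMesh T n t) (hα₀ : 0 < α) (hα₁ : α < 1) (hσ : 0 < σ)
    (v : StateAdjointIndex n → ℝ) :
    0 ≤ ∑ j, scaledWeight α σ t n j * v j * (coupledMatrix α σ t n *ᵥ v) j := by
  have h1 := h.coupled_coercive hα₀ hα₁ hσ v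
  have h2 : 0 ≤ l1Floor α T / 2 * ∑ j, stateAdjointWeight α σ t n j * v j ^ 2 :=
    mul_nonneg (half_pos (l1Floor_pos hα₁ h.pos)).le (Finset.sum_nonneg fun j _ =>
      mul_nonneg (h.stateAdjointWeight_pos hσ j).le (sq_nonneg _))
  have h3 : ∑ j, scaledWeight α σ t n j * v j * (coupledMatrix α σ t n *ᵥ v) j =
      ((n : ℝ) + 1) ^ (α - 1) *
        ∑ j, stateAdjointWeight α σ t n j * v j * (coupledMatrix α σ t n *ᵥ v) j := by
    rw [Finset.mul_sum]
    exact Finset.sum_congr rfl fun j _ => by rw [scaledWeight]; ring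
  rw [h3]
  exact mul_nonneg (by positivity) (h2.trans h1)

lemma norm_sq_scaled (h : LogConcaveMesh T n t) (hσ : 0 < σ) (v : StateAdjointIndex n → ℝ) :
    ‖weightedEmbed (scaledWeight α σ t n) v‖ ^ 2 =
      (∑ i : Fin (n + 1), ((n : ℝ) + 1) ^ (α - 1) * energyWeight α t n i * v (Sum.inl i) ^ 2) +
      σ⁻¹ * ∑ i : Fin (n + 1),
        ((n : ℝ) + 1) ^ (α - 1) * energyWeight α t n i * v (Sum.inr i) ^ 2 := by
  rw [norm_sq_weightedEmbed fun j => (h.scaledWeight_pos hσ j).le, Fintype.sum_sum_type,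
    Finset.mul_sum]
  congr 1
  refine Finset.sum_congr rfl fun i _ => ?_
  simp only [scaledWeight, stateAdjointWeight, Sum.elim_inr]
  ring

/-- The steps are dominated by the scaled weights, whose total mass is at most `C ^ 2`;
Cauchy–Schwarz then passes from the weighted sum of moduli to the weighted norm. -/
lemma stepSum_le (h : LogConcaveMesh T n t) (hα₀ : 0 < α) (hα₁ : α < 1) (hC1 : 1 ≤ C)
    (hstep : ∀ k ≤ n, t (k + 1) - t k ≤ C / (n + 1)) (hC : t 2 - t 1 ≤ C * (t 1 - t 0))
    {v : Fin (n + 1) → ℝ} {K : ℝ} (hK : 0 ≤ K)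
    (hv : ∑ i : Fin (n + 1), ((n : ℝ) + 1) ^ (α - 1) * energyWeight α t n i * v i ^ 2 ≤ K ^ 2) :
    stepSum t n v ≤ 2 * C ^ 3 * K := by
  set w : Fin (n + 1) → ℝ := fun i => ((n : ℝ) + 1) ^ (α - 1) * energyWeight α t n i with hw
  have hw0 : ∀ i, 0 ≤ w i := fun i =>
    mul_nonneg (by positivity) (h.energyWeight_pos (by omega)).le
  have hsum : ∑ i, w i ≤ C ^ 2 := by
    refine (Finset.sum_le_sum fun i _ =>
      h.energyWeight_le hα₀ hα₁ hC1 hstep hC (Nat.le_of_lt_succ i.2)).trans ?_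
    rw [Finset.sum_const, Finset.card_univ, Fintype.card_fin, nsmul_eq_mul]
    push_cast
    rw [mul_div_cancel₀ _ (by positivity)]
  have h1 : stepSum t n v ≤ 2 * C ^ 2 * ∑ i, w i * |v i| := by
    rw [stepSum, Finset.mul_sum]
    refine Finset.sum_le_sum fun i _ => ?_
    split_ifs with hi
    · rw [← mul_assoc]
      exact mul_le_mul_of_nonneg_right (h.step_le_energyWeight hα₀ hα₁ hC1 hstep hC hi)
        (abs_nonneg _)
    · exact mul_nonneg (by positivity) (mul_nonneg (hw0 i) (abs_nonneg _))
  have h2 : (∑ i, w i * |v i|) ^ 2 ≤ (C * K) ^ 2 := by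
    have hcs := Finset.sum_mul_sq_le_sq_mul_sq Finset.univ (fun i => √(w i))
      (fun i => √(w i) * |v i|)
    have e1 : ∀ i, √(w i) * (√(w i) * |v i|) = w i * |v i| := fun i => by
      rw [← mul_assoc, Real.mul_self_sqrt (hw0 i)]
    have e2 : ∀ i, (√(w i) * |v i|) ^ 2 = w i * v i ^ 2 := fun i => by
      rw [mul_pow, Real.sq_sqrt (hw0 i), sq_abs]
    simp only [e1, e2, Real.sq_sqrt (hw0 _)] at hcs
    refine hcs.trans ?_
    rw [mul_pow]
    exact mul_le_mul hsum hv (Finset.sum_nonneg fun i _ => mul_nonneg (hw0 i) (sq_nonneg _))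
      (by positivity)
  have h3 := abs_le_of_sq_le_sq h2 (by positivity)
  calc _ ≤ 2 * C ^ 2 * (C * K) := h1.trans (by gcongr; exact (abs_le.1 h3).2)
    _ = _ := by ring

/-- The step sums of both blocks are controlled by the weighted norm. -/
lemma stepSum_blocks_le (h : LogConcaveMesh T n t) (hα₀ : 0 < α) (hα₁ : α < 1) (hσ : 0 < σ)
    (hC1 : 1 ≤ C) (hstep : ∀ k ≤ n, t (k + 1) - t k ≤ C / (n + 1))
    (hC : t 2 - t 1 ≤ C * (t 1 - t 0)) {v : StateAdjointIndex n → ℝ} {K : ℝ}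
    (hv : ‖weightedEmbed (scaledWeight α σ t n) v‖ ≤ K) :
    stepSum t n (v ∘ Sum.inl) ≤ 2 * C ^ 3 * ((1 + σ) * K) ∧
      stepSum t n (v ∘ Sum.inr) ≤ 2 * C ^ 3 * ((1 + σ) * K) := by
  have hK : 0 ≤ K := (norm_nonneg _).trans hv
  have hsq := pow_le_pow_left₀ (norm_nonneg _) hv 2
  rw [h.norm_sq_scaled hσ] at hsq
  have hpos : ∀ u : Fin (n + 1) → ℝ,
      0 ≤ ∑ i : Fin (n + 1), ((n : ℝ) + 1) ^ (α - 1) * energyWeight α t n i * u i ^ 2 := fun u =>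
    Finset.sum_nonneg fun i _ => mul_nonneg (mul_nonneg (by positivity)
      (h.energyWeight_pos (by omega)).le) (sq_nonneg _)
  have h1 := hpos (v ∘ Sum.inl)
  have h2 := hpos (v ∘ Sum.inr)
  simp only [Function.comp_apply] at h1 h2
  refine ⟨h.stepSum_le hα₀ hα₁ hC1 hstep hC (by positivity) ?_,
    h.stepSum_le hα₀ hα₁ hC1 hstep hC (by positivity) ?_⟩
  · simp only [Function.comp_apply]
    have : 0 ≤ σ⁻¹ * ∑ i : Fin (n + 1),
      ((n : ℝ) + 1) ^ (α - 1) * energyWeight α t n i * v (Sum.inr i) ^ 2 :=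
        mul_nonneg (inv_pos.2 hσ).le h2
    have : K ^ 2 ≤ ((1 + σ) * K) ^ 2 :=
      pow_le_pow_left₀ hK (le_mul_of_one_le_left hK (by linarith)) 2
    linarith
  · simp only [Function.comp_apply]
    have h3 : σ⁻¹ * ∑ i : Fin (n + 1),
      ((n : ℝ) + 1) ^ (α - 1) * energyWeight α t n i * v (Sum.inr i) ^ 2 ≤ K ^ 2 := by linarith
    rw [inv_mul_le_iff₀ hσ] at h3
    refine h3.trans ?_
    rw [mul_pow]
    exact mul_le_mul_of_nonneg_right (by nlinarith) (sq_nonneg _)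

/-- A vector that is bounded, and small except for the first components of each block, is small
in the weighted norm. -/
lemma weighted_norm_sq_le (h : LogConcaveMesh T n t) (hα₀ : 0 < α) (hα₁ : α < 1) (hσ : 0 < σ)
    (hC1 : 1 ≤ C) (hstep : ∀ k ≤ n, t (k + 1) - t k ≤ C / (n + 1))
    (hC : t 2 - t 1 ≤ C * (t 1 - t 0)) {R : StateAdjointIndex n → ℝ} {M ε θ : ℝ} (hθ : 0 ≤ θ)
    (hM : ∀ j, |R j| ≤ M) (hε : ∀ i : Fin (n + 1), θ * ((n : ℝ) + 1) ≤ (i : ℕ) + 1 →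
      |R (Sum.inl i)| ≤ ε ∧ |R (Sum.inr i)| ≤ ε) :
    ‖weightedEmbed (scaledWeight α σ t n) R‖ ^ 2 ≤
      (1 + σ⁻¹) * (C ^ 2 * (ε ^ 2 + θ * M ^ 2)) := by
  have hn1 : (0 : ℝ) < n + 1 := by positivity
  have hblock : ∀ r : Fin (n + 1) → ℝ, (∀ i, |r i| ≤ M) →
      (∀ i : Fin (n + 1), θ * ((n : ℝ) + 1) ≤ (i : ℕ) + 1 → |r i| ≤ ε) →
      ∑ i : Fin (n + 1), ((n : ℝ) + 1) ^ (α - 1) * energyWeight α t n i * r i ^ 2 ≤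
        C ^ 2 * (ε ^ 2 + θ * M ^ 2) := by
    intro r hrM hrε
    -- At most `θ * (n + 1)` components are exceptional, each of weight at most `C ^ 2 / (n + 1)`.
    set B : Finset (Fin (n + 1)) :=
      Finset.univ.filter fun i => ((i : ℕ) : ℝ) + 1 < θ * ((n : ℝ) + 1) with hB
    have hcard : (B.card : ℝ) ≤ θ * ((n : ℝ) + 1) := by
      have : B.card ≤ (Finset.range ⌊θ * ((n : ℝ) + 1)⌋₊).card := by
        refine Finset.card_le_card_of_injOn (fun i => (i : ℕ)) (fun i hi => ?_)
          (fun i _ k _ e => Fin.ext e)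
        simp only [hB, Finset.coe_filter, Finset.mem_univ, true_and, Set.mem_ofPred_eq] at hi
        simp only [Finset.coe_range, mem_Iio]
        exact Nat.le_floor (by push_cast; exact hi.le)
      rw [Finset.card_range] at this
      exact (Nat.cast_le.2 this).trans (Nat.floor_le (by positivity))
    have hterm : ∀ i : Fin (n + 1),
        ((n : ℝ) + 1) ^ (α - 1) * energyWeight α t n i * r i ^ 2 ≤
          C ^ 2 / (n + 1) * (ε ^ 2 + if i ∈ B then M ^ 2 else 0) := by
      intro i
      refine mul_le_mul (h.energyWeight_le hα₀ hα₁ hC1 hstep hC (by omega)) ?_ (sq_nonneg _)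
        (by positivity)
      split_ifs with hi
      · have := pow_le_pow_left₀ (abs_nonneg _) (hrM i) 2
        rw [sq_abs] at this
        linarith [sq_nonneg ε]
      · have := pow_le_pow_left₀ (abs_nonneg _) (hrε i (by simpa [hB] using hi)) 2
        rw [sq_abs] at this
        linarith
    refine (Finset.sum_le_sum fun i _ => hterm i).trans ?_
    rw [← Finset.mul_sum, Finset.sum_add_distrib, Finset.sum_const, Finset.card_univ,
      Fintype.card_fin, Finset.sum_ite_mem, Finset.univ_inter, Finset.sum_const, nsmul_eq_mul,
      nsmul_eq_mul, div_mul_eq_mul_div, div_le_iff₀ hn1]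
    push_cast
    have := mul_le_mul_of_nonneg_right hcard (sq_nonneg M)
    have := mul_le_mul_of_nonneg_left this (sq_nonneg C)
    nlinarith
  rw [h.norm_sq_scaled hσ, one_add_mul]
  exact add_le_add (hblock _ (fun i => hM _) fun i hi => (hε i hi).1)
    (mul_le_mul_of_nonneg_left (hblock _ (fun i => hM _) fun i hi => (hε i hi).2)
      (inv_pos.2 hσ).le)

end LogConcaveMesh

open LogConcaveMesh

/-- The truncation errors of a consistent pair tend to zero in the weighted norm. -/
lemma L1Consistent.weighted_small {α T σ a b : ℝ} {mesh : TimeMesh} {y p : ℝ → ℝ → ℝ}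
    (hc : L1Consistent α T a b mesh y p) (hα₀ : 0 < α) (hα₁ : α < 1) (hT : 0 < T) (hσ : 0 < σ)
    {ρ : ℝ} (hρ : 0 < ρ) : ∃ n₀ : ℕ, ∀ n ≥ n₀, mesh.Admissible n → ∀ x ∈ Icc a b,
      ‖weightedEmbed (scaledWeight α σ (mesh.node α T n) n)
        (l1Truncation α T (mesh.node α T n) n (y x) (p x))‖ ≤ ρ := by
  obtain ⟨⟨M, hM⟩, hsmall⟩ := hc
  obtain ⟨C, hC1, hC⟩ := TimeMesh.exists_step_bound mesh hα₀ hα₁ hT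
  have hσ' := inv_pos.2 hσ
  set q := (1 + σ⁻¹) * C ^ 2 with hq
  have hq0 : 0 < q := by positivity
  -- `θ` and the tolerance `√(ρ ^ 2 / (2 * q))` make the exceptional and the regular components
  -- contribute at most `ρ ^ 2 / 2` each; `M ^ 2 + 1` avoids division by zero.
  obtain ⟨δ, hδ, hnode⟩ := TimeMesh.exists_node_lower_bound mesh hα₀ hα₁ hT
    (θ := ρ ^ 2 / (2 * q * (M ^ 2 + 1))) (by positivity)
  obtain ⟨n₀, hn₀⟩ := hsmall δ hδ (√(ρ ^ 2 / (2 * q))) (by positivity)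
  refine ⟨n₀, fun n hn ha x hx => ?_⟩
  have hmesh := TimeMesh.logConcaveMesh mesh hα₀ hα₁ hT ha
  have hb := hmesh.weighted_norm_sq_le hα₀ hα₁ hσ hC1 (hC n ha).1 (hC n ha).2
    (θ := ρ ^ 2 / (2 * q * (M ^ 2 + 1))) (by positivity) (hM n ha x hx) (fun i hi =>
      hn₀ n hn ha x hx i (hnode n ha _ (by omega) (by exact_mod_cast hi)))
  refine abs_le_of_sq_le_sq' (hb.trans ?_) hρ.le |>.2
  rw [Real.sq_sqrt (by positivity), ← mul_assoc, ← hq]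
  have e : q * (ρ ^ 2 / (2 * q) + ρ ^ 2 / (2 * q * (M ^ 2 + 1)) * M ^ 2) =
      ρ ^ 2 / 2 * (1 + M ^ 2 / (M ^ 2 + 1)) := by field_simp
  rw [e]
  have : M ^ 2 / (M ^ 2 + 1) ≤ 1 := by rw [div_le_one (by positivity)]; linarith
  nlinarith [sq_nonneg ρ]

/-- The widths of the cutoffs can be chosen to give any prescribed local rate, with a small
commutator. -/
lemma exists_cutoff_parameters {α Λ : ℝ} (hα₁ : α < 1) (hα₀ : 0 < α) (hΛ : 0 < Λ) :
    ∃ δ η s : ℝ, 0 < δ ∧ 0 < η ∧ 0 < s ∧ localRate α δ = Λ ∧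
      ∀ M, 0 ≤ M → 0 ≤ commutatorBound α δ η M s ∧ commutatorBound α δ η M s ≤ Λ / 4 * M + 1 := by
  have hg := inv_gamma_two_sub_pos hα₁
  have h1 : 0 < 1 - α := by linarith
  set g := (Real.Gamma (2 - α))⁻¹ with hgdef
  -- `δ` solves `localRate α δ = Λ`. Then `η` makes the near part of the commutator equal to `Λ / 4
  -- * M`, and `s = c⁻¹` makes the far part equal to `1`.
  set z := Λ / (g * (1 - α)) with hz
  have hz0 : 0 < z := by positivity
  set δ := z ^ (-α⁻¹) / 2 with hδ
  have hδ0 : 0 < δ := by positivity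
  set η := (Λ * δ / (4 * g)) ^ (1 - α)⁻¹ with hη
  have hη0 : 0 < η := by positivity
  have hηpow : η ^ (1 - α) = Λ * δ / (4 * g) := by
    rw [hη, ← Real.rpow_mul (by positivity), inv_mul_cancel₀ h1.ne', Real.rpow_one]
  set c := g * ((1 - α) * (η / 2) ^ (-α - 1)) with hc
  have hc0 : 0 < c := by positivity
  refine ⟨δ, η, c⁻¹, hδ0, hη0, inv_pos.2 hc0, ?_, fun M hM => ?_⟩
  · have : (2 * δ) ^ (-α) = z := by
      rw [hδ, mul_div_cancel₀ _ two_ne_zero, ← Real.rpow_mul hz0.le, neg_mul_neg,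
        inv_mul_cancel₀ hα₀.ne', Real.rpow_one]
    rw [localRate, this, ← hgdef, hz]
    field_simp
  · have e : commutatorBound α δ η M c⁻¹ = Λ / 4 * M + 1 := by
      rw [commutatorBound, ← hgdef, ← hc, mul_inv_cancel₀ hc0.ne', hηpow]
      field_simp
    rw [e]
    exact ⟨by positivity, le_rfl⟩

/-! ### Convergence and the theorem. -/

open LogConcaveMesh

lemma derivWithin_sub_pi {ι : Type} [Fintype ι] {a b x : ℝ} (hab : a < b) (hx : x ∈ Icc a b)
    {X N : ℝ → ι → ℝ} (hX : TwiceDifferentiable a b X) (hN : TwiceDifferentiable a b N) :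
    HasDerivWithinAt (fun x => X x - N x)
      (derivWithin X (Icc a b) x - fun j => derivWithin (fun x => N x j) (Icc a b) x)
      (Icc a b) x := by
  have hu : UniqueDiffWithinAt ℝ (Icc a b) x := uniqueDiffOn_Icc hab x hx
  have h2 := (hN.1 x hx).hasDerivWithinAt
  have e : derivWithin N (Icc a b) x = fun j => derivWithin (fun x => N x j) (Icc a b) x :=
    funext fun j => ((hasDerivWithinAt_pi.1 h2 j).derivWithin hu).symm
  rw [← e]
  exact (hX.1 x hx).hasDerivWithinAt.sub h2

/-- The equation of the difference of a semi-discrete solution and the nodal values. -/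
lemma LogConcaveMesh.difference_equation {T α σ κ a b : ℝ} {n : ℕ} {t : ℕ → ℝ}
    (h : LogConcaveMesh T n t) {y p : ℝ → ℝ → ℝ} (hs : SolvesStateAdjoint α T σ κ a b y p)
    {X : ℝ → StateAdjointIndex n → ℝ} (hX : TwiceDifferentiable a b X)
    (heq : ∀ x ∈ Ioo a b, coupledMatrix α σ t n *ᵥ X x = κ • deriv (deriv X) x) :
    ∃ E' E'' : ℝ → StateAdjointIndex n → ℝ,
      (∀ x ∈ Ioo a b, HasDerivAt (fun x => X x - nodalVector t n (y x) (p x)) (E' x) x) ∧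
      (∀ x ∈ Ioo a b, HasDerivAt E' (E'' x) x) ∧
      ∀ x ∈ Ioo a b, κ • E'' x =
        coupledMatrix α σ t n *ᵥ (X x - nodalVector t n (y x) (p x)) +
          l1Truncation α T t n (y x) (p x) := by
  obtain ⟨hN, he⟩ := h.nodal_equation hs
  refine ⟨_, _, fun x hx => (hX.hasDerivAt hx).sub (hN.hasDerivAt hx),
    fun x hx => (hX.hasDerivAt_deriv hx).sub (hN.hasDerivAt_deriv hx), fun x hx => ?_⟩
  rw [smul_sub, ← heq x hx, he x hx, Matrix.mulVec_sub]
  abel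

/-- The error solves the semi-discrete equation with the truncation error as residual. Its weighted
norm is bounded first, on the left, through the flux, and on the right. This bounds the step sums by
`s`, after which the maximum norm bounds follow the same route with `M₀` in place of `ρ`. -/
lemma IsErrorSolution.error_bound {T α σ κ₁ κ₂ ℓ₁ ℓ₂ : ℝ} {n : ℕ} {t : ℕ → ℝ} {C δ η s ρ M₀ : ℝ}
    {ω υ : ℝ → ℝ} {y₁ p₁ y₂ p₂ : ℝ → ℝ → ℝ}
    (hsol : IsErrorSolution α T σ κ₁ κ₂ ℓ₁ ℓ₂ ω υ y₁ p₁ y₂ p₂) (h : LogConcaveMesh T n t)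
    (hα₀ : 0 < α) (hα₁ : α < 1) (hσ : 0 < σ) (hκ₁ : 0 < κ₁) (hκ₂ : 0 < κ₂) (hℓ₁ : 0 < ℓ₁)
    (hℓ₂ : 0 < ℓ₂) (hC1 : 1 ≤ C) (hstep : ∀ k ≤ n, t (k + 1) - t k ≤ C / (n + 1))
    (hC : t 2 - t 1 ≤ C * (t 1 - t 0)) (hδ : 0 < δ) (hη : 0 < η)
    (hstepδ : ∀ k ≤ n, t (k + 1) - t k ≤ δ) (hstepη : ∀ k ≤ n, t (k + 1) - t k ≤ η / 2)
    (hM₀ : 0 ≤ M₀) (hρ : 0 ≤ ρ)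
    (hcom : ∀ M, 0 ≤ M → 0 ≤ commutatorBound α δ η M s ∧
      commutatorBound α δ η M s ≤ localRate α δ / 4 * M + 1)
    (hrate : 1 + σ⁻¹ ≤ localRate α δ / 4)
    (hs : 2 * C ^ 3 * ((1 + σ) * (ρ * (ℓ₁ / (2 * κ₁) * ℓ₁ +
      κ₁ / κ₂ * (ℓ₁ / (2 * κ₁)) * ℓ₂ + ℓ₂ ^ 2 / (2 * κ₂)))) ≤ s)
    (hM₁ : ∀ x ∈ Icc (-ℓ₁) 0, ∀ j, |l1Truncation α T t n (y₁ x) (p₁ x) j| ≤ M₀)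
    (hM₂ : ∀ x ∈ Icc 0 ℓ₂, ∀ j, |l1Truncation α T t n (y₂ x) (p₂ x) j| ≤ M₀)
    (hρ₁ : ∀ x ∈ Icc (-ℓ₁) 0, ‖weightedEmbed (scaledWeight α σ t n)
      (l1Truncation α T t n (y₁ x) (p₁ x))‖ ≤ ρ)
    (hρ₂ : ∀ x ∈ Icc 0 ℓ₂, ‖weightedEmbed (scaledWeight α σ t n)
      (l1Truncation α T t n (y₂ x) (p₂ x))‖ ≤ ρ)
    {X₁ X₂ : ℝ → StateAdjointIndex n → ℝ}
    (hX : IsSemiDiscreteSolution (coupledMatrix α σ t n) κ₁ κ₂ ℓ₁ ℓ₂ (nodalVector t n ω υ) X₁ X₂) :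
    (∀ x ∈ Icc (-ℓ₁) 0, ∀ j, |X₁ x j - nodalVector t n (y₁ x) (p₁ x) j| ≤
      2 * (M₀ + 1) / localRate α δ) ∧
    ∀ x ∈ Icc 0 ℓ₂, ∀ j, |X₂ x j - nodalVector t n (y₂ x) (p₂ x) j| ≤
      2 * (M₀ + 1) / localRate α δ * (1 + 2 * (κ₁ / κ₂) / √(κ₁ / κ₂)) := by
  have hW : ∀ j, 0 ≤ scaledWeight α σ t n j := fun j => (h.scaledWeight_pos hσ j).le
  have hA := h.scaledWeight_coercive hα₀ hα₁ hσ
  have hnode : ∀ j ≤ n + 1, t j ∈ Icc 0 T := fun j hj => ⟨h.nonneg hj, h.le_last hj⟩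
  set Φ := weightedEmbed (scaledWeight α σ t n) with hΦ
  set E₁ : ℝ → StateAdjointIndex n → ℝ := fun x => X₁ x - nodalVector t n (y₁ x) (p₁ x) with hE₁
  set E₂ : ℝ → StateAdjointIndex n → ℝ := fun x => X₂ x - nodalVector t n (y₂ x) (p₂ x) with hE₂
  have hN₁ := (h.nodal_equation hsol.left).1
  have hN₂ := (h.nodal_equation hsol.right).1
  obtain ⟨E₁', E₁'', d1, d1', eq1⟩ :=
    h.difference_equation hsol.left hX.left_space hX.left_eq
  obtain ⟨E₂', E₂'', d2, d2', eq2⟩ :=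
    h.difference_equation hsol.right hX.right_space hX.right_eq
  have hc1 : ContinuousOn E₁ (Icc (-ℓ₁) 0) :=
    hX.left_space.1.continuousOn.sub hN₁.1.continuousOn
  have hc2 : ContinuousOn E₂ (Icc 0 ℓ₂) := hX.right_space.1.continuousOn.sub hN₂.1.continuousOn
  have b1l : E₁ (-ℓ₁) = 0 := by
    funext j
    simp only [hE₁, hX.left_outer]
    rcases j with i | i
    · simp [nodalVector, hsol.state_left_outer _ (hnode (i + 1) (by omega))]
    · simp [nodalVector, hsol.adjoint_left_outer _ (hnode (n - i) (by omega))]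
  have b1r : E₁ 0 = 0 := by
    funext j
    simp only [hE₁, hX.interface]
    rcases j with i | i
    · simp [nodalVector, hsol.state_interface _ (hnode (i + 1) (by omega))]
    · simp [nodalVector, hsol.adjoint_interface _ (hnode (n - i) (by omega))]
  have b2r : E₂ ℓ₂ = 0 := by
    funext j
    simp only [hE₂, hX.right_outer]
    rcases j with i | i
    · simp [nodalVector, hsol.state_right_outer _ (hnode (i + 1) (by omega))]
    · simp [nodalVector, hsol.adjoint_right_outer _ (hnode (n - i) (by omega))]
  have D1 := derivWithin_sub_pi (by linarith) (right_mem_Icc.2 (by linarith : -ℓ₁ ≤ 0))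
    hX.left_space hN₁
  have D2 := derivWithin_sub_pi hℓ₂ (left_mem_Icc.2 hℓ₂.le) hX.right_space hN₂
  set g₁ := derivWithin X₁ (Icc (-ℓ₁) 0) 0 -
    fun j => derivWithin (fun x => nodalVector t n (y₁ x) (p₁ x) j) (Icc (-ℓ₁) 0) 0 with hg₁
  set g₂ := derivWithin X₂ (Icc 0 ℓ₂) 0 -
    fun j => derivWithin (fun x => nodalVector t n (y₂ x) (p₂ x) j) (Icc 0 ℓ₂) 0 with hg₂
  have hflux : g₂ = (κ₁ / κ₂) • g₁ := by
    funext j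
    have f1 := congrFun hX.flux j
    simp only [Pi.smul_apply, smul_eq_mul] at f1
    have f2 : κ₂ * derivWithin (fun x => nodalVector t n (y₂ x) (p₂ x) j) (Icc 0 ℓ₂) 0 =
        κ₁ * derivWithin (fun x => nodalVector t n (y₁ x) (p₁ x) j) (Icc (-ℓ₁) 0) 0 := by
      rcases j with i | i
      · exact hsol.state_flux _ ⟨by rw [← h.zero]; exact h.lt (by omega) (by omega),
          h.le_last (by omega)⟩
      · exact hsol.adjoint_flux _ ⟨h.nonneg (by omega),
          by rw [← h.last]; exact h.lt (by omega) (by omega)⟩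
    simp only [hg₁, hg₂, Pi.smul_apply, Pi.sub_apply, smul_eq_mul]
    field_simp
    linear_combination f1 - f2
  -- smallness in the weighted norm
  have w1 : ∀ x ∈ Icc (-ℓ₁) 0, ‖Φ (E₁ x)‖ ≤ ρ * ℓ₁ / (2 * κ₁) * (-x) := fun x hx =>
    weighted_dirichlet_bound hW hA hℓ₁ hκ₁ hρ hc1 d1 d1' eq1
      (fun x hx => hρ₁ x (Ioo_subset_Icc_self hx)) b1l b1r hx
  have wg1 : ‖Φ g₁‖ ≤ ρ * ℓ₁ / (2 * κ₁) :=
    norm_deriv_le_of_linear_bound hℓ₁ (F := fun x => Φ (E₁ x))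
      (Φ.hasFDerivAt.comp_hasDerivWithinAt (0 : ℝ) D1) (by simp [b1r]) w1
  have wg2 : ‖Φ g₂‖ ≤ κ₁ / κ₂ * (ρ * ℓ₁ / (2 * κ₁)) := by
    rw [hflux, map_smul, norm_smul, Real.norm_of_nonneg (by positivity)]
    gcongr
  have w2 : ∀ x ∈ Icc 0 ℓ₂,
      ‖Φ (E₂ x)‖ ≤ κ₁ / κ₂ * (ρ * ℓ₁ / (2 * κ₁)) * ℓ₂ + ρ * ℓ₂ ^ 2 / (2 * κ₂) := fun x hx =>
    weighted_neumann_bound hW hA hℓ₂ hκ₂ hρ hc2 d2 d2' eq2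
      (fun x hx => hρ₂ x (Ioo_subset_Icc_self hx)) D2 wg2 b2r hx
  have k1 : ∀ x ∈ Icc (-ℓ₁) 0, ‖Φ (E₁ x)‖ ≤ ρ * (ℓ₁ / (2 * κ₁) * ℓ₁ +
      κ₁ / κ₂ * (ℓ₁ / (2 * κ₁)) * ℓ₂ + ℓ₂ ^ 2 / (2 * κ₂)) := fun x hx => by
    have q1 : 0 ≤ ρ * ℓ₁ / (2 * κ₁) := by positivity
    have q2 : 0 ≤ ρ * (κ₁ / κ₂ * (ℓ₁ / (2 * κ₁)) * ℓ₂ + ℓ₂ ^ 2 / (2 * κ₂)) := by positivity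
    have q3 := mul_le_mul_of_nonneg_left (by linarith [hx.1] : -x ≤ ℓ₁) q1
    calc _ ≤ _ := (w1 x hx).trans q3
      _ = ρ * (ℓ₁ / (2 * κ₁) * ℓ₁) := by ring
      _ ≤ _ := by linarith
  have k2 : ∀ x ∈ Icc 0 ℓ₂, ‖Φ (E₂ x)‖ ≤ ρ * (ℓ₁ / (2 * κ₁) * ℓ₁ +
      κ₁ / κ₂ * (ℓ₁ / (2 * κ₁)) * ℓ₂ + ℓ₂ ^ 2 / (2 * κ₂)) := fun x hx => by
    have q1 : 0 ≤ ρ * (ℓ₁ / (2 * κ₁) * ℓ₁) := by positivity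
    calc _ ≤ _ := w2 x hx
      _ = ρ * (κ₁ / κ₂ * (ℓ₁ / (2 * κ₁)) * ℓ₂ + ℓ₂ ^ 2 / (2 * κ₂)) := by ring
      _ ≤ _ := by linarith
  have s1 := fun x (hx : x ∈ Ioo (-ℓ₁) 0) =>
    h.stepSum_blocks_le hα₀ hα₁ hσ hC1 hstep hC (k1 x (Ioo_subset_Icc_self hx))
  have s2 := fun x (hx : x ∈ Ioo 0 ℓ₂) =>
    h.stepSum_blocks_le hα₀ hα₁ hσ hC1 hstep hC (k2 x (Ioo_subset_Icc_self hx))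
  -- maximum norm bounds
  have m1 := fun x (hx : x ∈ Icc (-ℓ₁) 0) => h.coupled_sup_dirichlet hα₀ hα₁ hσ hδ hη hstepδ hstepη
    hκ₁ hℓ₁ hM₀ (fun M hM => (hcom M hM).1) (fun M hM => (hcom M hM).2) hrate hc1 d1 d1' eq1
    (fun x hx => hM₁ x (Ioo_subset_Icc_self hx)) (fun x hx => (s1 x hx).1.trans hs)
    (fun x hx => (s1 x hx).2.trans hs) b1l b1r hx
  have hΛ : 0 < localRate α δ := localRate_pos hα₁ hδ
  have mg1 : ∀ j, |g₁ j| ≤ 2 * (M₀ + 1) / √(κ₁ * localRate α δ) := fun j =>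
    norm_deriv_le_of_linear_bound hℓ₁ (F := fun x => E₁ x j) (hasDerivWithinAt_pi.1 D1 j)
      (by simp [b1r]) fun x hx => (m1 x hx j).2
  have mg2 : ∀ j, |g₂ j| ≤ κ₁ / κ₂ * (2 * (M₀ + 1) / √(κ₁ * localRate α δ)) := fun j => by
    rw [hflux, Pi.smul_apply, smul_eq_mul, abs_mul, abs_of_nonneg (by positivity)]
    gcongr
    exact mg1 j
  refine ⟨fun x hx j => (m1 x hx j).1, fun x hx j => ?_⟩
  have m2 := h.coupled_sup_neumann hα₀ hα₁ hσ hδ hη hstepδ hstepη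
    hκ₂ hℓ₂ hM₀ (fun M hM => (hcom M hM).1) (fun M hM => (hcom M hM).2) hrate hc2 d2 d2' eq2
    (fun x hx => hM₂ x (Ioo_subset_Icc_self hx)) (fun x hx => (s2 x hx).1.trans hs)
    (fun x hx => (s2 x hx).2.trans hs) D2 mg2 b2r hx j
  refine m2.trans (le_of_eq ?_)
  -- The left flux and the response of the right problem to a flux each decay like the local rate to
  -- the power `-1 / 2`; together they give a full power, as for the residual.
  have e : √(κ₁ * localRate α δ) * √(localRate α δ / κ₂) = √(κ₁ / κ₂) * localRate α δ := by
    rw [← Real.sqrt_mul (by positivity),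
      show κ₁ * localRate α δ * (localRate α δ / κ₂) = κ₁ / κ₂ * localRate α δ ^ 2 by ring,
      Real.sqrt_mul (by positivity), Real.sqrt_sq hΛ.le]
  rw [mul_div_assoc (κ₁ / κ₂), div_div, e]
  have : 0 < √(κ₁ / κ₂) := by positivity
  field_simp

/-- Convergence of the semi-discrete solutions to the nodal values of the continuous solution. -/
lemma IsErrorSolution.converges {T α σ κ₁ κ₂ ℓ₁ ℓ₂ : ℝ} {ω υ : ℝ → ℝ} {y₁ p₁ y₂ p₂ : ℝ → ℝ → ℝ}
    (hsol : IsErrorSolution α T σ κ₁ κ₂ ℓ₁ ℓ₂ ω υ y₁ p₁ y₂ p₂) (mesh : TimeMesh)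
    (hα₀ : 0 < α) (hα₁ : α < 1) (hT : 0 < T) (hσ : 0 < σ) (hκ₁ : 0 < κ₁) (hκ₂ : 0 < κ₂)
    (hℓ₁ : 0 < ℓ₁) (hℓ₂ : 0 < ℓ₂) {ε : ℝ} (hε : 0 < ε) :
    ∃ n₀ : ℕ, ∀ n ≥ n₀, mesh.Admissible n → ∀ X₁ X₂ : ℝ → StateAdjointIndex n → ℝ,
      IsSemiDiscreteSolution (coupledMatrix α σ (mesh.node α T n) n) κ₁ κ₂ ℓ₁ ℓ₂
        (nodalVector (mesh.node α T n) n ω υ) X₁ X₂ →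
      (∀ x ∈ Icc (-ℓ₁) 0, ∀ j,
        |X₁ x j - nodalVector (mesh.node α T n) n (y₁ x) (p₁ x) j| ≤ ε) ∧
      ∀ x ∈ Icc 0 ℓ₂, ∀ j,
        |X₂ x j - nodalVector (mesh.node α T n) n (y₂ x) (p₂ x) j| ≤ ε := by
  have hc₁ := hsol.left.l1Consistent mesh hα₀ hα₁ hT
  have hc₂ := hsol.right.l1Consistent mesh hα₀ hα₁ hT
  obtain ⟨C, hC1, hC⟩ := TimeMesh.exists_step_bound mesh hα₀ hα₁ hT
  obtain ⟨M₁, hM₁⟩ := hc₁.1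
  obtain ⟨M₂, hM₂⟩ := hc₂.1
  set M₀ := max 0 (max M₁ M₂) with hM₀def
  have hM₀ : 0 ≤ M₀ := le_max_left _ _
  have hM₁₀ : M₁ ≤ M₀ := (le_max_left _ _).trans (le_max_right _ _)
  have hM₂₀ : M₂ ≤ M₀ := (le_max_right _ _).trans (le_max_right _ _)
  have hσ' := inv_pos.2 hσ
  set D := 1 + 2 * (κ₁ / κ₂) / √(κ₁ / κ₂) with hD
  have hD1 : 1 ≤ D := le_add_of_nonneg_right (by positivity)
  -- The first entry lets the rate absorb the coupling; the second makes the final bound at most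
  -- `ε`. The rate depends on `ε` and `M₀` but not on the mesh, so the cutoff is fixed before `n` is
  -- taken large.
  set Λ := max (4 * (1 + σ⁻¹)) (2 * (M₀ + 1) * D / ε) with hΛdef
  have hΛ₁ : 4 * (1 + σ⁻¹) ≤ Λ := le_max_left _ _
  have hΛ₂ : 2 * (M₀ + 1) * D / ε ≤ Λ := le_max_right _ _
  have hΛ : 0 < Λ := lt_of_lt_of_le (by positivity) hΛ₁
  obtain ⟨δ, η, s, hδ, hη, hs, hrate, hcom⟩ := exists_cutoff_parameters hα₁ hα₀ hΛ
  set B := ℓ₁ / (2 * κ₁) * ℓ₁ + κ₁ / κ₂ * (ℓ₁ / (2 * κ₁)) * ℓ₂ + ℓ₂ ^ 2 / (2 * κ₂) with hB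
  have hB0 : 0 < B := by positivity
  have hC0 : 0 < C := by linarith
  -- The weighted size of the truncation error that keeps the step sums of the error below `s`.
  set ρ := s / (2 * C ^ 3 * ((1 + σ) * B)) with hρdef
  have hρ : 0 < ρ := by positivity
  obtain ⟨n₁, hn₁⟩ := hc₁.weighted_small hα₀ hα₁ hT hσ hρ
  obtain ⟨n₂, hn₂⟩ := hc₂.weighted_small hα₀ hα₁ hT hσ hρ
  obtain ⟨n₃, hn₃⟩ := exists_nat_ge (C / min δ (η / 2))
  have hfinal : 2 * (M₀ + 1) / Λ * D ≤ ε := by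
    rw [div_mul_eq_mul_div, div_le_iff₀ hΛ]
    rwa [div_le_iff₀' hε] at hΛ₂
  refine ⟨max n₁ (max n₂ n₃), fun n hn ha X₁ X₂ hX => ?_⟩
  have hmesh := TimeMesh.logConcaveMesh mesh hα₀ hα₁ hT ha
  have hstep : ∀ k ≤ n, mesh.node α T n (k + 1) - mesh.node α T n k ≤ min δ (η / 2) := by
    intro k hk
    refine ((hC n ha).1 k hk).trans ?_
    have hmin : 0 < min δ (η / 2) := lt_min hδ (by positivity)
    rw [div_le_comm₀ (by positivity) hmin]
    have : (n₃ : ℝ) ≤ n := by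
      exact_mod_cast (le_max_right _ _).trans ((le_max_right _ _).trans hn)
    linarith
  obtain ⟨r1, r2⟩ := hsol.error_bound hmesh hα₀ hα₁ hσ hκ₁ hκ₂ hℓ₁ hℓ₂ hC1 (hC n ha).1 (hC n ha).2
    hδ hη (fun k hk => (hstep k hk).trans (min_le_left _ _))
    (fun k hk => (hstep k hk).trans (min_le_right _ _)) hM₀ hρ.le (s := s)
    (by rw [hrate]; exact hcom) (by rw [hrate]; linarith)
    (le_of_eq (by rw [← hB, hρdef]; field_simp))
    (fun x hx j => (hM₁ n ha x hx j).trans hM₁₀) (fun x hx j => (hM₂ n ha x hx j).trans hM₂₀)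
    (hn₁ n ((le_max_left _ _).trans hn) ha)
    (hn₂ n ((le_max_left _ _).trans ((le_max_right _ _).trans hn)) ha) hX
  rw [hrate] at r1 r2
  refine ⟨fun x hx j => (r1 x hx j).trans (le_trans ?_ hfinal), fun x hx j =>
    (r2 x hx j).trans hfinal⟩
  exact le_mul_of_one_le_right (by positivity) hD1

theorem theorem8p1 (α T σ κ₁ κ₂ h₁ h₂ : ℝ) (hα₀ : 0 < α) (hα₁ : α < 1) (hT : 0 < T)
    (hσ : 0 < σ) (hκ₁ : 0 < κ₁) (hκ₂ : 0 < κ₂) (hh₁ : 0 < h₁) (hh₂ : 0 < h₂)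
    (mesh : TimeMesh) :
    -- stability and solvability on every admissible mesh
    (∀ n, mesh.Admissible n →
      eigenvalueMultiset ((coupledMatrix α σ (mesh.node α T n) n).map Complex.ofReal) =
          eigenvalueMultiset
            (shiftedMatrix α (mesh.node α T n) n (Complex.I / (Real.sqrt σ : ℂ))) +
          eigenvalueMultiset
            (shiftedMatrix α (mesh.node α T n) n (-(Complex.I / (Real.sqrt σ : ℂ)))) ∧
      (∀ z ∈ eigenvalueMultiset ((coupledMatrix α σ (mesh.node α T n) n).map Complex.ofReal),
        0 < z.re) ∧
      (∀ ξ : ℝ, IsUnit (coupledMatrix α σ (mesh.node α T n) n +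
        ξ ^ 2 • (1 : Matrix (StateAdjointIndex n) (StateAdjointIndex n) ℝ))) ∧
      ∀ g : StateAdjointIndex n → ℝ,
        (∃ X₁ X₂ : ℝ → StateAdjointIndex n → ℝ,
          IsSemiDiscreteSolution (coupledMatrix α σ (mesh.node α T n) n) κ₁ κ₂ h₁ h₂ g X₁ X₂) ∧
        ∀ X₁ X₂ Z₁ Z₂ : ℝ → StateAdjointIndex n → ℝ,
          IsSemiDiscreteSolution (coupledMatrix α σ (mesh.node α T n) n) κ₁ κ₂ h₁ h₂ g X₁ X₂ →
          IsSemiDiscreteSolution (coupledMatrix α σ (mesh.node α T n) n) κ₁ κ₂ h₁ h₂ g Z₁ Z₂ →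
          EqOn X₁ Z₁ (Icc (-h₁) 0) ∧ EqOn X₂ Z₂ (Icc 0 h₂)) ∧
    -- consistency and convergence for every solution of the continuous system
    (∀ (ω υ : ℝ → ℝ) (y₁ p₁ y₂ p₂ : ℝ → ℝ → ℝ),
      IsErrorSolution α T σ κ₁ κ₂ h₁ h₂ ω υ y₁ p₁ y₂ p₂ →
      L1Consistent α T (-h₁) 0 mesh y₁ p₁ ∧
      L1Consistent α T 0 h₂ mesh y₂ p₂ ∧
      ∀ ε > 0, ∃ n₀ : ℕ, ∀ n ≥ n₀, mesh.Admissible n →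
        ∀ X₁ X₂ : ℝ → StateAdjointIndex n → ℝ,
          IsSemiDiscreteSolution (coupledMatrix α σ (mesh.node α T n) n) κ₁ κ₂ h₁ h₂
            (nodalVector (mesh.node α T n) n ω υ) X₁ X₂ →
          (∀ x ∈ Icc (-h₁) 0, ∀ j,
            |X₁ x j - nodalVector (mesh.node α T n) n (y₁ x) (p₁ x) j| ≤ ε) ∧
          (∀ x ∈ Icc 0 h₂, ∀ j,
            |X₂ x j - nodalVector (mesh.node α T n) n (y₂ x) (p₂ x) j| ≤ ε)) := by
  refine ⟨fun n hn => ?_, fun ω υ y₁ p₁ y₂ p₂ hsol =>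
    ⟨hsol.left.l1Consistent mesh hα₀ hα₁ hT, hsol.right.l1Consistent mesh hα₀ hα₁ hT,
      fun ε hε => hsol.converges mesh hα₀ hα₁ hT hσ hκ₁ hκ₂ hh₁ hh₂ hε⟩⟩
  have hmesh := TimeMesh.logConcaveMesh mesh hα₀ hα₁ hT hn
  have hW := hmesh.stateAdjointWeight_pos (α := α) hσ
  have hc := half_pos (l1Floor_pos hα₁ hT)
  have hA := hmesh.coupled_coercive hα₀ hα₁ hσ
  have hA0 := fun v => (mul_nonneg hc.le (Finset.sum_nonneg fun j _ =>
    mul_nonneg (hW j).le (sq_nonneg (v j)))).trans (hA v)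
  exact ⟨eigenvalueMultiset_coupledMatrix α hσ _ n,
    fun z hz => re_pos_of_mem_eigenvalueMultiset hW hc hA hz,
    fun ξ => isUnit_add_smul_one hW hc hA ξ,
    fun g => ⟨exists_isSemiDiscreteSolution hW hA0 hκ₁ hκ₂ hh₁ hh₂ g,
      fun X₁ X₂ Z₁ Z₂ hX hZ => hX.unique hW hA0 hκ₁ hκ₂ hh₁ hh₂ hZ⟩⟩
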